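/- Let $G=(V,E)$ be a directed graph with $n=|V|$, $m=|E|$, non-negative integer edge costs at most $c$ and non-negative real edge capacities, and let $s\in V$ be a source. The distinct edge capacities are called the maximal flows. The bottleneck of a path is its minimum edge capacity, and a path accommodates a flow $f$ if its bottleneck is at least $f$. For a vertex $v\ne s$ and a maximal flow $f$ accommodated by some path from $s$ to $v$, let $d_v(f)$ be the minimum cost of such a path. Let $S[v]$ be the set of all useful pairs $(d_v(f),f)$, i.e. those for which every maximal flow $f'>f$ that is accommodated by some path from $s$ to $v$ has $d_v(f')>d_v(f)$. The Single Source Shortest Paths for All Flows problem (SSSP-AF) asks for the pairs of $S[v]$, for all $v\neq s$, each pair $(d,f)$ stored exactly once and together with a predecessor vertex, such that following the stored predecessors back to $s$ (with one memory access per edge, hence in time linear in the length of the path) yields a path from $s$ to $v$ of cost $d$ that accommodates $f$. The computational model is a random access machine, with memory initially zero outside the input, in which additions, comparisons, moves and indirect memory accesses on words of $O(\log(n+c))$ bits take unit time, and in which capacities can only be moved and compared. The input consists of $n$, $m$, $s$ and the list of the edges, in any order, with their costs and capacities. **Theorem.** There is an algorithm that solves SSSP-AF on all such inputs in $O(m^2+nc)$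 time, and there is an algorithm that solves SSSP-AF on all such inputs in $O\!\left(m^2+mn\log^{+}\frac{c}{m}\right)$ time, where $\log^{+}x=\max(0,\log x)$. Here $O(T)$ means at most $C\cdot(T+1)$ steps with an absolute constant $C$, and the second summand of the second bound is $0$ if $m=0$. -/

import Mathlib

open scoped NNReal ENNReal

/-! ### Networks, paths and the problem SSSP-AF -/

/-- A directed graph on the vertices `0, …, n - 1` with non-negative integer edge costs and
non-negative real edge capacities (only the values on edges matter). -/
structure Network (n : ℕ) where
  edges : Finset (Fin n × Fin n)
  cost : Fin n × Fin n → ℕ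
  cap : Fin n × Fin n → ℝ≥0

namespace Network

variable {n : ℕ} (G : Network n)

/-- The list of consecutive pairs of a list of vertices. -/
def pathEdges (p : List (Fin n)) : List (Fin n × Fin n) := p.zip p.tail

/-- `p` is the vertex list of a (simple, directed) path of `G` from `s` to `v`. -/
def IsPath (s v : Fin n) (p : List (Fin n)) : Prop :=
  p.head? = some s ∧ p.getLast? = some v ∧ p.Nodup ∧ ∀ e ∈ pathEdges p, e ∈ G.edges

/-- The total cost of the edges of `p`. -/
def pathCost (p : List (Fin n)) : ℕ := ((pathEdges p).map G.cost).sum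

/-- The bottleneck of `p`: its minimum edge capacity (`∞` for a path without edges). -/
noncomputable def bottleneck (p : List (Fin n)) : ℝ≥0∞ :=
  ((pathEdges p).map fun e => (G.cap e : ℝ≥0∞)).foldr min ⊤

/-- The maximal flows: the distinct edge capacities. -/
def maximalFlows : Set ℝ≥0 := {f | ∃ e ∈ G.edges, G.cap e = f}

/-- `f` is a maximal flow and `d` is the shortest distance from `s` to `v` along paths that can
accommodate the flow `f`. -/
def IsDistFlow (s v : Fin n) (d : ℕ) (f : ℝ≥0) : Prop :=
  f ∈ G.maximalFlows ∧
    IsLeast {k : ℕ | ∃ p, G.IsPath s v p ∧ (f : ℝ≥0∞) ≤ G.bottleneck p ∧ G.pathCost p = k} d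

/-- The set `S[v]` of all useful (distance, maximal flow) pairs: a longer distance is kept only if
it accommodates a greater flow, and among equal distances only the greatest flow is kept. -/
def usefulPairs (s v : Fin n) : Set (ℕ × ℝ≥0) :=
  {x | G.IsDistFlow s v x.1 x.2 ∧
    ∀ d' f', G.IsDistFlow s v d' f' → (d' < x.1 → f' < x.2) ∧ (d' = x.1 → f' ≤ x.2)}

/-- All edge costs are at most `c`. -/
def CostsBoundedBy (c : ℕ) : Prop := ∀ e ∈ G.edges, G.cost e ≤ c

/-- `L` lists every edge of `G` exactly once, in some order. -/
def Enumerates (L : List (Fin n × Fin n)) : Prop := L.Nodup ∧ ∀ e, e ∈ L ↔ e ∈ G.edges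

end Network

/-! ### A comparison-addition random access machine

The machine has registers and a memory that hold natural numbers, and a second memory that holds
capacities.  Numbers can be added and compared, capacities can only be moved and compared.  Every
instruction takes one unit of time. -/

/-- Instructions.  All operands `r`, `a`, `b` are register indices and `l` is a program line. -/
inductive Instr where
  /-- `reg r := k` -/
  | const (r k : ℕ)
  /-- `reg r := reg a` -/
  | copy (r a : ℕ)
  /-- `reg r := reg a + reg b` -/
  | add (r a b : ℕ)
  /-- `reg r := mem (reg a)` -/
  | load (r a : ℕ)
  /-- `mem (reg a) := reg r` -/
  | store (a r : ℕ)
  /-- `capMem (reg a) := capMem (reg b)` -/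
  | moveCap (a b : ℕ)
  /-- go to line `l` -/
  | jump (l : ℕ)
  /-- if `reg a < reg b`, go to line `l` -/
  | jumpLt (a b l : ℕ)
  /-- if `capMem (reg a) < capMem (reg b)`, go to line `l` -/
  | jumpCapLt (a b l : ℕ)

/-- A program is a finite list of instructions. -/
abbrev Program := List Instr

/-- Configurations of the machine. -/
structure Config where
  pc : ℕ
  reg : ℕ → ℕ
  mem : ℕ → ℕ
  capMem : ℕ → ℝ≥0

namespace Config

/-- The effect of one instruction. -/
noncomputable def exec (σ : Config) : Instr → Config
  | .const r k => { σ with pc := σ.pc + 1, reg := Function.update σ.reg r k }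
  | .copy r a => { σ with pc := σ.pc + 1, reg := Function.update σ.reg r (σ.reg a) }
  | .add r a b => { σ with pc := σ.pc + 1, reg := Function.update σ.reg r (σ.reg a + σ.reg b) }
  | .load r a => { σ with pc := σ.pc + 1, reg := Function.update σ.reg r (σ.mem (σ.reg a)) }
  | .store a r => { σ with pc := σ.pc + 1, mem := Function.update σ.mem (σ.reg a) (σ.reg r) }
  | .moveCap a b =>
      { σ with
        pc := σ.pc + 1
        capMem := Function.update σ.capMem (σ.reg a) (σ.capMem (σ.reg b)) }
  | .jump l => { σ with pc := l }
  | .jumpLt a b l => { σ with pc := if σ.reg a < σ.reg b then l else σ.pc + 1 }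
  | .jumpCapLt a b l =>
      { σ with pc := if σ.capMem (σ.reg a) < σ.capMem (σ.reg b) then l else σ.pc + 1 }

/-- The machine has halted: the program counter points to no line of the program. -/
def Halted (P : Program) (σ : Config) : Prop := P.length ≤ σ.pc

/-- One step; a halted machine does not change any more. -/
noncomputable def step (P : Program) (σ : Config) : Config :=
  match P[σ.pc]? with
  | none => σ
  | some i => σ.exec i

/-- The configuration after `t` steps. -/
noncomputable def run (P : Program) (t : ℕ) (σ : Config) : Config := (step P)^[t] σ

/-- All words in the registers and in the memory are at most `W`. -/
def WordsAtMost (W : ℕ) (σ : Config) : Prop := (∀ i, σ.reg i ≤ W) ∧ ∀ a, σ.mem a ≤ W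

end Config

/-! ### Input and output -/

/-- The input: memory holds `n`, `m`, `s`, followed by tail, head and cost of each listed edge; the
capacity memory holds the capacities in the same order; everything else is `0`. -/
noncomputable def inputConfig {n : ℕ} (G : Network n) (s : Fin n) (L : List (Fin n × Fin n)) :
    Config where
  pc := 0
  reg := fun _ => 0
  mem := fun a =>
    ([n, L.length, s.val] ++ L.flatMap fun e => [e.1.val, e.2.val, G.cost e]).getD a 0
  capMem := fun a => (L.map G.cap).getD a 0

/-- A record at address `a ≠ 0` consists of `mem a` (a distance `d`), `capMem a` (a flow `f`),
`mem (a + 1)` (a predecessor vertex `u`), `mem (a + 2)` (the address of the record of `u` at which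
the path continues backwards) and `mem (a + 3)` (the address of the next record of the list, or
`0`).  `RecordList mem a l`: `l` is the list of the addresses of the linked list that starts
at `a`. -/
inductive RecordList (mem : ℕ → ℕ) : ℕ → List ℕ → Prop
  | nil : RecordList mem 0 []
  | cons {a : ℕ} {l : List ℕ} : a ≠ 0 → RecordList mem (mem (a + 3)) l →
      RecordList mem a (a :: l)

/-- `Retrieves mem s R v a p`: starting at the record `a` in the list `R v` of `v`, and following
the stored predecessors back to `s`, one record per vertex, one reads off the vertex list `p`. -/
inductive Retrieves {n : ℕ} (mem : ℕ → ℕ) (s : Fin n) (R : Fin n → List ℕ) :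
    Fin n → ℕ → List (Fin n) → Prop
  | source {v : Fin n} {a : ℕ} : a ∈ R v → mem (a + 1) = s.val → Retrieves mem s R v a [s, v]
  | step {u v : Fin n} {a : ℕ} {p : List (Fin n)} : a ∈ R v → mem (a + 1) = u.val → u ≠ s →
      Retrieves mem s R u (mem (a + 2)) p → Retrieves mem s R v a (p ++ [v])

/-- The configuration `σ` holds a solution of SSSP-AF for `G` and `s`: register `0` is the address
of an array with one entry for each vertex; for each `v ≠ s` the entry of `v` is the start of a
linked list of records which holds each useful pair of `v` exactly once (and nothing else), and
from each of its records `(d, f)` one retrieves a path from `s` to `v` of cost `d` that can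
accommodate the flow `f`. -/
def IsSolution {n : ℕ} (G : Network n) (s : Fin n) (σ : Config) : Prop :=
  ∃ R : Fin n → List ℕ, ∀ v : Fin n, v ≠ s →
    RecordList σ.mem (σ.mem (σ.reg 0 + v.val)) (R v) ∧
    ((R v).map fun a => (σ.mem a, σ.capMem a)).Nodup ∧
    {x | x ∈ (R v).map fun a => (σ.mem a, σ.capMem a)} = G.usefulPairs s v ∧
    ∀ a ∈ R v, ∃ p : List (Fin n), Retrieves σ.mem s R v a p ∧ G.IsPath s v p ∧
      G.pathCost p = σ.mem a ∧ (σ.capMem a : ℝ≥0∞) ≤ G.bottleneck p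

/-- The program `P` solves SSSP-AF in time `O(T n m c)`, with words of `O(log (n + c))` bits, on all
directed graphs with `n` vertices and `m` edges whose costs are at most `c`. -/
def SolvesInTime (P : Program) (T : ℕ → ℕ → ℕ → ℝ) : Prop :=
  ∃ C K : ℕ, ∀ (n c : ℕ) (G : Network n) (s : Fin n) (L : List (Fin n × Fin n)),
    G.CostsBoundedBy c → G.Enumerates L →
    (∃ t : ℕ, (t : ℝ) ≤ C * (T n G.edges.card c + 1) ∧
      ((inputConfig G s L).run P t).Halted P ∧ IsSolution G s ((inputConfig G s L).run P t)) ∧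
    ∀ t : ℕ, ((inputConfig G s L).run P t).WordsAtMost ((n + c + 2) ^ K)

/-! Take `m` copies of the graph, one for each edge `i`: copy `i` keeps only the edges whose
capacity is at least that of `i`. For the flow `f` of the edge `i`, the distance from the source to
the node `(i, v)` of this layered graph is `d_v(f)`. A single run of Dijkstra's algorithm, with one
common queue, searches all copies at once. The nodes that belong to a vertex `v` are then settled in
order of nondecreasing distance, so that the latest record of `v` has the greatest distance and the
greatest flow so far. A newly settled node matters only if its flow is greater still: with a greater
distance it opens a new record, with an equal distance it overwrites the latest one. If its flow is
not greater, then its distance equals that of the latest record, because a smaller flow never has a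
longer distance (`record_spec`). There are at most `m * m` relaxations, and at most `m * min n (m +
1)` nodes can be reached.

The queue exploits that all relevant distances are at most `m * mx`, where `mx` is the largest cost.
Let `Q` be the least power of two with `mx ≤ m * Q`. The range of distances then splits into `O(m *
m + 1)` top buckets of width `Q`, which can be scanned one by one. The items of the opened top
bucket are spread over levels whose widths halve down to one. When a level is redistributed, the
bounds of the later levels are set anew from its minimum, and an item only ever moves to later
levels. So every item moves `O(1 + log⁺ (mx / m))` times. `QI` is the invariant of this queue,
`QI.openLevel` its central step, and `Inst.pot` the potential that pays for everything.

A record points to a record of the preceding vertex. Costs may be zero and records may be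
overwritten, so the target of a pointer can change after the pointer was set, but only to a greater
flow at the same distance. Along the pointers the flow never decreases, and where it stays constant
the time of the last write (`ρ`) decreases. Hence the pointers lead back to the source; they never
return to a vertex, since among the records of one vertex a smaller distance comes with a smaller
flow (`Network.retrieves`).

The algorithm is written in a small structured language and compiled to the machine; `Cmd.code_spec`
shows that this costs a constant factor. As the machine can neither multiply nor subtract, products
and predecessors of numbers are tabulated. Correctness and running time are proved together through
weakest preconditions with a potential. `Inst.total_le_real` yields the bound with the logarithm,
and `log⁺ x ≤ x` turns it into the bound `m ^ 2 + n * c`, so one program serves both claims. -/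

set_option linter.constructorNameAsVariable false

/-! ### A structured language with arrays -/

/-- Variables of the structured language. -/
inductive Vr
  | n | m | s | i | p | q | u | v | w | r | mx | em | pp | qq | kk | j | t | e | cur | cnt | rc
  | c | x | y | d | l | f | g | h | a | ad
  deriving DecidableEq

/-- Arrays of the structured language. The first four are the fields of the output records. -/
inductive Ar
  | rd | rp | rr | rn | key | lev | pv | pr | nx | ci | cv | hh | ub | pw | dec | row
  | ah | an | hd | wt | wh | cx | hr | rf
  deriving DecidableEq

theorem Vr.ctorIdx_injective : Function.Injective Vr.ctorIdx :=
  Function.LeftInverse.injective Vr.ofNat_ctorIdx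

theorem Ar.ctorIdx_injective : Function.Injective Ar.ctorIdx :=
  Function.LeftInverse.injective Ar.ofNat_ctorIdx

/-- The arrays are interleaved with stride `32`, which must exceed their number for the cells to be
distinct. A power of two is chosen because the machine can compute the multiple by five doublings.
-/
theorem Ar.ctorIdx_lt (k : Ar) : k.ctorIdx < 32 := by cases k <;> decide

/-- Expressions. -/
inductive Ex
  | v (x : Vr)
  | c (k : ℕ)
  | add (a b : Ex)
  | get (k : Ar) (e : Ex)
  | inp (e : Ex)
  | adr (e : Ex)

/-- Conditions. -/
inductive Cd
  | lt (a b : Ex)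
  | capLt (a b : Ex)

/-- Commands. -/
inductive Cmd
  | skip
  | asg (x : Vr) (e : Ex)
  | put (k : Ar) (i e : Ex)
  | out (i e : Ex)
  | cap (i j : Ex)
  | seq (a b : Cmd)
  | ite (c : Cd) (a b : Cmd)
  | loop (c : Cd) (a : Cmd)

/-- The data on which the semantics depends: the number of vertices and edges, a bound on the words,
the input numbers and the input capacities. -/
structure Env where
  n : ℕ
  m : ℕ
  W : ℕ
  inp : ℕ → ℕ
  cp : ℕ → ℝ≥0

/-- Address of the output array. -/
def Env.O (E : Env) : ℕ := 3 + (E.m + E.m + E.m)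

/-- Base address of the interleaved arrays. -/
def Env.B (E : Env) : ℕ := E.O + E.n

/-- States of the structured language: variables, arrays, the output array and the capacities of
the records. -/
structure St where
  v : Vr → ℕ
  a : Ar → ℕ → ℕ
  o : ℕ → ℕ
  rc : ℕ → ℝ≥0

namespace St

def setV (s : St) (x : Vr) (k : ℕ) : St := { s with v := Function.update s.v x k }

def setA (s : St) (k : Ar) (i x : ℕ) : St :=
  { s with a := Function.update s.a k (Function.update (s.a k) i x) }

def setO (s : St) (i x : ℕ) : St := { s with o := Function.update s.o i x }

def setC (s : St) (i : ℕ) (x : ℝ≥0) : St := { s with rc := Function.update s.rc i x }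

end St

namespace Ex

def ev (E : Env) (s : St) : Ex → ℕ
  | v x => s.v x
  | c k => k
  | add a b => a.ev E s + b.ev E s
  | get k e => s.a k (e.ev E s)
  | inp e => E.inp (e.ev E s)
  | adr e => E.B + 32 * e.ev E s

/-- No word exceeds the bound, and only input cells are read by `inp`. -/
def ok (E : Env) (s : St) : Ex → Prop
  | v _ => True
  | c k => k ≤ E.W
  | add a b => a.ok E s ∧ b.ok E s ∧ a.ev E s + b.ev E s ≤ E.W
  | get _ e => e.ok E s
  | inp e => e.ok E s ∧ e.ev E s < E.O
  | adr e => e.ok E s ∧ E.B + 32 * e.ev E s ≤ E.W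

end Ex

namespace Cd

def ev (E : Env) (s : St) : Cd → Prop
  | lt a b => a.ev E s < b.ev E s
  | capLt a b => E.cp (a.ev E s) < E.cp (b.ev E s)

def ok (E : Env) (s : St) : Cd → Prop
  | lt a b => a.ok E s ∧ b.ok E s
  | capLt a b => a.ok E s ∧ b.ok E s ∧ a.ev E s < E.m ∧ b.ev E s < E.m

end Cd

/-- Big-step semantics with a step count. -/
inductive Exec (E : Env) : Cmd → St → ℕ → St → Prop
  | skip {s} : Exec E .skip s 0 s
  | asg {x e s} : e.ok E s → Exec E (.asg x e) s 1 (s.setV x (e.ev E s))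
  | put {k i e s} : i.ok E s → e.ok E s →
      Exec E (.put k i e) s 1 (s.setA k (i.ev E s) (e.ev E s))
  | out {i e s} : i.ok E s → e.ok E s → i.ev E s < E.n →
      Exec E (.out i e) s 1 (s.setO (i.ev E s) (e.ev E s))
  | cap {i j s} : i.ok E s → j.ok E s → j.ev E s < E.m →
      Exec E (.cap i j) s 1 (s.setC (i.ev E s) (E.cp (j.ev E s)))
  | seq {a b s t s' t' s''} : Exec E a s t s' → Exec E b s' t' s'' →
      Exec E (.seq a b) s (t + t') s''
  | iteT {c a b s t s'} : c.ok E s → c.ev E s → Exec E a s t s' → Exec E (.ite c a b) s (t + 1) s'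
  | iteF {c a b s t s'} : c.ok E s → ¬ c.ev E s → Exec E b s t s' →
      Exec E (.ite c a b) s (t + 1) s'
  | loopT {c a s t s' t' s''} : c.ok E s → c.ev E s → Exec E a s t s' →
      Exec E (.loop c a) s' t' s'' → Exec E (.loop c a) s (t + t' + 1) s''
  | loopF {c a s} : c.ok E s → ¬ c.ev E s → Exec E (.loop c a) s 1 s

/-! ### Compilation -/

/-- The register of a variable. -/
def Vr.reg (x : Vr) : ℕ := 2 * x.ctorIdx + 2

/-- Scratch registers. -/
def scr (t : ℕ) : ℕ := 2 * t + 3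

/-- Replace an index in a scratch register by `B + 32 * index`. -/
def addrCode (t : ℕ) : List Instr :=
  [.add (scr t) (scr t) (scr t), .add (scr t) (scr t) (scr t), .add (scr t) (scr t) (scr t),
    .add (scr t) (scr t) (scr t), .add (scr t) (scr t) (scr t), .add (scr t) (scr t) 1]

def Ex.comp : Ex → ℕ → List Instr
  | v x, t => [.copy (scr t) x.reg]
  | c k, t => [.const (scr t) k]
  | add a b, t => a.comp t ++ (b.comp (t + 1) ++ [.add (scr t) (scr t) (scr (t + 1))])
  | get k e, t => e.comp t ++ (addrCode t ++
      [.const (scr (t + 1)) k.ctorIdx, .add (scr t) (scr t) (scr (t + 1)), .load (scr t) (scr t)])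
  | inp e, t => e.comp t ++ [.load (scr t) (scr t)]
  | adr e, t => e.comp t ++ addrCode t

def Cd.comp : Cd → List Instr
  | lt a b => a.comp 0 ++ b.comp 1
  | capLt a b => a.comp 0 ++ b.comp 1

def Cd.jump : Cd → ℕ → Instr
  | lt _ _, l => .jumpLt (scr 0) (scr 1) l
  | capLt _ _, l => .jumpCapLt (scr 0) (scr 1) l

/-- The code of a command that starts at a given line. -/
def Cmd.code : Cmd → ℕ → List Instr
  | skip, _ => []
  | asg x e, _ => e.comp 0 ++ [.copy x.reg (scr 0)]
  | put k i e, _ => i.comp 0 ++ (e.comp 1 ++ (addrCode 0 ++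
      [.const (scr 2) k.ctorIdx, .add (scr 0) (scr 0) (scr 2), .store (scr 0) (scr 1)]))
  | out i e, _ => i.comp 0 ++ (e.comp 1 ++ [.add (scr 0) (scr 0) 0, .store (scr 0) (scr 1)])
  | cap i j, _ => i.comp 0 ++ (j.comp 1 ++ (addrCode 0 ++ [.moveCap (scr 0) (scr 1)]))
  | seq a b, p => a.code p ++ b.code (p + (a.code p).length)
  | ite c a b, p =>
      c.comp ++ (c.jump (p + c.comp.length + 1 +
          (b.code (p + c.comp.length + 1)).length + 1) ::
        (b.code (p + c.comp.length + 1) ++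
          (.jump (p + c.comp.length + 1 + (b.code (p + c.comp.length + 1)).length + 1 +
              (a.code (p + c.comp.length + 1 +
                (b.code (p + c.comp.length + 1)).length + 1)).length) ::
            a.code (p + c.comp.length + 1 + (b.code (p + c.comp.length + 1)).length + 1))))
  | loop c a, p =>
      c.comp ++ (c.jump (p + c.comp.length + 2) ::
        (.jump (p + c.comp.length + 2 + (a.code (p + c.comp.length + 2)).length + 1) ::
          (a.code (p + c.comp.length + 2) ++ [.jump p])))

/-! ### Runs of the machine -/

/-- `l` is the part of the program `P` that starts at line `p`. -/
def CodeAt (P : Program) (p : ℕ) (l : List Instr) : Prop :=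
  ∃ A B : List Instr, P = A ++ (l ++ B) ∧ A.length = p

theorem CodeAt.left {P p l l'} (h : CodeAt P p (l ++ l')) : CodeAt P p l := by
  obtain ⟨A, B, h, h'⟩ := h
  exact ⟨A, l' ++ B, by simp [h], h'⟩

theorem CodeAt.right {P p l l'} (h : CodeAt P p (l ++ l')) : CodeAt P (p + l.length) l' := by
  obtain ⟨A, B, h, h'⟩ := h
  exact ⟨A ++ l, B, by simp [h], by simp [h']⟩

theorem CodeAt.tail {P p i l} (h : CodeAt P p (i :: l)) : CodeAt P (p + 1) l :=
  CodeAt.right (l := [i]) h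

theorem CodeAt.head {P p i l} (h : CodeAt P p (i :: l)) : P[p]? = some i := by
  obtain ⟨A, B, h, h'⟩ := h
  simp [h, ← h']

/-- `P` goes from `σ` to `σ'` in `T` steps, and all words on the way are at most `W`. -/
def Runs (P : Program) (W T : ℕ) (σ σ' : Config) : Prop :=
  σ.run P T = σ' ∧ ∀ T' ≤ T, (σ.run P T').WordsAtMost W

theorem Config.run_add (P : Program) (T T' : ℕ) (σ : Config) :
    σ.run P (T + T') = (σ.run P T).run P T' := by
  simp only [Config.run]
  rw [Nat.add_comm, Function.iterate_add_apply]

theorem Runs.trans {P W T T' σ σ' σ''} (h : Runs P W T σ σ') (h' : Runs P W T' σ' σ'') :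
    Runs P W (T + T') σ σ'' := by
  refine ⟨by rw [Config.run_add, h.1, h'.1], fun t ht => ?_⟩
  rcases le_total t T with h1 | h1
  · exact h.2 t h1
  · obtain ⟨k, rfl⟩ := Nat.exists_eq_add_of_le h1
    rw [Config.run_add, h.1]
    exact h'.2 k (by omega)

theorem Runs.words {P W T σ σ'} (h : Runs P W T σ σ') : σ'.WordsAtMost W := h.1 ▸ h.2 T le_rfl

theorem Runs.refl {P W σ} (h : σ.WordsAtMost W) : Runs P W 0 σ σ :=
  ⟨rfl, fun t ht => by obtain rfl : t = 0 := by omega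
                       exact h⟩

theorem Runs.single {P : Program} {W σ i} (hi : P[σ.pc]? = some i) (h : σ.WordsAtMost W)
    (h' : (σ.exec i).WordsAtMost W) : Runs P W 1 σ (σ.exec i) := by
  have e : σ.run P 1 = σ.exec i := by simp [Config.run, Config.step, hi]
  refine ⟨e, fun t ht => ?_⟩
  interval_cases t
  · exact h
  · rw [e]; exact h'

/-- The configuration after a register has been set. -/
def Config.setReg (σ : Config) (r x : ℕ) : Config :=
  { σ with pc := σ.pc + 1, reg := Function.update σ.reg r x }

theorem Config.WordsAtMost.setReg {W σ r x} (h : Config.WordsAtMost W σ) (hx : x ≤ W) :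
    (σ.setReg r x).WordsAtMost W := by
  refine ⟨fun i => ?_, h.2⟩
  by_cases hi : i = r
  · subst hi; simpa [Config.setReg] using hx
  · simpa [Config.setReg, Function.update_of_ne hi] using h.1 i

theorem Runs.setReg {P : Program} {W : ℕ} {σ : Config} {i : Instr} {r x : ℕ}
    (hi : P[σ.pc]? = some i) (h : σ.WordsAtMost W)
    (he : σ.exec i = σ.setReg r x) (hx : x ≤ W) : Runs P W 1 σ (σ.setReg r x) :=
  he ▸ Runs.single hi h (he ▸ h.setReg hx)

/-- `σ'` arises from `σ` by running straight-line code that only changes scratch registers with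
index at least `t`. -/
structure Frame (σ σ' : Config) (t len : ℕ) : Prop where
  pc : σ'.pc = σ.pc + len
  mem : σ'.mem = σ.mem
  cap : σ'.capMem = σ.capMem
  reg : ∀ r, (∀ t' ≥ t, r ≠ scr t') → σ'.reg r = σ.reg r

theorem Frame.trans {σ σ' σ'' t t' len len'} (h : Frame σ σ' t len) (h' : Frame σ' σ'' t' len')
    (ht : t ≤ t') : Frame σ σ'' t (len + len') where
  pc := by rw [h'.pc, h.pc, Nat.add_assoc]
  mem := h'.mem.trans h.mem
  cap := h'.cap.trans h.cap
  reg r hr := (h'.reg r fun t'' h'' => hr t'' (le_trans ht h'')).trans (h.reg r hr)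

theorem Frame.setReg (σ : Config) {t t' : ℕ} (h : t ≤ t') (x : ℕ) :
    Frame σ (σ.setReg (scr t') x) t 1 where
  pc := rfl
  mem := rfl
  cap := rfl
  reg _ hr := Function.update_of_ne (hr t' h) _ _

theorem scr_ne {t t' : ℕ} (h : t ≠ t') : scr t ≠ scr t' := by unfold scr; omega

theorem Frame.scr {σ σ' t len} (h : Frame σ σ' t len) {t' : ℕ} (ht : t' < t) :
    σ'.reg (scr t') = σ.reg (scr t') := h.reg _ fun _ h' => scr_ne (by omega)

/-! ### Simulation -/

/-- Bound on the words of the machine. -/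
def Env.WW (E : Env) : ℕ := E.B + 32 * E.W + 64

/-- The configuration `σ` represents the state `s`. -/
structure Sim (E : Env) (s : St) (σ : Config) : Prop where
  r0 : σ.reg 0 = E.O
  r1 : σ.reg 1 = E.B
  v : ∀ x : Vr, σ.reg x.reg = s.v x
  a : ∀ (k : Ar) i, σ.mem (E.B + 32 * i + k.ctorIdx) = s.a k i
  o : ∀ i < E.n, σ.mem (E.O + i) = s.o i
  inp : ∀ i < E.O, σ.mem i = E.inp i
  rc : ∀ i, σ.capMem (E.B + 32 * i) = s.rc i
  cp : ∀ i < E.m, σ.capMem i = E.cp i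
  words : σ.WordsAtMost E.WW
  vle : ∀ x, s.v x ≤ E.W
  ale : ∀ k i, s.a k i ≤ E.W
  ile : ∀ i < E.O, E.inp i ≤ E.W

/-- Parity separates them: variables occupy even registers from `2` on and scratch values odd
registers from `3` on, while `0` and `1` hold the two base addresses. -/
theorem Vr.reg_ne_scr (x : Vr) (t : ℕ) : x.reg ≠ scr t := by unfold Vr.reg scr; omega

theorem Sim.frame {E s σ σ' t len} (h : Sim E s σ) (f : Frame σ σ' t len)
    (hw : σ'.WordsAtMost E.WW) : Sim E s σ' where
  r0 := by rw [f.reg 0 fun t' _ => by unfold scr; omega, h.r0]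
  r1 := by rw [f.reg 1 fun t' _ => by unfold scr; omega, h.r1]
  v x := by rw [f.reg _ fun t' _ => x.reg_ne_scr t', h.v]
  a k i := by rw [f.mem, h.a]
  o i hi := by rw [f.mem, h.o i hi]
  inp i hi := by rw [f.mem, h.inp i hi]
  rc i := by rw [f.cap, h.rc]
  cp i hi := by rw [f.cap, h.cp i hi]
  words := hw
  vle := h.vle
  ale := h.ale
  ile := h.ile

theorem Ex.ev_le {E s σ} (h : Sim E s σ) : ∀ e : Ex, e.ok E s → e.ev E s ≤ E.W
  | .v x, _ => h.vle x
  | .c _, hk => hk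
  | .add _ _, hk => hk.2.2
  | .get k _, _ => h.ale k _
  | .inp _, hk => h.ile _ hk.2
  | .adr _, hk => hk.2

theorem Runs.add {P : Program} {W : ℕ} {σ : Config} {r a b x : ℕ}
    (hi : P[σ.pc]? = some (.add r a b)) (h : σ.WordsAtMost W)
    (he : σ.reg a + σ.reg b = x) (hx : x ≤ W) : Runs P W 1 σ (σ.setReg r x) :=
  Runs.setReg hi h (by simp [Config.exec, Config.setReg, he]) hx

theorem addrCode_spec {E : Env} {P : Program} {σ : Config} {t : ℕ} (hw : σ.WordsAtMost E.WW)
    (h1 : σ.reg 1 = E.B) (hc : CodeAt P σ.pc (addrCode t)) (hx : σ.reg (scr t) ≤ E.W) :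
    ∃ σ', Runs P E.WW (addrCode t).length σ σ' ∧ Frame σ σ' t (addrCode t).length ∧
      σ'.reg (scr t) = E.B + 32 * σ.reg (scr t) ∧ ∀ t', t' ≠ t → σ'.reg (scr t') = σ.reg (scr t') := by
  have key : ∀ (σ : Config) (r' x : ℕ), σ.WordsAtMost E.WW →
      P[σ.pc]? = some (.add (scr t) (scr t) r') → σ.reg (scr t) + σ.reg r' = x → x ≤ E.WW →
      Runs P E.WW 1 σ (σ.setReg (scr t) x) := fun σ r' x hw hi he hx => Runs.add hi hw he hx
  have get : ∀ (σ : Config) (x : ℕ), (σ.setReg (scr t) x).reg (scr t) = x := fun σ x => by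
    simp [Config.setReg]
  have pcs : ∀ (σ : Config) (x : ℕ), (σ.setReg (scr t) x).pc = σ.pc + 1 := fun σ x => rfl
  have get1 : ∀ (σ : Config) (x : ℕ), (σ.setReg (scr t) x).reg 1 = σ.reg 1 := fun σ x =>
    Function.update_of_ne (show (1 : ℕ) ≠ scr t by unfold scr; omega) x σ.reg
  have get2 : ∀ (σ : Config) (x t' : ℕ), t' ≠ t →
      (σ.setReg (scr t) x).reg (scr t') = σ.reg (scr t') := fun σ x t' ht =>
    Function.update_of_ne (scr_ne ht) _ _
  set x := σ.reg (scr t) with hxd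
  have hW : E.WW = E.B + 32 * E.W + 64 := rfl
  have R1 := key σ (scr t) (2 * x) hw hc.head (by omega) (by omega)
  have R2 := key _ (scr t) (4 * x) R1.words hc.tail.head (by simp only [get]; omega) (by omega)
  have R3 := key _ (scr t) (8 * x) R2.words hc.tail.tail.head (by simp only [get]; omega) (by omega)
  have R4 := key _ (scr t) (16 * x) R3.words hc.tail.tail.tail.head (by simp only [get]; omega)
    (by omega)
  have R5 := key _ (scr t) (32 * x) R4.words hc.tail.tail.tail.tail.head
    (by simp only [get]; omega) (by omega)
  have R6 := key _ 1 (E.B + 32 * x) R5.words hc.tail.tail.tail.tail.tail.head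
    (by simp only [get, get1]; omega) (by omega)
  have F := fun (σ : Config) (x : ℕ) => Frame.setReg σ (le_refl t) x
  refine ⟨_, ((((R1.trans R2).trans R3).trans R4).trans R5).trans R6, ?_, get _ _, ?_⟩
  · exact (((((F _ _).trans (F _ _) le_rfl).trans (F _ _) le_rfl).trans (F _ _) le_rfl).trans
      (F _ _) le_rfl).trans (F _ _) le_rfl
  · intro t' ht
    simp only [get2 _ _ t' ht]

/-- The code for index `t` touches only scratch registers from `t` on. Therefore the left summand in
`scr t` survives while the right one is evaluated with index `t + 1`. -/
theorem Ex.comp_spec {E : Env} {P : Program} {s : St} (e : Ex) :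
    ∀ {σ : Config} {t : ℕ}, Sim E s σ → CodeAt P σ.pc (e.comp t) → e.ok E s →
    ∃ σ', Runs P E.WW (e.comp t).length σ σ' ∧ Frame σ σ' t (e.comp t).length ∧
      σ'.reg (scr t) = e.ev E s := by
  have hW : E.WW = E.B + 32 * E.W + 64 := rfl
  induction e with
  | v x =>
    intro σ t h hc _
    have hx : s.v x ≤ E.WW := by have := h.vle x; omega
    exact ⟨_, Runs.setReg hc.head h.words (by simp [Config.exec, Config.setReg, h.v]) hx,
      Frame.setReg σ le_rfl _, by simp [Config.setReg, Ex.ev]⟩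
  | c k =>
    intro σ t h hc hk
    have hx : k ≤ E.WW := by have : k ≤ E.W := hk; omega
    exact ⟨_, Runs.setReg hc.head h.words (by simp [Config.exec, Config.setReg]) hx,
      Frame.setReg σ le_rfl _, by simp [Config.setReg, Ex.ev]⟩
  | add a b iha ihb =>
    intro σ t h hc hk
    obtain ⟨σ1, R1, F1, V1⟩ := iha h hc.left hk.1
    have h1 := h.frame F1 R1.words
    have hc1 := hc.right
    rw [← F1.pc] at hc1
    obtain ⟨σ2, R2, F2, V2⟩ := ihb h1 hc1.left hk.2.1
    have hc2 := hc1.right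
    rw [← F2.pc] at hc2
    have R3 := Runs.add (x := a.ev E s + b.ev E s) hc2.head R2.words
      (by rw [F2.scr (Nat.lt_succ_self t), V1, V2]) (by have := hk.2.2; omega)
    refine ⟨σ2.setReg (scr t) (a.ev E s + b.ev E s), ?_, ?_, ?_⟩
    · simp only [Ex.comp, List.length_append, List.length_cons, List.length_nil]
      exact R1.trans (R2.trans R3)
    · simp only [Ex.comp, List.length_append, List.length_cons, List.length_nil]
      rw [← Nat.add_assoc]
      exact (F1.trans F2 (Nat.le_succ t)).trans (Frame.setReg σ2 (le_refl t) _) le_rfl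
    · simp [Config.setReg, Ex.ev]
  | get k e ih =>
    intro σ t h hc hk
    obtain ⟨σ1, R1, F1, V1⟩ := ih h hc.left hk
    have h1 := h.frame F1 R1.words
    have hc1 := hc.right
    rw [← F1.pc] at hc1
    have hle := Ex.ev_le h e hk
    obtain ⟨σ2, R2, F2, V2, -⟩ := addrCode_spec R1.words h1.r1 hc1.left (V1 ▸ hle)
    have h2 := h1.frame F2 R2.words
    have hc2 := hc1.right
    rw [← F2.pc] at hc2
    have hk32 := k.ctorIdx_lt
    rw [V1] at V2
    have R3 := Runs.setReg (r := scr (t + 1)) (x := k.ctorIdx) hc2.head h2.words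
      (by simp [Config.exec, Config.setReg]) (by omega)
    have n1 : scr t ≠ scr (t + 1) := scr_ne (by omega)
    have R4 := Runs.add (x := E.B + 32 * e.ev E s + k.ctorIdx) hc2.tail.head R3.words
      (by simp [Config.setReg, Function.update_of_ne n1, V2]) (by omega)
    have hale : s.a k (e.ev E s) ≤ E.WW := by have := h.ale k (e.ev E s); omega
    have R5 := Runs.setReg (r := scr t) (x := s.a k (e.ev E s)) hc2.tail.tail.head R4.words
      (by simp [Config.exec, Config.setReg, h2.a]) hale
    refine ⟨((σ2.setReg (scr (t + 1)) k.ctorIdx).setReg (scr t)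
      (E.B + 32 * e.ev E s + k.ctorIdx)).setReg (scr t) (s.a k (e.ev E s)), ?_, ?_, ?_⟩
    · simp only [Ex.comp, List.length_append, List.length_cons, List.length_nil]
      exact R1.trans (R2.trans ((R3.trans R4).trans R5))
    · simp only [Ex.comp, List.length_append, List.length_cons, List.length_nil]
      exact F1.trans (F2.trans (((Frame.setReg σ2 (Nat.le_succ t) _).trans
        (Frame.setReg _ (le_refl t) _) le_rfl).trans (Frame.setReg _ (le_refl t) _) le_rfl)
        le_rfl) le_rfl
    · simp [Config.setReg, Ex.ev]
  | inp e ih =>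
    intro σ t h hc hk
    obtain ⟨σ1, R1, F1, V1⟩ := ih h hc.left hk.1
    have h1 := h.frame F1 R1.words
    have hc1 := hc.right
    rw [← F1.pc] at hc1
    have hile : E.inp (e.ev E s) ≤ E.WW := by have := h.ile _ hk.2; omega
    have R5 := Runs.setReg (r := scr t) (x := E.inp (e.ev E s)) hc1.head R1.words
      (by simp [Config.exec, Config.setReg, V1, h1.inp _ hk.2]) hile
    refine ⟨σ1.setReg (scr t) (E.inp (e.ev E s)), ?_, ?_, ?_⟩
    · simp only [Ex.comp, List.length_append, List.length_cons, List.length_nil]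
      exact R1.trans R5
    · simp only [Ex.comp, List.length_append, List.length_cons, List.length_nil]
      exact F1.trans (Frame.setReg σ1 (le_refl t) _) le_rfl
    · simp [Config.setReg, Ex.ev]
  | adr e ih =>
    intro σ t h hc hk
    obtain ⟨σ1, R1, F1, V1⟩ := ih h hc.left hk.1
    have h1 := h.frame F1 R1.words
    have hc1 := hc.right
    rw [← F1.pc] at hc1
    have hle := Ex.ev_le h e hk.1
    obtain ⟨σ2, R2, F2, V2, -⟩ := addrCode_spec R1.words h1.r1 hc1 (V1 ▸ hle)
    refine ⟨σ2, ?_, ?_, ?_⟩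
    · simp only [Ex.comp, List.length_append]
      exact R1.trans R2
    · simp only [Ex.comp, List.length_append]
      exact F1.trans F2 le_rfl
    · rw [V2, V1, Ex.ev]

theorem Config.WordsAtMost.step {W} {σ : Config} (h : σ.WordsAtMost W) {i : Instr}
    (hr : (σ.exec i).reg = σ.reg) (hm : ∀ a, (σ.exec i).mem a ≤ W) : (σ.exec i).WordsAtMost W :=
  ⟨fun r => by rw [hr]; exact h.1 r, hm⟩

/-- Two expressions evaluated one after the other. -/
theorem Ex.comp_spec₂ {E : Env} {P : Program} {s : St} {σ : Config} (a b : Ex) (h : Sim E s σ)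
    (hc : CodeAt P σ.pc (a.comp 0 ++ b.comp 1)) (ha : a.ok E s) (hb : b.ok E s) :
    ∃ σ', Runs P E.WW (a.comp 0 ++ b.comp 1).length σ σ' ∧ Sim E s σ' ∧
      σ'.pc = σ.pc + (a.comp 0 ++ b.comp 1).length ∧
      σ'.reg (scr 0) = a.ev E s ∧ σ'.reg (scr 1) = b.ev E s := by
  obtain ⟨σ1, R1, F1, V1⟩ := a.comp_spec h hc.left ha
  have h1 := h.frame F1 R1.words
  have hc1 := hc.right
  rw [← F1.pc] at hc1
  obtain ⟨σ2, R2, F2, V2⟩ := b.comp_spec h1 hc1 hb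
  refine ⟨σ2, ?_, h1.frame F2 R2.words, ?_, ?_, V2⟩
  · simpa using R1.trans R2
  · rw [F2.pc, F1.pc, List.length_append, Nat.add_assoc]
  · rw [F2.scr Nat.zero_lt_one, V1]

theorem Cd.comp_spec {E : Env} {P : Program} {s : St} {σ : Config} (c : Cd) (h : Sim E s σ)
    {l : ℕ} {rest : List Instr} (hc : CodeAt P σ.pc (c.comp ++ c.jump l :: rest))
    (hk : c.ok E s) :
    ∃ σ', Runs P E.WW (c.comp.length + 1) σ σ' ∧ Sim E s σ' ∧
      (c.ev E s → σ'.pc = l) ∧ (¬ c.ev E s → σ'.pc = σ.pc + c.comp.length + 1) := by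
  cases c with
  | lt a b =>
    obtain ⟨σ1, R1, h1, p1, V1, V2⟩ := Ex.comp_spec₂ a b h hc.left hk.1 hk.2
    have hc1 := hc.right
    have p1' : σ1.pc = σ.pc + (Cd.comp (.lt a b)).length := p1
    rw [← p1'] at hc1
    have R2 := Runs.single hc1.head h1.words (h1.words.step rfl h1.words.2)
    refine ⟨_, R1.trans R2, ⟨h1.r0, h1.r1, h1.v, h1.a, h1.o, h1.inp, h1.rc, h1.cp,
      R2.words, h1.vle, h1.ale, h1.ile⟩, fun hv => ?_, fun hv => ?_⟩
    · exact if_pos (by rw [V1, V2]; exact hv)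
    · exact (if_neg (by rw [V1, V2]; exact hv)).trans (by rw [p1'])
  | capLt a b =>
    obtain ⟨σ1, R1, h1, p1, V1, V2⟩ := Ex.comp_spec₂ a b h hc.left hk.1 hk.2.1
    have hc1 := hc.right
    have p1' : σ1.pc = σ.pc + (Cd.comp (.capLt a b)).length := p1
    rw [← p1'] at hc1
    have R2 := Runs.single hc1.head h1.words (h1.words.step rfl h1.words.2)
    refine ⟨_, R1.trans R2, ⟨h1.r0, h1.r1, h1.v, h1.a, h1.o, h1.inp, h1.rc, h1.cp,
      R2.words, h1.vle, h1.ale, h1.ile⟩, fun hv => ?_, fun hv => ?_⟩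
    · refine if_pos ?_
      rw [V1, V2, h1.cp _ hk.2.2.1, h1.cp _ hk.2.2.2]
      exact hv
    · refine (if_neg ?_).trans (by rw [p1'])
      rw [V1, V2, h1.cp _ hk.2.2.1, h1.cp _ hk.2.2.2]
      exact hv

theorem Env.m_lt_O (E : Env) : E.m < E.O := by unfold Env.O; omega

theorem Sim.jump {E s σ l} (h : Sim E s σ) {P : Program} (hi : P[σ.pc]? = some (.jump l)) :
    ∃ σ', Runs P E.WW 1 σ σ' ∧ Sim E s σ' ∧ σ'.pc = l := by
  have R := Runs.single hi h.words (h.words.step rfl h.words.2)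
  exact ⟨_, R, ⟨h.r0, h.r1, h.v, h.a, h.o, h.inp, h.rc, h.cp,
      R.words, h.vle, h.ale, h.ile⟩, rfl⟩

/-- The position enters only through jump targets, never through the number of lines. So the length
at line `0` bounds the code of a command wherever it is placed. -/
theorem Cmd.code_length (c : Cmd) : ∀ p q, (c.code p).length = (c.code q).length := by
  induction c with
  | seq a b iha ihb =>
    intro p q
    simp only [Cmd.code, List.length_append]
    rw [iha p q, ihb _ (q + (a.code q).length)]
  | ite c a b iha ihb =>
    intro p q
    simp only [Cmd.code, List.length_append, List.length_cons]
    rw [ihb _ (q + c.comp.length + 1), iha _ (q + c.comp.length + 1 +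
      (b.code (q + c.comp.length + 1)).length + 1)]
  | loop c a ih =>
    intro p q
    simp only [Cmd.code, List.length_append, List.length_cons]
    rw [ih _ (q + c.comp.length + 2)]
  | _ => intros; rfl

/-- Between two counted steps no line of the code runs twice, so `Λ` machine steps suffice for each
counted step as soon as `Λ` is at least the length of the code. The induction follows the derivation
of `Exec`; for a loop the code is re-entered at its first line. -/
theorem Cmd.code_spec {E : Env} {P : Program} {Λ : ℕ} {c : Cmd} {s s' : St} {t : ℕ}
    (hx : Exec E c s t s') : ∀ {σ : Config}, Sim E s σ → CodeAt P σ.pc (c.code σ.pc) →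
    (c.code 0).length ≤ Λ →
    ∃ T σ', T ≤ Λ * t ∧ Runs P E.WW T σ σ' ∧ Sim E s' σ' ∧
      σ'.pc = σ.pc + (c.code σ.pc).length := by
  have hW : E.WW = E.B + 32 * E.W + 64 := rfl
  induction hx with
  | skip =>
    intro σ h _ _
    exact ⟨0, σ, Nat.zero_le _, Runs.refl h.words, h, rfl⟩
  | @asg x e s hk =>
    intro σ h hc hΛ
    obtain ⟨σ1, R1, F1, V1⟩ := e.comp_spec h hc.left hk
    have h1 := h.frame F1 R1.words
    have hc1 := hc.right
    rw [← F1.pc] at hc1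
    have hle := Ex.ev_le h e hk
    have R2 := Runs.setReg (r := x.reg) (x := e.ev E s) hc1.head R1.words
      (by simp [Config.exec, Config.setReg, V1]) (by omega)
    refine ⟨_, _, ?_, R1.trans R2, ?_, ?_⟩
    · have := hΛ
      simpa [Cmd.code] using this
    · have hne : ∀ r, r ≠ x.reg → (σ1.setReg x.reg (e.ev E s)).reg r = σ1.reg r :=
        fun r hr => Function.update_of_ne hr _ _
      refine ⟨?_, ?_, fun y => ?_, h1.a, h1.o, h1.inp, h1.rc, h1.cp, R2.words, fun y => ?_,
        h1.ale, h1.ile⟩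
      · rw [hne _ (by unfold Vr.reg; omega), h1.r0]
      · rw [hne _ (by unfold Vr.reg; omega), h1.r1]
      · by_cases hy : y = x
        · subst hy; simp [Config.setReg, St.setV]
        · have : y.reg ≠ x.reg := fun e => hy (Vr.ctorIdx_injective (by unfold Vr.reg at e; omega))
          rw [hne _ this, h1.v]
          simp [St.setV, Function.update_of_ne hy]
      · by_cases hy : y = x
        · subst hy; simpa [St.setV] using hle
        · simpa [St.setV, Function.update_of_ne hy] using h.vle y
    · simp [Config.setReg, F1.pc, Cmd.code, Nat.add_assoc]
  | @put k i e s hi he =>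
    intro σ h hc hΛ
    obtain ⟨σ1, R1, h1, p1, V1, V2⟩ := Ex.comp_spec₂ i e h
      (by have := hc; simp only [Cmd.code] at this; rw [← List.append_assoc] at this
          exact this.left) hi he
    have hc1 := hc
    simp only [Cmd.code] at hc1
    rw [← List.append_assoc] at hc1
    have hc1 := hc1.right
    rw [← p1] at hc1
    have hle := Ex.ev_le h i hi
    have hle' := Ex.ev_le h e he
    obtain ⟨σ2, R2, F2, V3, V4⟩ := addrCode_spec R1.words h1.r1 hc1.left (V1 ▸ hle)
    have h2 := h1.frame F2 R2.words
    have hc2 := hc1.right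
    rw [← F2.pc] at hc2
    have hk32 := k.ctorIdx_lt
    rw [V1] at V3
    have V5 := V4 1 (by omega)
    rw [V2] at V5
    have R3 := Runs.setReg (r := scr 2) (x := k.ctorIdx) hc2.head h2.words
      (by simp [Config.exec, Config.setReg]) (by omega)
    have h3 := h2.frame (Frame.setReg σ2 (Nat.zero_le 2) _) R3.words
    have n1 : scr 0 ≠ scr 2 := scr_ne (by omega)
    have n2 : scr 1 ≠ scr 2 := scr_ne (by omega)
    have n3 : scr 1 ≠ scr 0 := scr_ne (by omega)
    have R4 := Runs.add (x := E.B + 32 * i.ev E s + k.ctorIdx) hc2.tail.head R3.words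
      (by simp [Config.setReg, Function.update_of_ne n1, V3]) (by omega)
    have h4 := h3.frame (Frame.setReg _ (Nat.zero_le 0) _) R4.words
    set σ4 := (σ2.setReg (scr 2) k.ctorIdx).setReg (scr 0) (E.B + 32 * i.ev E s + k.ctorIdx)
      with hσ4
    have A4 : σ4.reg (scr 0) = E.B + 32 * i.ev E s + k.ctorIdx := by simp [hσ4, Config.setReg]
    have B4 : σ4.reg (scr 1) = e.ev E s := by
      simp [hσ4, Config.setReg, Function.update_of_ne n2, Function.update_of_ne n3, V5]
    have hex : σ4.exec (.store (scr 0) (scr 1)) = { σ4 with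
        pc := σ4.pc + 1
        mem := Function.update σ4.mem (E.B + 32 * i.ev E s + k.ctorIdx) (e.ev E s) } := by
      simp [Config.exec, A4, B4]
    have R5 := Runs.single hc2.tail.tail.head h4.words (by
      refine h4.words.step rfl fun b => ?_
      rw [hex]
      by_cases hb : b = E.B + 32 * i.ev E s + k.ctorIdx
      · subst hb; simp only [Function.update_self]; omega
      · simpa [Function.update_of_ne hb] using h4.words.2 b)
    refine ⟨_, _, ?_, R1.trans (R2.trans (R3.trans (R4.trans R5))), ?_, ?_⟩
    · have := hΛ
      simp only [Cmd.code, List.length_append, List.length_cons, List.length_nil] at this ⊢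
      omega
    · have hO : E.O ≤ E.B := Nat.le_add_right _ _
      have hwd := R5.words
      rw [hex] at hwd ⊢
      refine ⟨h4.r0, h4.r1, h4.v, fun k' i' => ?_, fun i' hi' => ?_, fun i' hi' => ?_, h4.rc, h4.cp,
        hwd, h.vle, fun k' i' => ?_, h.ile⟩
      · by_cases hk' : k' = k
        · subst hk'
          by_cases hi' : i' = i.ev E s
          · subst hi'; simp [St.setA]
          · have : E.B + 32 * i' + k'.ctorIdx ≠ E.B + 32 * i.ev E s + k'.ctorIdx := by omega
            simp [St.setA, Function.update_of_ne this, Function.update_of_ne hi', h4.a]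
        · have hkk : k'.ctorIdx ≠ k.ctorIdx := fun e => hk' (Ar.ctorIdx_injective e)
          have := k'.ctorIdx_lt
          have : E.B + 32 * i' + k'.ctorIdx ≠ E.B + 32 * i.ev E s + k.ctorIdx := by omega
          simp [St.setA, Function.update_of_ne this, Function.update_of_ne hk', h4.a]
      · have : E.O + i' ≠ E.B + 32 * i.ev E s + k.ctorIdx := by
          have : E.B = E.O + E.n := rfl
          omega
        simp [St.setA, Function.update_of_ne this, h4.o i' hi']
      · have : i' ≠ E.B + 32 * i.ev E s + k.ctorIdx := by omega
        simp [Function.update_of_ne this, h4.inp i' hi']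
      · by_cases hk' : k' = k
        · subst hk'
          by_cases hi' : i' = i.ev E s
          · subst hi'; simpa [St.setA] using hle'
          · simpa [St.setA, Function.update_of_ne hi'] using h.ale k' i'
        · simpa [St.setA, Function.update_of_ne hk'] using h.ale k' i'
    · rw [hex]
      simp only [hσ4, Config.setReg, F2.pc, p1, Cmd.code, List.length_append, List.length_cons,
        List.length_nil]
      omega
  | @out i e s hi he hn =>
    intro σ h hc hΛ
    obtain ⟨σ1, R1, h1, p1, V1, V2⟩ := Ex.comp_spec₂ i e h
      (by have := hc; simp only [Cmd.code] at this; rw [← List.append_assoc] at this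
          exact this.left) hi he
    have hc1 := hc
    simp only [Cmd.code] at hc1
    rw [← List.append_assoc] at hc1
    have hc1 := hc1.right
    rw [← p1] at hc1
    have hle' := Ex.ev_le h e he
    have hB : E.B = E.O + E.n := rfl
    have n3 : scr 1 ≠ scr 0 := scr_ne (by omega)
    have R4 := Runs.add (x := E.O + i.ev E s) hc1.head R1.words
      (by rw [V1, h1.r0, Nat.add_comm]) (by omega)
    have h4 := h1.frame (Frame.setReg _ (Nat.zero_le 0) _) R4.words
    set σ4 := σ1.setReg (scr 0) (E.O + i.ev E s) with hσ4
    have A4 : σ4.reg (scr 0) = E.O + i.ev E s := by simp [hσ4, Config.setReg]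
    have B4 : σ4.reg (scr 1) = e.ev E s := by
      simp [hσ4, Config.setReg, Function.update_of_ne n3, V2]
    have hex : σ4.exec (.store (scr 0) (scr 1)) = { σ4 with
        pc := σ4.pc + 1
        mem := Function.update σ4.mem (E.O + i.ev E s) (e.ev E s) } := by
      simp [Config.exec, A4, B4]
    have R5 := Runs.single hc1.tail.head h4.words (by
      refine h4.words.step rfl fun b => ?_
      rw [hex]
      by_cases hb : b = E.O + i.ev E s
      · subst hb; simp only [Function.update_self]; omega
      · simpa [Function.update_of_ne hb] using h4.words.2 b)
    refine ⟨_, _, ?_, R1.trans (R4.trans R5), ?_, ?_⟩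
    · have := hΛ
      simp only [Cmd.code, List.length_append, List.length_cons, List.length_nil] at this ⊢
      omega
    · have hwd := R5.words
      rw [hex] at hwd ⊢
      refine ⟨h4.r0, h4.r1, h4.v, fun k' i' => ?_, fun i' hi' => ?_, fun i' hi' => ?_, h4.rc, h4.cp,
        hwd, h.vle, h.ale, h.ile⟩
      · have : E.B + 32 * i' + k'.ctorIdx ≠ E.O + i.ev E s := by omega
        simp [St.setO, Function.update_of_ne this, h4.a]
      · by_cases hi'' : i' = i.ev E s
        · subst hi''; simp [St.setO]
        · have : E.O + i' ≠ E.O + i.ev E s := by omega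
          simp [St.setO, Function.update_of_ne this, Function.update_of_ne hi'', h4.o i' hi']
      · have : i' ≠ E.O + i.ev E s := by omega
        simp [Function.update_of_ne this, h4.inp i' hi']
    · rw [hex]
      simp only [hσ4, Config.setReg, p1, Cmd.code, List.length_append, List.length_cons,
        List.length_nil]
      omega
  | @cap i j s hi hj hm =>
    intro σ h hc hΛ
    obtain ⟨σ1, R1, h1, p1, V1, V2⟩ := Ex.comp_spec₂ i j h
      (by have := hc; simp only [Cmd.code] at this; rw [← List.append_assoc] at this
          exact this.left) hi hj
    have hc1 := hc
    simp only [Cmd.code] at hc1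
    rw [← List.append_assoc] at hc1
    have hc1 := hc1.right
    rw [← p1] at hc1
    have hle := Ex.ev_le h i hi
    obtain ⟨σ2, R2, F2, V3, V4⟩ := addrCode_spec R1.words h1.r1 hc1.left (V1 ▸ hle)
    have h2 := h1.frame F2 R2.words
    have hc2 := hc1.right
    rw [← F2.pc] at hc2
    rw [V1] at V3
    have V5 := V4 1 (by omega)
    rw [V2] at V5
    have hex : σ2.exec (.moveCap (scr 0) (scr 1)) = { σ2 with
        pc := σ2.pc + 1
        capMem := Function.update σ2.capMem (E.B + 32 * i.ev E s) (E.cp (j.ev E s)) } := by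
      simp [Config.exec, V3, V5, h2.cp _ hm]
    have R5 := Runs.single hc2.head h2.words (h2.words.step rfl h2.words.2)
    refine ⟨_, _, ?_, R1.trans (R2.trans R5), ?_, ?_⟩
    · have := hΛ
      simp only [Cmd.code, List.length_append, List.length_cons, List.length_nil] at this ⊢
      omega
    · have hwd := R5.words
      rw [hex] at hwd ⊢
      refine ⟨h2.r0, h2.r1, h2.v, h2.a, h2.o, h2.inp, fun i' => ?_, fun i' hi' => ?_,
        hwd, h.vle, h.ale, h.ile⟩
      · by_cases hi' : i' = i.ev E s
        · subst hi'; simp [St.setC]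
        · have : E.B + 32 * i' ≠ E.B + 32 * i.ev E s := by omega
          simp [St.setC, Function.update_of_ne this, Function.update_of_ne hi', h2.rc]
      · have : i' ≠ E.B + 32 * i.ev E s := by
          have := E.m_lt_O
          have : E.B = E.O + E.n := rfl
          omega
        simp [Function.update_of_ne this, h2.cp i' hi']
    · rw [hex]
      simp only [F2.pc, p1, Cmd.code, List.length_append, List.length_cons, List.length_nil]
      omega
  | @seq a b s t s' t' s'' _ _ iha ihb =>
    intro σ h hc hΛ
    simp only [Cmd.code, List.length_append] at hΛ
    rw [b.code_length _ 0] at hΛ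
    obtain ⟨T1, σ1, l1, R1, h1, p1⟩ := iha h hc.left (by omega)
    have hc1 := hc.right
    rw [← p1] at hc1
    obtain ⟨T2, σ2, l2, R2, h2, p2⟩ := ihb h1 hc1 (by omega)
    refine ⟨_, σ2, ?_, R1.trans R2, h2, ?_⟩
    · rw [Nat.mul_add]; omega
    · simp only [p2, p1, Cmd.code, List.length_append]; omega
  | @iteT c a b s t s' hk hv _ ih =>
    intro σ h hc hΛ
    simp only [Cmd.code, List.length_append, List.length_cons] at hΛ
    rw [b.code_length _ 0, a.code_length _ 0] at hΛ
    obtain ⟨σ1, R1, h1, p1, -⟩ := c.comp_spec h hc hk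
    have hc1 := hc.right.tail.right.tail
    rw [← p1 hv] at hc1
    obtain ⟨T2, σ2, l2, R2, h2, p2⟩ := ih h1 (by rw [p1 hv] at hc1 ⊢; exact hc1) (by omega)
    refine ⟨_, σ2, ?_, R1.trans R2, h2, ?_⟩
    · rw [Nat.mul_add]; omega
    · rw [p2, p1 hv]; simp only [Cmd.code, List.length_append, List.length_cons]; omega
  | @iteF c a b s t s' hk hv _ ih =>
    intro σ h hc hΛ
    simp only [Cmd.code, List.length_append, List.length_cons] at hΛ
    rw [b.code_length _ 0, a.code_length _ 0] at hΛ
    obtain ⟨σ1, R1, h1, -, p1⟩ := c.comp_spec h hc hk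
    have hc1 := hc.right.tail
    rw [← p1 hv] at hc1
    obtain ⟨T2, σ2, l2, R2, h2, p2⟩ := ih h1 hc1.left (by omega)
    have hc2 := hc1.right
    rw [← p2] at hc2
    obtain ⟨σ3, R3, h3, p3⟩ := h2.jump hc2.head
    refine ⟨_, σ3, ?_, R1.trans (R2.trans R3), h3, ?_⟩
    · rw [Nat.mul_add]; omega
    · have e1 := b.code_length σ1.pc (σ.pc + c.comp.length + 1)
      have e0 := p1 hv
      have e2 := a.code_length (σ2.pc + 1) (σ.pc + c.comp.length + 1 +
        (b.code (σ.pc + c.comp.length + 1)).length + 1)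
      simp only [Cmd.code, List.length_append, List.length_cons]
      omega
  | @loopT c a s t s' t' s'' hk hv _ _ iha ihb =>
    intro σ h hc hΛ
    have hΛ' := hΛ
    simp only [Cmd.code, List.length_append, List.length_cons] at hΛ
    rw [a.code_length _ 0] at hΛ
    obtain ⟨σ1, R1, h1, p1, -⟩ := c.comp_spec h hc hk
    have hc1 := hc.right.tail.tail
    obtain ⟨T2, σ2, l2, R2, h2, p2⟩ := iha h1 (by rw [p1 hv]; exact hc1.left)
      (by omega)
    have hc2 := hc1.right
    rw [p1 hv] at p2
    rw [show σ.pc + c.comp.length + 1 + 1 = σ.pc + c.comp.length + 2 by rfl, ← p2] at hc2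
    obtain ⟨σ3, R3, h3, p3⟩ := h2.jump hc2.head
    obtain ⟨T4, σ4, l4, R4, h4, p4⟩ := ihb h3 (by rw [p3]; exact hc) hΛ'
    refine ⟨_, σ4, ?_, R1.trans (R2.trans (R3.trans R4)), h4, ?_⟩
    · rw [Nat.mul_add, Nat.mul_add]; omega
    · rw [p4, p3]
  | @loopF c a s hk hv =>
    intro σ h hc hΛ
    simp only [Cmd.code, List.length_append, List.length_cons] at hΛ
    obtain ⟨σ1, R1, h1, -, p1⟩ := c.comp_spec h hc hk
    have hc1 := hc.right.tail
    rw [← p1 hv] at hc1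
    obtain ⟨σ3, R3, h3, p3⟩ := h1.jump hc1.head
    refine ⟨_, σ3, ?_, R1.trans R3, h3, ?_⟩
    · omega
    · rw [p3]; simp only [Cmd.code, List.length_append, List.length_cons, List.length_nil]; omega

/-! ### The queue -/

/-- The invariant of the queue. There are levels `1, …, K`, of which `1` is the opened top bucket
`[e, e + Q)` and `K` holds the items with key `cur`; the top bucket that starts at `e'` has the list
`lst (K + 1 + e')`. `lev x` is the level of the item `x` (`0` if it has not been seen), and the keys
at level `l` are at least `ub (l + 1)` and below `ub l`. `S` is the set of settled items, the levels
after `j` are empty, and `rem` are the items of level `r` which are being redistributed. -/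
structure QI (K Q : ℕ) (key lev ub : ℕ → ℕ) (lst : ℕ → List ℕ) (S : Finset ℕ) (e cur j : ℕ)
    (rem : List ℕ) (r : ℕ) : Prop where
  K2 : 2 ≤ K
  hQ : Q = 2 ^ (K - 2)
  j1 : 1 ≤ j
  jK : j ≤ K
  eQ : Q ∣ e
  levK : ∀ x, lev x ≤ K
  Sk : ∀ x ∈ S, lev x = K ∧ key x ≤ cur
  Uc : ∀ x, x ∉ S → lev x ≠ 0 → cur ≤ key x
  emp : ∀ i, j < i → i ≤ K → lst i = []
  fin : ∀ x ∈ lst K, lev x = K ∧ x ∉ S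
  nd : (lst K).Nodup
  cov2 : ∀ x, x ∉ S → 2 ≤ lev x → ¬ (x ∈ rem ∧ lev x = r) → x ∈ lst (lev x)
  -- Level `1` also comprises the items of the unopened top buckets, so upper bounds make sense only
  -- from level `2` on.
  up : ∀ x i, x ∉ S → 2 ≤ i → i ≤ lev x → key x < ub i
  low : ∀ x, x ∉ S → 2 ≤ lev x → lev x < K → ¬ (x ∈ rem ∧ lev x = r) → ub (lev x + 1) ≤ key x
  cov1 : ∀ x, x ∉ S → lev x = 1 → ¬ (x ∈ rem ∧ lev x = r) →
    (x ∈ lst 1 ∧ e ≤ key x) ∨ ∃ e', Q ∣ e' ∧ e + Q ≤ e' ∧ e' ≤ key x ∧ x ∈ lst (K + 1 + e')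
  -- Deletion is lazy: an item that moves on leaves its entries behind, and an entry of the list `l`
  -- is stale once the level of its item exceeds `l`.
  ent : ∀ l x, 1 ≤ l → l ≤ K → x ∈ lst l → l ≤ lev x
  ent1 : ∀ x ∈ lst 1, key x < e + Q
  entT : ∀ e', ∀ x ∈ lst (K + 1 + e'), 1 ≤ lev x ∧ key x < e' + Q
  ex : ∀ x ∈ rem, r ≤ lev x ∧ (lev x = r → x ∉ S ∧ key x < ub (r + 1))
  -- Permitted widths halve from level to level; this is what makes `log Q` levels suffice.
  ubw : ∀ i, 2 ≤ i → i < K → ub i ≤ ub (i + 1) + 2 ^ (K - (i + 1))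
  ub1 : ub 1 = e + Q
  -- `j = 1` means that the opened bucket has not been distributed or is exhausted. Otherwise `ub 2`
  -- separates the opened bucket from all later ones.
  ph : 1 < j → ub 2 = e + Q ∧ e ≤ cur ∧ cur < e + Q ∧ lst 1 = []
  ubK : ub K ≤ cur + 1
  -- A sentinel: no key lies below it, so the search for a level stops at `K`.
  ub0 : ub (K + 1) = 0

namespace QI

variable {K Q : ℕ} {key lev ub : ℕ → ℕ} {lst : ℕ → List ℕ} {S : Finset ℕ} {e cur j : ℕ}
  {rem : List ℕ} {r : ℕ}

theorem Q_pos (h : QI K Q key lev ub lst S e cur j rem r) : 0 < Q := by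
  rw [h.hQ]; positivity

/-- All unsettled items have keys which are at least `e`. -/
theorem e_le (h : QI K Q key lev ub lst S e cur j [] r) {x : ℕ} (hx : x ∉ S) (hl : lev x ≠ 0) :
    e ≤ key x := by
  by_cases hj : 1 < j
  · exact (h.ph hj).2.1.trans (h.Uc x hx hl)
  · have hj1 : j = 1 := by have := h.j1; omega
    by_cases h2 : 2 ≤ lev x
    · have := h.cov2 x hx h2 (by simp)
      rw [h.emp _ (by omega) (h.levK x)] at this
      simp at this
    · rcases h.cov1 x hx (by omega) (by simp) with h' | ⟨e', -, h1, h2, -⟩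
      · exact h'.2
      · omega

theorem down (h : QI K Q key lev ub lst S e cur j [] r) (hj : lst j = []) (h1 : 1 < j) :
    QI K Q key lev ub lst S e cur (j - 1) [] r :=
  { h with
    j1 := by omega
    jK := by have := h.jK; omega
    emp := fun i hi hK => by
      rcases (show j = i ∨ j < i by omega) with rfl | h'
      · exact hj
      · exact h.emp i h' hK
    ph := fun _ => h.ph h1 }

/-- With all levels empty, every seen unsettled item lies in a later top bucket. The bucket starts
are multiples of `Q`, so those other than `e + Q` are at least `e + Q + Q`, and the invariant holds
for the next bucket. -/
theorem advance (h : QI K Q key lev ub lst S e cur 1 [] r) (hl : lst 1 = []) :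
    QI K Q key lev (Function.update ub 1 (e + Q + Q))
      (Function.update (Function.update lst 1 (lst (K + 1 + (e + Q)))) (K + 1 + (e + Q)) [])
      S (e + Q) cur 1 [] r := by
  have hK2 := h.K2
  have hne : (1 : ℕ) ≠ K + 1 + (e + Q) := by omega
  have u : ∀ i, 2 ≤ i → Function.update ub 1 (e + Q + Q) i = ub i := fun i hi =>
    Function.update_of_ne (by omega) _ _
  set lst' := Function.update (Function.update lst 1 (lst (K + 1 + (e + Q)))) (K + 1 + (e + Q)) []
    with hlst'
  have l1 : lst' 1 = lst (K + 1 + (e + Q)) := by simp [lst', Function.update_of_ne hne]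
  have lK : ∀ i, 2 ≤ i → i ≤ K → lst' i = lst i := fun i hi hiK => by
    have a1 : i ≠ 1 := by omega
    have a2 : i ≠ K + 1 + (e + Q) := by omega
    simp [lst', Function.update_of_ne a1, Function.update_of_ne a2]
  have lT : ∀ e', e' ≠ e + Q → lst' (K + 1 + e') = lst (K + 1 + e') := fun e' he => by
    have a1 : K + 1 + e' ≠ 1 := by omega
    have a2 : K + 1 + e' ≠ K + 1 + (e + Q) := by omega
    simp [lst', Function.update_of_ne a1, Function.update_of_ne a2]
  have lT' : lst' (K + 1 + (e + Q)) = [] := by simp [lst']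
  refine { h with
    eQ := ?_, emp := ?_, fin := ?_, nd := ?_, cov2 := ?_, up := ?_, low := ?_, cov1 := ?_
    ent := ?_, ent1 := ?_, entT := ?_, ex := ?_, ubw := ?_, ub1 := ?_, ph := ?_, ubK := ?_
    ub0 := ?_ }
  · exact dvd_add h.eQ dvd_rfl
  · intro i hi hK
    rw [lK i hi hK, h.emp i hi hK]
  · rw [lK K hK2 le_rfl]; exact h.fin
  · rw [lK K hK2 le_rfl]; exact h.nd
  · intro x hx h2 hn
    rw [lK _ h2 (h.levK x)]
    exact h.cov2 x hx h2 hn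
  · intro x i hx h2 hi
    rw [u i h2]
    exact h.up x i hx h2 hi
  · intro x hx h2 hi hn
    rw [u _ (by omega)]
    exact h.low x hx h2 hi hn
  · intro x hx h1 hn
    rcases h.cov1 x hx h1 hn with h' | ⟨e', d, a, b, c⟩
    · rw [hl] at h'; simp at h'
    · rcases eq_or_ne e' (e + Q) with rfl | he
      · left; rw [l1]; exact ⟨c, b⟩
      · right
        refine ⟨e', d, ?_, b, by rw [lT e' he]; exact c⟩
        obtain ⟨p, rfl⟩ := h.eQ
        obtain ⟨p', rfl⟩ := d
        have : p + 1 < p' := by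
          have hQ := h.Q_pos
          have : Q * (p + 1) < Q * p' := by
            rw [Nat.mul_add, Nat.mul_one]; omega
          exact Nat.lt_of_mul_lt_mul_left this
        have := Nat.mul_le_mul_left Q (show p + 2 ≤ p' from this)
        rw [Nat.mul_add] at this
        omega
  · intro l x h1 h2 hx
    rcases (show l = 1 ∨ 2 ≤ l by omega) with rfl | h2'
    · rw [l1] at hx
      exact (h.entT _ x hx).1
    · rw [lK l h2' h2] at hx
      exact h.ent l x h1 h2 hx
  · intro x hx
    rw [l1] at hx
    exact (h.entT _ x hx).2
  · intro e' x hx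
    rcases eq_or_ne e' (e + Q) with rfl | he
    · rw [lT'] at hx; simp at hx
    · rw [lT e' he] at hx
      exact h.entT e' x hx
  · simp
  · intro i h2 hi
    rw [u i h2, u _ (by omega)]
    exact h.ubw i h2 hi
  · simp
  · simp
  · rw [u K hK2]; exact h.ubK
  · rw [u _ (by omega)]; exact h.ub0

/-- If all entries of a list are stale, it covers no item: each unsettled item is covered by the
list of its own level or by a top bucket. -/
theorem clear (h : QI K Q key lev ub lst S e cur j [] r) (hj : ∀ x ∈ lst j, lev x ≠ j)
    (hjK : j < K) : QI K Q key lev ub (Function.update lst j []) S e cur j [] r := by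
  have sub : ∀ l x, x ∈ Function.update lst j [] l → x ∈ lst l := fun l x hx => by
    rcases eq_or_ne l j with rfl | hl
    · simp at hx
    · rwa [Function.update_of_ne hl] at hx
  have keep : ∀ l x, x ∈ lst l → l ≠ j → x ∈ Function.update lst j [] l := fun l x hx hl => by
    rwa [Function.update_of_ne hl]
  have hnK : K ≠ j := by omega
  have hj1 := h.j1
  refine { h with
    emp := ?_, fin := ?_, nd := ?_, cov2 := ?_, cov1 := ?_, ent := ?_, ent1 := ?_
    entT := ?_, ph := ?_ }
  · intro i hi hK
    rw [Function.update_of_ne (by omega)]; exact h.emp i hi hK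
  · exact fun x hx => h.fin x (sub _ x hx)
  · rw [Function.update_of_ne hnK]; exact h.nd
  · intro x hx h2 hn
    have := h.cov2 x hx h2 hn
    exact keep _ x this fun e => hj x (e ▸ this) e
  · intro x hx h1 hn
    rcases h.cov1 x hx h1 hn with h' | ⟨e', d, a, b, c⟩
    · exact Or.inl ⟨keep _ x h'.1 fun e => hj x (e ▸ h'.1) (h1.trans e), h'.2⟩
    · exact Or.inr ⟨e', d, a, b, keep _ x c (by omega)⟩
  · exact fun l x h1 h2 hx => h.ent l x h1 h2 (sub _ x hx)
  · exact fun x hx => h.ent1 x (sub _ x hx)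
  · exact fun e' x hx => h.entT e' x (sub _ x hx)
  · intro h1
    obtain ⟨a, b, c, d⟩ := h.ph h1
    refine ⟨a, b, c, ?_⟩
    rw [Function.update_of_ne (by omega)]; exact d

/-- At the last level the key is squeezed by `cur ≤ key x < ub K ≤ cur + 1`. The list of that level
has neither stale nor repeated entries, as no level follows it. -/
theorem pop (h : QI K Q key lev ub lst S e cur K [] r) {x : ℕ} {t : List ℕ} (hx : lst K = x :: t) :
    QI K Q key lev ub (Function.update lst K t) (insert x S) e cur K [] r ∧ x ∉ S ∧ lev x = K ∧
      key x = cur := by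
  have hK2 := h.K2
  obtain ⟨hxK, hxS⟩ := h.fin x (by simp [hx])
  have hkey : key x = cur := by
    have h1 := h.Uc x hxS (by omega)
    have h2 := h.up x K hxS hK2 hxK.ge
    have h3 := h.ubK
    omega
  have hnd := h.nd
  rw [hx, List.nodup_cons] at hnd
  have sub : ∀ l y, y ∈ Function.update lst K t l → y ∈ lst l := fun l y hy => by
    rcases eq_or_ne l K with rfl | hl
    · rw [Function.update_self] at hy; rw [hx]; exact List.mem_cons_of_mem _ hy
    · rwa [Function.update_of_ne hl] at hy
  have keep : ∀ l y, y ∈ lst l → y ≠ x → y ∈ Function.update lst K t l := fun l y hy hyx => by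
    rcases eq_or_ne l K with rfl | hl
    · rw [hx] at hy
      rw [Function.update_self]
      exact (List.mem_cons.1 hy).resolve_left hyx
    · rwa [Function.update_of_ne hl]
  have nS : ∀ y, y ∉ insert x S → y ∉ S ∧ y ≠ x := fun y hy => by
    rw [Finset.mem_insert, not_or] at hy; exact ⟨hy.2, hy.1⟩
  refine ⟨{ h with
    Sk := ?_, Uc := ?_, emp := ?_, fin := ?_, nd := ?_, cov2 := ?_, up := ?_, low := ?_
    cov1 := ?_, ent := ?_, ent1 := ?_, entT := ?_, ex := ?_, ph := ?_ },
    hxS, hxK, hkey⟩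
  · intro y hy
    rcases Finset.mem_insert.1 hy with rfl | hy
    · exact ⟨hxK, hkey.le⟩
    · exact h.Sk y hy
  · exact fun y hy => h.Uc y (nS y hy).1
  · intro i hi hK; omega
  · intro y hy
    have := h.fin y (sub _ y hy)
    refine ⟨this.1, ?_⟩
    rw [Finset.mem_insert, not_or]
    refine ⟨?_, this.2⟩
    rintro rfl
    rw [Function.update_self] at hy
    exact hnd.1 hy
  · rw [Function.update_self]; exact hnd.2
  · exact fun y hy h2 hn => keep _ y (h.cov2 y (nS y hy).1 h2 hn) (nS y hy).2
  · exact fun y i hy => h.up y i (nS y hy).1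
  · exact fun y hy => h.low y (nS y hy).1
  · intro y hy h1 hn
    rcases h.cov1 y (nS y hy).1 h1 hn with h' | ⟨e', d, a, b, c⟩
    · exact Or.inl ⟨keep _ y h'.1 (nS y hy).2, h'.2⟩
    · exact Or.inr ⟨e', d, a, b, keep _ y c (nS y hy).2⟩
  · exact fun l y h1 h2 hy => h.ent l y h1 h2 (sub _ y hy)
  · exact fun y hy => h.ent1 y (sub _ y hy)
  · exact fun e' y hy => h.entT e' y (sub _ y hy)
  · simp
  · intro h1
    obtain ⟨a, b, c, d⟩ := h.ph h1
    refine ⟨a, b, c, ?_⟩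
    rw [Function.update_of_ne (by omega)]; exact d

/-- The minimum `key x₀` of level `j` is the minimum of the whole queue, because earlier levels only
hold greater keys and later ones are empty. Level `j + 1` inherits the upper bound of level `j`; the
later bounds are placed at distances `2 ^ (K - i)` above the minimum, so the last level holds
exactly the keys equal to it. The entries of level `j` become the list `rem` that is still to be
distributed. -/
theorem openLevel (h : QI K Q key lev ub lst S e cur j [] r) (hjK : j < K) {x₀ : ℕ}
    (hx₀ : x₀ ∈ lst j) (hl₀ : lev x₀ = j) (hmin : ∀ x ∈ lst j, lev x = j → key x₀ ≤ key x)
    {ub' : ℕ → ℕ} (u1 : ub' (j + 1) = ub j)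
    (u2 : ∀ i, j + 2 ≤ i → i ≤ K → ub' i = key x₀ + 2 ^ (K - i))
    (u3 : ∀ i, i ≤ j ∨ K < i → ub' i = ub i) :
    QI K Q key lev ub' (Function.update lst j []) S e (key x₀) K (lst j) j := by
  have hK2 := h.K2
  have hj1 := h.j1
  have hS₀ : x₀ ∉ S := fun hx => by have := (h.Sk _ hx).1; omega
  have hlev : ∀ x, x ∉ S → lev x ≤ j := fun x hx => by
    by_contra hc
    have := h.cov2 x hx (by omega) (by simp)
    rw [h.emp _ (by omega) (h.levK x)] at this
    simp at this
  have e₀ : e ≤ key x₀ := h.e_le hS₀ (by omega)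
  have e₁ : key x₀ < e + Q := by
    rcases (show j = 1 ∨ 1 < j by omega) with rfl | hj
    · exact h.ent1 _ hx₀
    · rw [← (h.ph hj).1]; exact h.up _ _ hS₀ le_rfl (by omega)
  have hc := h.Uc _ hS₀ (by omega)
  have sub : ∀ l x, x ∈ Function.update lst j [] l → x ∈ lst l := fun l x hx => by
    rcases eq_or_ne l j with rfl | hl
    · simp at hx
    · rwa [Function.update_of_ne hl] at hx
  have keep : ∀ l x, x ∈ lst l → l ≠ j → x ∈ Function.update lst j [] l := fun l x hx hl => by
    rwa [Function.update_of_ne hl]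
  have lK : lst K = [] := h.emp K hjK le_rfl
  have lK' : Function.update lst j [] K = [] := by rw [Function.update_of_ne (by omega), lK]
  have pw : ∀ i, i < K → 2 ^ (K - i) = 2 ^ (K - (i + 1)) + 2 ^ (K - (i + 1)) := fun i hi => by
    rw [show K - i = K - (i + 1) + 1 by omega, pow_succ]; omega
  -- The whole level `j` fits within its permitted width above the minimum; this makes the new level
  -- `j + 1` narrow enough.
  have hub : ub j ≤ key x₀ + 2 ^ (K - (j + 1)) := by
    rcases (show j = 1 ∨ 1 < j by omega) with rfl | hj
    · rw [h.ub1, h.hQ]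
      exact Nat.add_le_add_right e₀ _
    · have := h.ubw j hj hjK
      have := h.low x₀ hS₀ (by omega) (by omega) (by simp)
      rw [hl₀] at this
      omega
  refine { h with
    j1 := by omega, jK := le_rfl, Sk := ?_, Uc := ?_, emp := ?_, fin := ?_, nd := ?_
    cov2 := ?_, up := ?_, low := ?_, cov1 := ?_, ent := ?_, ent1 := ?_, entT := ?_, ex := ?_
    ubw := ?_, ub1 := ?_, ph := ?_, ubK := ?_, ub0 := ?_ }
  · exact fun x hx => ⟨(h.Sk x hx).1, (h.Sk x hx).2.trans hc⟩
  · intro x hx hl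
    rcases (show lev x = j ∨ lev x < j by have := hlev x hx; omega) with hxj | hxj
    · rcases (show j = 1 ∨ 1 < j by omega) with rfl | hj
      · rcases h.cov1 x hx hxj (by simp) with h' | ⟨e', -, a, b, -⟩
        · exact hmin x h'.1 hxj
        · omega
      · have := h.cov2 x hx (by omega) (by simp)
        rw [hxj] at this
        exact hmin x this hxj
    · rcases (show lev x = 1 ∨ 1 < lev x by omega) with h1 | h1
      · rcases h.cov1 x hx h1 (by simp) with h' | ⟨e', -, a, b, -⟩
        · rw [(h.ph (by omega)).2.2.2] at h'; simp at h'
        · omega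
      -- The bound `ub (lev x + 1)` lies between the two keys: `x` is above it, and `x₀`, being at a
      -- later level, is below it.
      · have a := h.low x hx h1 (by omega) (by simp)
        have b := h.up x₀ (lev x + 1) hS₀ (by omega) (by omega)
        omega
  · intro i hi hK; omega
  · rw [lK']; simp
  · rw [lK']; simp
  · intro x hx h2 hn
    have := h.cov2 x hx h2 (by simp)
    exact keep _ x this fun e => hn ⟨e ▸ this, e⟩
  · intro x i hx h2 hi
    rw [u3 i (Or.inl (hi.trans (hlev x hx)))]
    exact h.up x i hx h2 hi
  · intro x hx h2 hK hn
    have hxj : lev x ≠ j := fun hxj => hn ⟨hxj ▸ h.cov2 x hx h2 (by simp), hxj⟩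
    rw [u3 _ (Or.inl (by have := hlev x hx; omega))]
    exact h.low x hx h2 hK (by simp)
  · intro x hx h1 hn
    rcases h.cov1 x hx h1 (by simp) with h' | ⟨e', d, a, b, c⟩
    · rcases (show j = 1 ∨ 1 < j by omega) with rfl | hj
      · exact absurd ⟨h'.1, h1⟩ hn
      · rw [(h.ph hj).2.2.2] at h'; simp at h'
    · exact Or.inr ⟨e', d, a, b, keep _ x c (by omega)⟩
  · exact fun l x h1 h2 hx => h.ent l x h1 h2 (sub _ x hx)
  · exact fun x hx => h.ent1 x (sub _ x hx)
  · exact fun e' x hx => h.entT e' x (sub _ x hx)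
  · intro x hx
    refine ⟨h.ent j x hj1 hjK.le hx, fun hxj => ?_⟩
    have hS : x ∉ S := fun hx => by have := (h.Sk _ hx).1; omega
    refine ⟨hS, ?_⟩
    rw [u1]
    rcases (show j = 1 ∨ 1 < j by omega) with rfl | hj
    · rw [h.ub1]; exact h.ent1 x hx
    · exact h.up x j hS hj hxj.ge
  · intro i h2 hi
    rcases (show i < j ∨ i = j ∨ i = j + 1 ∨ j + 2 ≤ i by omega) with h' | rfl | rfl | h'
    · rw [u3 i (Or.inl h'.le), u3 _ (Or.inl h')]; exact h.ubw i h2 hi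
    · rw [u3 i (Or.inl le_rfl), u1]; exact Nat.le_add_right _ _
    · rw [u1, u2 (j + 1 + 1) (by omega) (by omega)]
      have := pw (j + 1) hi
      omega
    · rw [u2 i h' hi.le, u2 (i + 1) (by omega) (by omega)]
      have := pw i hi
      omega
  · rw [u3 1 (Or.inl hj1)]; exact h.ub1
  · intro _
    refine ⟨?_, e₀, e₁, ?_⟩
    · rcases (show j = 1 ∨ 1 < j by omega) with rfl | hj
      · rw [u1, h.ub1]
      · rw [u3 2 (Or.inl hj)]; exact (h.ph hj).1
    · rcases (show j = 1 ∨ 1 < j by omega) with rfl | hj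
      · simp
      · rw [Function.update_of_ne (by omega)]; exact (h.ph hj).2.2.2
  · rcases (show j + 1 = K ∨ j + 2 ≤ K by omega) with hj | hj
    · rw [← hj, u1]
      rw [← hj] at hub
      simpa using hub
    · rw [u2 K hj le_rfl]; simp
  · rw [u3 _ (Or.inr (by omega))]; exact h.ub0

/-- An entry whose item has left level `r`, be it stale, a duplicate or just moved, grants no
exemption from the covering conditions. -/
theorem skipRem {x : ℕ} {t : List ℕ} (h : QI K Q key lev ub lst S e cur j (x :: t) r)
    (hx : lev x ≠ r) : QI K Q key lev ub lst S e cur j t r := by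
  have ex : ∀ y, ¬ (y ∈ t ∧ lev y = r) → ¬ (y ∈ x :: t ∧ lev y = r) := by
    rintro y hy ⟨h1, h2⟩
    rcases List.mem_cons.1 h1 with rfl | h1
    · exact hx h2
    · exact hy ⟨h1, h2⟩
  exact { h with
    cov2 := fun y hy h2 hn => h.cov2 y hy h2 (ex y hn)
    low := fun y hy h2 hk hn => h.low y hy h2 hk (ex y hn)
    cov1 := fun y hy h2 hn => h.cov1 y hy h2 (ex y hn)
    ex := fun y hy => h.ex y (List.mem_cons_of_mem _ hy) }

/-- Give an unsettled item a key and a level. -/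
theorem place (h : QI K Q key lev ub lst S e cur K rem r) {y d l : ℕ} (hy : y ∉ S)
    (hd : lev y = 0 ∨ d ≤ key y) (hc : cur ≤ d) (hl : lev y ≤ l) (h2 : 2 ≤ l) (hlK : l ≤ K)
    (hup : ∀ i, 2 ≤ i → i ≤ l → d < ub i) (hlow : l < K → ub (l + 1) ≤ d)
    (hex : lev y = l → ¬ (y ∈ rem ∧ lev y = r)) (hr : rem ≠ [] → lev y = 0 → r ≠ 0 ∧ y ∉ rem) :
    QI K Q (Function.update key y d) (Function.update lev y l) ub
      (if lev y < l then Function.update lst l (y :: lst l) else lst) S e cur K rem r := by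
  have hK2 := h.K2
  have kn : ∀ x, x ≠ y → Function.update key y d x = key x := fun x hx =>
    Function.update_of_ne hx _ _
  have ln : ∀ x, x ≠ y → Function.update lev y l x = lev x := fun x hx =>
    Function.update_of_ne hx _ _
  -- Lists are unordered, so a decrease of the key within a level needs no new entry.
  set lst' := if lev y < l then Function.update lst l (y :: lst l) else lst with hlst'
  have sub : ∀ i x, x ∈ lst' i → x ∈ lst i ∨ (x = y ∧ i = l ∧ lev y < l) := fun i x hx => by
    rw [hlst'] at hx
    split_ifs at hx with hc
    · rcases eq_or_ne i l with rfl | hi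
      · rw [Function.update_self] at hx
        rcases List.mem_cons.1 hx with rfl | hx
        · exact Or.inr ⟨rfl, rfl, hc⟩
        · exact Or.inl hx
      · rw [Function.update_of_ne hi] at hx; exact Or.inl hx
    · exact Or.inl hx
  have keep : ∀ i x, x ∈ lst i → x ∈ lst' i := fun i x hx => by
    rw [hlst']
    split_ifs
    · rcases eq_or_ne i l with rfl | hi
      · rw [Function.update_self]; exact List.mem_cons_of_mem _ hx
      · rwa [Function.update_of_ne hi]
    · exact hx
  have same : ∀ i, i ≠ l → lst' i = lst i := fun i hi => by
    rw [hlst']; split_ifs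
    · exact Function.update_of_ne hi _ _
    · rfl
  have newmem : y ∈ lst' l := by
    by_cases hlt : lev y < l
    · simp [hlst', hlt]
    · have heq : lev y = l := by omega
      apply keep
      have := h.cov2 y hy (by omega) (hex heq)
      rwa [heq] at this
  have ySne : ∀ x ∈ S, x ≠ y := fun x hx e => hy (e ▸ hx)
  have exn : ∀ x, x ≠ y → ¬ (x ∈ rem ∧ Function.update lev y l x = r) →
      ¬ (x ∈ rem ∧ lev x = r) := fun x hx hn => by rwa [ln x hx] at hn
  have keyle : ∀ x b, lev x ≠ 0 → key x < b → Function.update key y d x < b := by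
    intro x b h0 hb
    rcases eq_or_ne x y with rfl | hx
    · rw [Function.update_self]
      rcases hd with h' | h'
      · exact absurd h' h0
      · omega
    · rwa [kn x hx]
  have levle : ∀ x, lev x ≤ Function.update lev y l x := fun x => by
    rcases eq_or_ne x y with rfl | hx
    · rwa [Function.update_self]
    · rw [ln x hx]
  refine { h with
    levK := ?_, Sk := ?_, Uc := ?_, emp := ?_, fin := ?_, nd := ?_, cov2 := ?_, up := ?_
    low := ?_, cov1 := ?_, ent := ?_, ent1 := ?_, entT := ?_, ex := ?_, ph := ?_ }
  · intro x
    rcases eq_or_ne x y with rfl | hx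
    · rwa [Function.update_self]
    · rw [ln x hx]; exact h.levK x
  · intro x hx
    rw [kn x (ySne x hx), ln x (ySne x hx)]
    exact h.Sk x hx
  · intro x hx h0
    rcases eq_or_ne x y with rfl | hxy
    · rwa [Function.update_self]
    · rw [kn x hxy]; rw [ln x hxy] at h0; exact h.Uc x hx h0
  · intro i hi hK; omega
  · intro x hx
    rcases sub K x hx with hx | ⟨rfl, hlK', -⟩
    · have := h.fin x hx
      refine ⟨?_, this.2⟩
      rcases eq_or_ne x y with rfl | hxy
      · rw [Function.update_self]; omega
      · rw [ln x hxy]; exact this.1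
    · rw [Function.update_self]; exact ⟨hlK'.symm, hy⟩
  · rw [hlst']
    split_ifs with hlt
    · rcases eq_or_ne K l with rfl | hKl
      · rw [Function.update_self, List.nodup_cons]
        refine ⟨fun hm => ?_, h.nd⟩
        have := (h.fin y hm).1
        omega
      · rw [Function.update_of_ne hKl]; exact h.nd
    · exact h.nd
  · intro x hx hx2 hn
    rcases eq_or_ne x y with rfl | hxy
    · rw [Function.update_self]; exact newmem
    · have hn' := exn x hxy hn
      rw [ln x hxy] at hx2 ⊢
      exact keep _ x (h.cov2 x hx hx2 hn')
  · intro x i hx hi2 hi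
    rcases eq_or_ne x y with rfl | hxy
    · rw [Function.update_self] at hi ⊢
      exact hup i hi2 hi
    · rw [ln x hxy] at hi; rw [kn x hxy]; exact h.up x i hx hi2 hi
  · intro x hx hx2 hxK hn
    rcases eq_or_ne x y with rfl | hxy
    · rw [Function.update_self] at hxK ⊢
      rw [Function.update_self]
      exact hlow hxK
    · have hn' := exn x hxy hn
      rw [ln x hxy] at hx2 hxK ⊢
      rw [kn x hxy]
      exact h.low x hx hx2 hxK hn'
  · intro x hx h1 hn
    rcases eq_or_ne x y with rfl | hxy
    · rw [Function.update_self] at h1; omega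
    · have hn' := exn x hxy hn
      rw [ln x hxy] at h1
      rw [kn x hxy]
      rcases h.cov1 x hx h1 hn' with h' | ⟨e', d, a, b, c⟩
      · exact Or.inl ⟨keep _ x h'.1, h'.2⟩
      · exact Or.inr ⟨e', d, a, b, keep _ x c⟩
  · intro i x h1 hiK hx
    rcases sub i x hx with hx | ⟨rfl, rfl, -⟩
    · exact (h.ent i x h1 hiK hx).trans (levle x)
    · rw [Function.update_self]
  · intro x hx
    rw [same 1 (by omega)] at hx
    exact keyle x _ (by have := h.ent 1 x le_rfl (by omega) hx; omega) (h.ent1 x hx)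
  · intro e' x hx
    rw [same _ (by omega)] at hx
    obtain ⟨a, b⟩ := h.entT e' x hx
    exact ⟨a.trans (levle x), keyle x _ (by omega) b⟩
  · intro x hx
    have := h.ex x hx
    refine ⟨this.1.trans (levle x), fun hxr => ?_⟩
    rcases eq_or_ne x y with rfl | hxy
    · refine ⟨hy, ?_⟩
      rw [Function.update_self] at hxr ⊢
      have hne : rem ≠ [] := fun h0 => by rw [h0] at hx; simp at hx
      rcases eq_or_ne (lev x) 0 with h0 | h0
      · exact absurd hx (hr hne h0).2
      · have heq : lev x = l := le_antisymm hl (by omega)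
        exact absurd ⟨hx, by omega⟩ (hex heq)
    · rw [ln x hxy] at hxr
      rw [kn x hxy]
      exact this.2 hxr
  · intro h1
    obtain ⟨a, b, c, d⟩ := h.ph h1
    exact ⟨a, b, c, by rw [same 1 (by omega)]; exact d⟩

/-- Give an unsettled item a key beyond the opened top bucket. -/
theorem placeTop (h : QI K Q key lev ub lst S e cur K [] r) {y d e' : ℕ} (hy : y ∉ S)
    (hd : lev y = 0 ∨ d ≤ key y) (hl : lev y ≤ 1) (heQ : Q ∣ e') (he : e + Q ≤ e')
    (hd1 : e' ≤ d) (hd2 : d < e' + Q) :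
    QI K Q (Function.update key y d) (Function.update lev y 1) ub
      (Function.update lst (K + 1 + e') (y :: lst (K + 1 + e'))) S e cur K [] r := by
  have hK2 := h.K2
  have hph := h.ph (by omega)
  have kn : ∀ x, x ≠ y → Function.update key y d x = key x := fun x hx =>
    Function.update_of_ne hx _ _
  have ln : ∀ x, x ≠ y → Function.update lev y 1 x = lev x := fun x hx =>
    Function.update_of_ne hx _ _
  -- Here every decrease makes a new entry. Older entries in later buckets remain; they are harmless
  -- because `entT` only asks for an upper bound on the key.
  set lst' := Function.update lst (K + 1 + e') (y :: lst (K + 1 + e')) with hlst'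
  have keep : ∀ i x, x ∈ lst i → x ∈ lst' i := fun i x hx => by
    rw [hlst']
    rcases eq_or_ne i (K + 1 + e') with rfl | hi
    · rw [Function.update_self]; exact List.mem_cons_of_mem _ hx
    · rwa [Function.update_of_ne hi]
  have same : ∀ i, i ≠ K + 1 + e' → lst' i = lst i := fun i hi => Function.update_of_ne hi _ _
  have newmem : y ∈ lst' (K + 1 + e') := by simp [hlst']
  have ySne : ∀ x ∈ S, x ≠ y := fun x hx e => hy (e ▸ hx)
  have keyle : ∀ x b, lev x ≠ 0 → key x < b → Function.update key y d x < b := by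
    intro x b h0 hb
    rcases eq_or_ne x y with rfl | hx
    · rw [Function.update_self]
      rcases hd with h' | h'
      · exact absurd h' h0
      · omega
    · rwa [kn x hx]
  have levle : ∀ x, lev x ≤ Function.update lev y 1 x := fun x => by
    rcases eq_or_ne x y with rfl | hx
    · rwa [Function.update_self]
    · rw [ln x hx]
  refine { h with
    levK := ?_, Sk := ?_, Uc := ?_, emp := ?_, fin := ?_, nd := ?_, cov2 := ?_, up := ?_
    low := ?_, cov1 := ?_, ent := ?_, ent1 := ?_, entT := ?_, ex := by simp, ph := ?_ }
  · intro x
    rcases eq_or_ne x y with rfl | hx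
    · rw [Function.update_self]; omega
    · rw [ln x hx]; exact h.levK x
  · intro x hx
    rw [kn x (ySne x hx), ln x (ySne x hx)]
    exact h.Sk x hx
  · intro x hx h0
    rcases eq_or_ne x y with rfl | hxy
    · rw [Function.update_self]; omega
    · rw [kn x hxy]; rw [ln x hxy] at h0; exact h.Uc x hx h0
  · intro i hi hK; omega
  · intro x hx
    rw [same K (by omega)] at hx
    have := h.fin x hx
    refine ⟨?_, this.2⟩
    rw [ln x (by rintro rfl; omega)]
    exact this.1
  · rw [same K (by omega)]; exact h.nd
  · intro x hx hx2 _
    rcases eq_or_ne x y with rfl | hxy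
    · rw [Function.update_self] at hx2; omega
    · rw [ln x hxy] at hx2 ⊢
      exact keep _ x (h.cov2 x hx hx2 (by simp))
  · intro x i hx hi2 hi
    rcases eq_or_ne x y with rfl | hxy
    · rw [Function.update_self] at hi; omega
    · rw [ln x hxy] at hi; rw [kn x hxy]; exact h.up x i hx hi2 hi
  · intro x hx hx2 hxK _
    rcases eq_or_ne x y with rfl | hxy
    · rw [Function.update_self] at hx2; omega
    · rw [ln x hxy] at hx2 hxK ⊢
      rw [kn x hxy]
      exact h.low x hx hx2 hxK (by simp)
  · intro x hx h1 _
    rcases eq_or_ne x y with rfl | hxy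
    · rw [Function.update_self]
      exact Or.inr ⟨e', heQ, he, hd1, newmem⟩
    · rw [ln x hxy] at h1
      rw [kn x hxy]
      rcases h.cov1 x hx h1 (by simp) with h' | ⟨e', d, a, b, c⟩
      · exact Or.inl ⟨keep _ x h'.1, h'.2⟩
      · exact Or.inr ⟨e', d, a, b, keep _ x c⟩
  · intro i x h1 hiK hx
    rw [same i (by omega)] at hx
    exact (h.ent i x h1 hiK hx).trans (levle x)
  · intro x hx
    rw [same 1 (by omega), hph.2.2.2] at hx
    simp at hx
  · intro e'' x hx
    rcases eq_or_ne e'' e' with rfl | he'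
    · rw [hlst', Function.update_self] at hx
      rcases List.mem_cons.1 hx with rfl | hx
      · rw [Function.update_self, Function.update_self]; exact ⟨le_rfl, hd2⟩
      · obtain ⟨a, b⟩ := h.entT e'' x hx
        exact ⟨a.trans (levle x), keyle x _ (by omega) b⟩
    · rw [same _ (by omega)] at hx
      obtain ⟨a, b⟩ := h.entT e'' x hx
      exact ⟨a.trans (levle x), keyle x _ (by omega) b⟩
  · intro h1
    obtain ⟨a, b, c, d⟩ := h.ph h1
    exact ⟨a, b, c, by rw [same 1 (by omega)]; exact d⟩

end QI

/-! ### Distances and records -/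

/-- An instance of the problem: numbers of vertices and edges, source, tails, heads, costs and
capacities of the edges, a bound on the costs, and the number of levels of the queue. -/
structure Inst where
  n : ℕ
  m : ℕ
  s : ℕ
  mx : ℕ
  K : ℕ
  tl : ℕ → ℕ
  hd : ℕ → ℕ
  wt : ℕ → ℕ
  cp : ℕ → ℝ≥0
  s_lt : s < n
  tl_lt : ∀ e < m, tl e < n
  hd_lt : ∀ e < m, hd e < n
  wt_le : ∀ e < m, wt e ≤ mx
  K2 : 2 ≤ K
  mx_le : mx ≤ m * 2 ^ (K - 2)

namespace Inst

variable (I : Inst)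

/-- The node for the flow of the edge `i` at the vertex `v`. -/
def node (i v : ℕ) : ℕ := i * I.n + v

variable {I}

theorem node_inj {i v i' v' : ℕ} (hv : v < I.n) (hv' : v' < I.n) (h : I.node i v = I.node i' v') :
    i = i' ∧ v = v' := by
  have hn : 0 < I.n := by omega
  have h1 : (v + I.n * i) / I.n = (v' + I.n * i') / I.n := by
    unfold node at h; rw [Nat.mul_comm i, Nat.mul_comm i'] at h
    congr 1; omega
  rw [Nat.add_mul_div_left _ _ hn, Nat.add_mul_div_left _ _ hn, Nat.div_eq_of_lt hv,
    Nat.div_eq_of_lt hv'] at h1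
  have h2 : i = i' := by omega
  subst h2
  unfold node at h
  exact ⟨rfl, by omega⟩

variable (I)

/-- `Reach i v d`: there is a walk of cost `d` from the source to `v` that accommodates the flow of
the edge `i`. -/
inductive Reach (i : ℕ) : ℕ → ℕ → Prop
  | src : Reach i I.s 0
  | step {d e : ℕ} : Reach i (I.tl e) d → e < I.m → I.cp i ≤ I.cp e →
      Reach i (I.hd e) (d + I.wt e)

variable {I}

theorem Reach.lt {i v d : ℕ} (h : I.Reach i v d) : v < I.n := by
  cases h with
  | src => exact I.s_lt
  | step _ he _ => exact I.hd_lt _ he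

theorem Reach.mono {i j v d : ℕ} (h : I.Reach i v d) (hij : I.cp j ≤ I.cp i) : I.Reach j v d := by
  induction h with
  | src => exact .src
  | step _ he hc ih => exact .step ih he (hij.trans hc)

end Inst

/-- The distances: all edges that leave settled nodes have been relaxed, except those in `rest` at
the node `x₀`. -/
structure DI (I : Inst) (key lev : ℕ → ℕ) (S : Finset ℕ) (x₀ : ℕ) (rest : List ℕ) : Prop where
  src : ∀ i < I.m, lev (I.node i I.s) ≠ 0 ∧ key (I.node i I.s) = 0
  rel : ∀ i < I.m, ∀ e < I.m, I.node i (I.tl e) ∈ S → I.cp i ≤ I.cp e →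
    ¬ (I.node i (I.tl e) = x₀ ∧ e ∈ rest) →
    lev (I.node i (I.hd e)) ≠ 0 ∧
      key (I.node i (I.hd e)) ≤ key (I.node i (I.tl e)) + I.wt e
  snd : ∀ x, lev x ≠ 0 → ∃ i < I.m, ∃ v, x = I.node i v ∧ I.Reach i v (key x)

namespace DI

variable {I : Inst} {key lev : ℕ → ℕ} {S : Finset ℕ} {x₀ : ℕ} {rest : List ℕ}

/-- Dijkstra's argument: along a walk, settled nodes have keys at most the cost of the walk so far,
since all their edges have been relaxed. At the first unsettled node the key is at most that cost
and at least `cur`. -/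
theorem lower (h : DI I key lev S x₀ []) {cur : ℕ}
    (hU : ∀ x, x ∉ S → lev x ≠ 0 → cur ≤ key x) {i v d : ℕ} (hi : i < I.m) (hr : I.Reach i v d) :
    (I.node i v ∈ S ∧ key (I.node i v) ≤ d) ∨ cur ≤ d := by
  induction hr with
  | src =>
    obtain ⟨h1, h2⟩ := h.src i hi
    by_cases hS : I.node i I.s ∈ S
    · exact Or.inl ⟨hS, h2.le⟩
    · exact Or.inr (h2 ▸ hU _ hS h1)
  | @step d e _ he hc ih =>
    rcases ih with ⟨h1, h2⟩ | h1
    · obtain ⟨h3, h4⟩ := h.rel i hi e he h1 hc (by simp)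
      by_cases hS : I.node i (I.hd e) ∈ S
      · exact Or.inl ⟨hS, by omega⟩
      · have := hU _ hS h3
        exact Or.inr (by omega)
    · exact Or.inr (by omega)

theorem snd_node (h : DI I key lev S x₀ rest) {i v : ℕ} (hv : v < I.n)
    (hl : lev (I.node i v) ≠ 0) : i < I.m ∧ I.Reach i v (key (I.node i v)) := by
  obtain ⟨i', hi', v', hx, hr⟩ := h.snd _ hl
  obtain ⟨rfl, rfl⟩ := I.node_inj hv hr.lt hx
  exact ⟨hi', hr⟩

/-- Settle a node, with all its edges still to be relaxed. -/
theorem insert (h : DI I key lev S x₀ []) (x : ℕ) {rest : List ℕ}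
    (hrest : ∀ i < I.m, ∀ e < I.m, I.node i (I.tl e) = x → e ∈ rest) :
    DI I key lev (insert x S) x rest where
  src := h.src
  rel i hi e he hS hc hn := by
    rcases Finset.mem_insert.1 hS with hx | hS
    · exact absurd ⟨hx, hrest i hi e he hx⟩ hn
    · exact h.rel i hi e he hS hc (by simp)
  snd := h.snd

/-- Relaxing an edge without improvement. -/
theorem skip {i e : ℕ} (h : DI I key lev S x₀ (e :: rest)) (hi : i < I.m) (he : e < I.m)
    (hx : x₀ = I.node i (I.tl e))
    (hc : I.cp i ≤ I.cp e → lev (I.node i (I.hd e)) ≠ 0 ∧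
      key (I.node i (I.hd e)) ≤ key x₀ + I.wt e) : DI I key lev S x₀ rest where
  src := h.src
  rel i' hi' e' he' hS hc' hn := by
    by_cases h1 : I.node i' (I.tl e') = x₀ ∧ e' ∈ e :: rest
    · obtain ⟨hx', hm⟩ := h1
      rcases List.mem_cons.1 hm with rfl | hm
      · rw [hx] at hx'
        obtain ⟨rfl, -⟩ := I.node_inj (I.tl_lt _ he) (I.tl_lt _ he) hx'
        rw [← hx]
        exact hc hc'
      · exact absurd ⟨hx', hm⟩ hn
    · exact h.rel i' hi' e' he' hS hc' h1
  snd := h.snd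

/-- Relaxing an edge with improvement. -/
theorem relax {i e l : ℕ} (h : DI I key lev S x₀ (e :: rest)) (hi : i < I.m) (he : e < I.m)
    (hx : x₀ = I.node i (I.tl e)) (hlx : lev x₀ ≠ 0) (hc : I.cp i ≤ I.cp e)
    (hy : I.node i (I.hd e) ∉ S) (hl : l ≠ 0)
    (hd : lev (I.node i (I.hd e)) = 0 ∨ key x₀ + I.wt e < key (I.node i (I.hd e))) :
    DI I (Function.update key (I.node i (I.hd e)) (key x₀ + I.wt e))
      (Function.update lev (I.node i (I.hd e)) l) S x₀ rest := by
  set y := I.node i (I.hd e) with hyd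
  have ne : ∀ x ∈ S, x ≠ y := fun x hx e => hy (e ▸ hx)
  have hhd := I.hd_lt e he
  have hreach : I.Reach i (I.hd e) (key x₀ + I.wt e) := by
    have := (h.snd_node (I.tl_lt e he) (hx ▸ hlx)).2
    rw [← hx] at this
    exact .step this he hc
  refine ⟨fun i' hi' => ?_, fun i' hi' e' he' hS hc' hn => ?_, fun x hlx' => ?_⟩
  · obtain ⟨h1, h2⟩ := h.src i' hi'
    -- A source has key `0` and has been seen, so it can never be improved.
    have : I.node i' I.s ≠ y := by
      intro hy'
      rcases hd with hd | hd
      · exact h1 (hy' ▸ hd)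
      · rw [← hy', h2] at hd; omega
    rw [Function.update_of_ne this, Function.update_of_ne this]
    exact ⟨h1, h2⟩
  · rw [Function.update_of_ne (ne _ hS) (f := key)]
    by_cases hy' : I.node i' (I.hd e') = y
    · rw [hy', Function.update_self, Function.update_self]
      refine ⟨hl, ?_⟩
      by_cases h1 : I.node i' (I.tl e') = x₀ ∧ e' ∈ e :: rest
      · rcases List.mem_cons.1 h1.2 with rfl | h2
        · rw [h1.1]
        · exact absurd ⟨h1.1, h2⟩ hn
      · have := h.rel i' hi' e' he' hS hc' h1
        rw [hy'] at this
        rcases hd with hd | hd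
        · exact absurd hd this.1
        · omega
    · rw [Function.update_of_ne hy', Function.update_of_ne hy']
      by_cases h1 : I.node i' (I.tl e') = x₀ ∧ e' ∈ e :: rest
      · rcases List.mem_cons.1 h1.2 with rfl | h2
        · have := h1.1
          rw [hx] at this
          obtain ⟨rfl, -⟩ := I.node_inj (I.tl_lt _ he) (I.tl_lt _ he) this
          exact absurd rfl hy'
        · exact absurd ⟨h1.1, h2⟩ hn
      · exact h.rel i' hi' e' he' hS hc' h1
  · rcases eq_or_ne x y with rfl | hxy
    · rw [Function.update_self]
      exact ⟨i, hi, I.hd e, hyd, hreach⟩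
    · rw [Function.update_of_ne hxy] at hlx' ⊢
      exact h.snd x hlx'

/-- Changing the level of a node which has been seen. -/
theorem relevel (h : DI I key lev S x₀ rest) {y l : ℕ} (hy : lev y ≠ 0) (hl : l ≠ 0) :
    DI I key (Function.update lev y l) S x₀ rest := by
  have : ∀ x, Function.update lev y l x ≠ 0 ↔ lev x ≠ 0 := fun x => by
    rcases eq_or_ne x y with rfl | hx
    · simp [hy, hl]
    · rw [Function.update_of_ne hx]
  refine ⟨fun i hi => ?_, fun i hi e he hS hc hn => ?_, fun x hx => h.snd x ((this x).1 hx)⟩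
  · rw [this]; exact h.src i hi
  · rw [this]; exact h.rel i hi e he hS hc hn

end DI

/-- The address of a record, `0` for the index `0`. -/
def adrOf (B a : ℕ) : ℕ := if a = 0 then 0 else B + 32 * a

/-- The next-pointers of a list of records. -/
def RCh (B : ℕ) (rn : ℕ → ℕ) : List ℕ → Prop
  | [] => True
  | a :: l => rn a = adrOf B (l.headD 0) ∧ RCh B rn l

theorem RCh.update {B : ℕ} {rn : ℕ → ℕ} {a k : ℕ} : ∀ {l : List ℕ}, a ∉ l → RCh B rn l →
    RCh B (Function.update rn a k) l
  | [], _, _ => trivial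
  | b :: l, ha, h => by
    rw [List.mem_cons, not_or] at ha
    exact ⟨by rw [Function.update_of_ne (Ne.symm ha.1)]; exact h.1, RCh.update ha.2 h.2⟩

/-- The invariant of the records. `recs v` is the list of the records of `v`, with decreasing
distances and flows; the record `a` belongs to the flow of the edge `rf a`. The flows increase
weakly along the pointers to predecessors, and where they do not increase strictly `ρ` decreases. -/
structure RI (I : Inst) (B : ℕ) (key lev : ℕ → ℕ) (S : Finset ℕ) (rd rp rr rf pv pr : ℕ → ℕ)
    (recs : ℕ → List ℕ) (rc : ℕ) (ρ : ℕ → ℕ) : Prop where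
  own : ∀ v < I.n, ∀ a ∈ recs v, 1 ≤ a ∧ a ≤ rc
  disj : ∀ v < I.n, ∀ v' < I.n, ∀ a ∈ recs v, a ∈ recs v' → v = v'
  good : ∀ v < I.n, ∀ a ∈ recs v, rf a < I.m ∧ I.node (rf a) v ∈ S ∧
    key (I.node (rf a) v) = rd a
  prd : ∀ v < I.n, v ≠ I.s → ∀ a ∈ recs v, ∃ e < I.m, ∃ b ∈ recs (I.tl e), I.hd e = v ∧
    I.cp (rf a) ≤ I.cp e ∧ rp a = I.tl e ∧ rr a = B + 32 * b ∧ rd a = rd b + I.wt e ∧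
    (I.cp (rf a) < I.cp (rf b) ∨ I.cp (rf a) = I.cp (rf b) ∧ ρ b < ρ a)
  pw : ∀ v < I.n, (recs v).Pairwise fun a b => rd b < rd a ∧ I.cp (rf b) < I.cp (rf a)
  cov : ∀ i < I.m, ∀ v < I.n, I.node i v ∈ S →
    ∃ a ∈ recs v, rd a = key (I.node i v) ∧ I.cp i ≤ I.cp (rf a)
  npr : ∀ i < I.m, ∀ v < I.n, v ≠ I.s → lev (I.node i v) ≠ 0 →
    ∃ e < I.m, ∃ b ∈ recs (I.tl e), I.hd e = v ∧ I.cp i ≤ I.cp e ∧ pv (I.node i v) = I.tl e ∧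
      pr (I.node i v) = B + 32 * b ∧ key (I.node i v) = rd b + I.wt e ∧ I.cp i ≤ I.cp (rf b)
  rcS : rc ≤ S.card

namespace RI

variable {I : Inst} {B : ℕ} {key lev : ℕ → ℕ} {S : Finset ℕ} {rd rp rr rf pv pr : ℕ → ℕ}
  {recs : ℕ → List ℕ} {rc : ℕ} {ρ : ℕ → ℕ}

theorem relevel (h : RI I B key lev S rd rp rr rf pv pr recs rc ρ) {y l : ℕ} (hy : lev y ≠ 0) :
    RI I B key (Function.update lev y l) S rd rp rr rf pv pr recs rc ρ :=
  { h with
    npr := fun i hi v hv hs hl => h.npr i hi v hv hs fun h0 => by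
      rcases eq_or_ne (I.node i v) y with hx | hx
      · exact hy (hx ▸ h0)
      · rw [Function.update_of_ne hx] at hl; exact hl h0 }

/-- The record `b` that becomes the predecessor need not belong to the flow of `i`: it may
accommodate a greater flow at the same distance. -/
theorem relax (h : RI I B key lev S rd rp rr rf pv pr recs rc ρ) {i e l d b : ℕ}
    (he : e < I.m) (hc : I.cp i ≤ I.cp e) (hy : I.node i (I.hd e) ∉ S)
    (hb : b ∈ recs (I.tl e)) (hd : d = rd b + I.wt e) (hb' : I.cp i ≤ I.cp (rf b)) :
    RI I B (Function.update key (I.node i (I.hd e)) d) (Function.update lev (I.node i (I.hd e)) l)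
      S rd rp rr rf (Function.update pv (I.node i (I.hd e)) (I.tl e))
      (Function.update pr (I.node i (I.hd e)) (B + 32 * b)) recs rc ρ := by
  have ne : ∀ x ∈ S, x ≠ I.node i (I.hd e) := fun x hx e => hy (e ▸ hx)
  refine { h with
    good := fun v hv a ha => ?_
    cov := fun i' hi' v hv hS => ?_
    npr := fun i' hi' v hv hs hl => ?_ }
  · obtain ⟨h1, h2, h3⟩ := h.good v hv a ha
    exact ⟨h1, h2, by rw [Function.update_of_ne (ne _ h2)]; exact h3⟩
  · rw [Function.update_of_ne (ne _ hS)]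
    exact h.cov i' hi' v hv hS
  · by_cases hx : I.node i' v = I.node i (I.hd e)
    · obtain ⟨rfl, rfl⟩ := I.node_inj hv (I.hd_lt e he) hx
      simp only [Function.update_self]
      exact ⟨e, he, b, hb, rfl, hc, rfl, rfl, hd, hb'⟩
    · rw [Function.update_of_ne hx] at hl
      simp only [Function.update_of_ne hx]
      exact h.npr i' hi' v hv hs hl

/-- Settle a node whose pair is not useful. -/
theorem skip (h : RI I B key lev S rd rp rr rf pv pr recs rc ρ) {i v a : ℕ} (hv : v < I.n)
    (hxS : I.node i v ∉ S) (ha : a ∈ recs v) (hd : rd a = key (I.node i v))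
    (hc : I.cp i ≤ I.cp (rf a)) :
    RI I B key lev (insert (I.node i v) S) rd rp rr rf pv pr recs rc ρ := by
  refine { h with
    good := fun v hv a ha => ?_
    cov := fun i' hi' v' hv' hS => ?_
    rcS := ?_ }
  · obtain ⟨h1, h2, h3⟩ := h.good v hv a ha
    exact ⟨h1, Finset.mem_insert_of_mem h2, h3⟩
  · rcases Finset.mem_insert.1 hS with hx | hS
    · obtain ⟨rfl, rfl⟩ := I.node_inj hv' hv hx
      exact ⟨a, ha, hd, hc⟩
    · exact h.cov i' hi' v' hv' hS
  · rw [Finset.card_insert_of_notMem hxS]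
    exact h.rcS.trans (Nat.le_succ _)

/-- Settle a node which has the same distance as the last record and a greater flow. -/
theorem overwrite (h : RI I B key lev S rd rp rr rf pv pr recs rc ρ) {i v a : ℕ} {l : List ℕ}
    (hi : i < I.m) (hv : v < I.n) (hxS : I.node i v ∉ S) (hl : lev (I.node i v) ≠ 0)
    (ha : recs v = a :: l) (hd : rd a = key (I.node i v)) (hc : I.cp (rf a) < I.cp i) :
    ∃ ρ', RI I B key lev (insert (I.node i v) S) rd (Function.update rp a (pv (I.node i v)))
      (Function.update rr a (pr (I.node i v))) (Function.update rf a i) pv pr recs rc ρ' := by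
  have hav : a ∈ recs v := by rw [ha]; exact List.mem_cons_self
  have hmax : ∀ b, I.cp (rf b) ≤ I.cp (Function.update rf a i b) := fun b => by
    rcases eq_or_ne b a with rfl | hb
    · rw [Function.update_self]; exact hc.le
    · rw [Function.update_of_ne hb]
  have hav' : ∀ v' < I.n, a ∈ recs v' → v' = v := fun v' hv' h' => h.disj v' hv' v hv a h' hav
  -- The new value of `ρ` exceeds all earlier ones, so `ρ` records the order of the last writes.
  set M := (Finset.range (rc + 1)).sup ρ with hM
  have hρ : ∀ v' < I.n, ∀ b ∈ recs v', ρ b < M + 1 := fun v' hv' b hb =>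
    Nat.lt_succ_of_le (Finset.le_sup (f := ρ)
      (Finset.mem_range.2 (Nat.lt_succ_of_le (h.own v' hv' b hb).2)))
  refine ⟨Function.update ρ a (M + 1), { h with
    good := fun v' hv' b hb => ?_
    prd := fun v' hv' hs b hb => ?_
    pw := fun v' hv' => ?_
    cov := fun i' hi' v' hv' hS => ?_
    npr := fun i' hi' v' hv' hs hl' => ?_
    rcS := ?_ }⟩
  · rcases eq_or_ne b a with rfl | hba
    · obtain rfl := hav' v' hv' hb
      rw [Function.update_self]
      exact ⟨hi, Finset.mem_insert_self _ _, hd.symm⟩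
    · rw [Function.update_of_ne hba]
      obtain ⟨h1, h2, h3⟩ := h.good v' hv' b hb
      exact ⟨h1, Finset.mem_insert_of_mem h2, h3⟩
  · rcases eq_or_ne b a with rfl | hba
    · obtain rfl := hav' v' hv' hb
      obtain ⟨e, he, b', hb', h1, h2, h3, h4, h5, h6⟩ := h.npr i hi v' hv' hs hl
      -- The record cannot become its own predecessor: its old flow is below that of `i`, while the
      -- predecessor accommodates the flow of `i`.
      have hbb : b' ≠ b := by rintro rfl; exact absurd hc (not_lt.2 h6)
      refine ⟨e, he, b', hb', h1, ?_⟩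
      simp only [Function.update_self, Function.update_of_ne hbb]
      refine ⟨h2, h3, h4, by rw [hd]; exact h5, ?_⟩
      rcases h6.lt_or_eq with h6 | h6
      · exact Or.inl h6
      · exact Or.inr ⟨h6, hρ _ (I.tl_lt e he) _ hb'⟩
    · obtain ⟨e, he, b', hb', h1, h2, h3, h4, h5, h6⟩ := h.prd v' hv' hs b hb
      refine ⟨e, he, b', hb', h1, ?_⟩
      simp only [Function.update_of_ne hba]
      refine ⟨h2, h3, h4, h5, ?_⟩
      -- Along a pointer into the overwritten record the flow now increases strictly, so the larger
      -- `ρ` does no harm.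
      rcases eq_or_ne b' a with rfl | hb'a
      · left
        rw [Function.update_self]
        refine lt_of_le_of_lt ?_ hc
        rcases h6 with h6 | h6
        · exact h6.le
        · exact h6.1.le
      · simp only [Function.update_of_ne hb'a]; exact h6
  · by_cases hvv : v' = v
    · subst hvv
      have := h.pw v' hv'
      rw [ha, List.pairwise_cons] at this ⊢
      have hal : a ∉ l := fun hm => lt_irrefl _ (this.1 a hm).1
      refine ⟨fun b hb => ?_, this.2.imp_of_mem fun {b c} hb hc' hbc => ?_⟩
      · have hba : b ≠ a := by rintro rfl; exact hal hb
        rw [Function.update_self, Function.update_of_ne hba]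
        exact ⟨(this.1 b hb).1, (this.1 b hb).2.trans hc⟩
      · have hba : b ≠ a := by rintro rfl; exact hal hb
        have hca : c ≠ a := by rintro rfl; exact hal hc'
        rw [Function.update_of_ne hba, Function.update_of_ne hca]
        exact hbc
    · refine (h.pw v' hv').imp_of_mem fun {b c} hb hc' hbc => ?_
      have hba : b ≠ a := by rintro rfl; exact hvv (hav' v' hv' hb)
      have hca : c ≠ a := by rintro rfl; exact hvv (hav' v' hv' hc')
      rw [Function.update_of_ne hba, Function.update_of_ne hca]
      exact hbc
  · rcases Finset.mem_insert.1 hS with hx | hS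
    · obtain ⟨rfl, rfl⟩ := I.node_inj hv' hv hx
      exact ⟨a, hav, hd, by rw [Function.update_self]⟩
    · obtain ⟨b, hb, h1, h2⟩ := h.cov i' hi' v' hv' hS
      exact ⟨b, hb, h1, h2.trans (hmax b)⟩
  · obtain ⟨e, he, b, hb, h1, h2, h3, h4, h5, h6⟩ := h.npr i' hi' v' hv' hs hl'
    exact ⟨e, he, b, hb, h1, h2, h3, h4, h5, h6.trans (hmax b)⟩
  · rw [Finset.card_insert_of_notMem hxS]
    exact h.rcS.trans (Nat.le_succ _)

/-- Settle a node with a new record. -/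
theorem new (h : RI I B key lev S rd rp rr rf pv pr recs rc ρ) {i v : ℕ}
    (hi : i < I.m) (hv : v < I.n) (hxS : I.node i v ∉ S) (hl : lev (I.node i v) ≠ 0)
    (ha : ∀ a ∈ (recs v).head?, rd a < key (I.node i v) ∧ I.cp (rf a) < I.cp i) :
    ∃ ρ', RI I B key lev (insert (I.node i v) S)
      (Function.update rd (rc + 1) (key (I.node i v)))
      (Function.update rp (rc + 1) (pv (I.node i v)))
      (Function.update rr (rc + 1) (pr (I.node i v))) (Function.update rf (rc + 1) i) pv pr
      (Function.update recs v ((rc + 1) :: recs v)) (rc + 1) ρ' := by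
  set a := rc + 1 with had
  have hna : ∀ v' < I.n, ∀ b ∈ recs v', b ≠ a := fun v' hv' b hb => by
    have := (h.own v' hv' b hb).2
    omega
  have sub : ∀ v' b, b ∈ recs v' → b ∈ Function.update recs v (a :: recs v) v' := fun v' b hb => by
    rcases eq_or_ne v' v with rfl | hvv
    · rw [Function.update_self]; exact List.mem_cons_of_mem _ hb
    · rwa [Function.update_of_ne hvv]
  have cas : ∀ v' b, b ∈ Function.update recs v (a :: recs v) v' →
      (v' = v ∧ b = a) ∨ b ∈ recs v' := fun v' b hb => by
    rcases eq_or_ne v' v with rfl | hvv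
    · rw [Function.update_self] at hb
      rcases List.mem_cons.1 hb with rfl | hb
      · exact Or.inl ⟨rfl, rfl⟩
      · exact Or.inr hb
    · rw [Function.update_of_ne hvv] at hb; exact Or.inr hb
  set M := (Finset.range (rc + 1)).sup ρ with hM
  have hρ : ∀ v' < I.n, ∀ b ∈ recs v', ρ b < M + 1 := fun v' hv' b hb =>
    Nat.lt_succ_of_le (Finset.le_sup (f := ρ)
      (Finset.mem_range.2 (Nat.lt_succ_of_le (h.own v' hv' b hb).2)))
  -- The head has the greatest distance and flow of the list, so a comparison with the head decides
  -- for all records.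
  have hall : ∀ b ∈ recs v, rd b < key (I.node i v) ∧ I.cp (rf b) < I.cp i := by
    intro b hb
    have hp := h.pw v hv
    cases hr : recs v with
    | nil => rw [hr] at hb; simp at hb
    | cons c l =>
      rw [hr] at hb hp ha
      have hc := ha c (by simp)
      rcases List.mem_cons.1 hb with rfl | hb
      · exact hc
      · have := (List.pairwise_cons.1 hp).1 b hb
        exact ⟨this.1.trans hc.1, this.2.trans hc.2⟩
  refine ⟨Function.update ρ a (M + 1), {
    own := fun v' hv' b hb => ?_
    disj := fun v' hv' v'' hv'' b hb hb' => ?_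
    good := fun v' hv' b hb => ?_
    prd := fun v' hv' hs b hb => ?_
    pw := fun v' hv' => ?_
    cov := fun i' hi' v' hv' hS => ?_
    npr := fun i' hi' v' hv' hs hl' => ?_
    rcS := ?_ }⟩
  · rcases cas v' b hb with ⟨rfl, rfl⟩ | hb
    · omega
    · have := h.own v' hv' b hb; omega
  · rcases cas v' b hb with ⟨rfl, rfl⟩ | hb
    · rcases cas v'' a hb' with ⟨rfl, -⟩ | hb'
      · rfl
      · exact absurd rfl (hna v'' hv'' a hb')
    · rcases cas v'' b hb' with ⟨-, h2⟩ | hb'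
      · exact absurd h2 (hna v' hv' b hb)
      · exact h.disj v' hv' v'' hv'' b hb hb'
  · rcases cas v' b hb with ⟨rfl, rfl⟩ | hb
    · simp only [Function.update_self]
      exact ⟨hi, Finset.mem_insert_self _ _, trivial⟩
    · simp only [Function.update_of_ne (hna v' hv' b hb)]
      obtain ⟨h1, h2, h3⟩ := h.good v' hv' b hb
      exact ⟨h1, Finset.mem_insert_of_mem h2, h3⟩
  · rcases cas v' b hb with ⟨rfl, rfl⟩ | hb
    · obtain ⟨e, he, b', hb', h1, h2, h3, h4, h5, h6⟩ := h.npr i hi v' hv' hs hl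
      have hbb := hna _ (I.tl_lt e he) b' hb'
      refine ⟨e, he, b', sub _ _ hb', h1, ?_⟩
      simp only [Function.update_self, Function.update_of_ne hbb]
      refine ⟨h2, h3, h4, h5, ?_⟩
      rcases h6.lt_or_eq with h6 | h6
      · exact Or.inl h6
      · exact Or.inr ⟨h6, hρ _ (I.tl_lt e he) _ hb'⟩
    · obtain ⟨e, he, b', hb', h1, h2, h3, h4, h5, h6⟩ := h.prd v' hv' hs b hb
      refine ⟨e, he, b', sub _ _ hb', h1, ?_⟩
      simp only [Function.update_of_ne (hna v' hv' b hb),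
        Function.update_of_ne (hna _ (I.tl_lt e he) b' hb')]
      exact ⟨h2, h3, h4, h5, h6⟩
  · have old : (recs v').Pairwise fun b c =>
        Function.update rd a (key (I.node i v)) c < Function.update rd a (key (I.node i v)) b ∧
        I.cp (Function.update rf a i c) < I.cp (Function.update rf a i b) := by
      refine (h.pw v' hv').imp_of_mem fun {b c} hb hc' hbc => ?_
      simp only [Function.update_of_ne (hna v' hv' b hb), Function.update_of_ne (hna v' hv' c hc')]
      exact hbc
    rcases eq_or_ne v' v with rfl | hvv
    · rw [Function.update_self, List.pairwise_cons]
      refine ⟨fun b hb => ?_, old⟩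
      simp only [Function.update_of_ne (hna v' hv' b hb), Function.update_self]
      exact hall b hb
    · rw [Function.update_of_ne hvv]; exact old
  · rcases Finset.mem_insert.1 hS with hx | hS
    · obtain ⟨rfl, rfl⟩ := I.node_inj hv' hv hx
      exact ⟨a, by simp, by simp, by simp⟩
    · obtain ⟨b, hb, h1, h2⟩ := h.cov i' hi' v' hv' hS
      refine ⟨b, sub _ _ hb, ?_⟩
      simp only [Function.update_of_ne (hna v' hv' b hb)]
      exact ⟨h1, h2⟩
  · obtain ⟨e, he, b, hb, h1, h2, h3, h4, h5, h6⟩ := h.npr i' hi' v' hv' hs hl'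
    refine ⟨e, he, b, sub _ _ hb, h1, h2, h3, h4, ?_⟩
    simp only [Function.update_of_ne (hna _ (I.tl_lt e he) b hb)]
    exact ⟨h5, h6⟩
  · rw [Finset.card_insert_of_notMem hxS]
    exact Nat.succ_le_succ h.rcS

end RI

/-! ### Weakest preconditions -/

/-- `c` terminates from `s`, and its number of steps and final state satisfy `Q`. -/
def wp (E : Env) (c : Cmd) (Q : ℕ → St → Prop) (s : St) : Prop := ∃ t s', Exec E c s t s' ∧ Q t s'

section wp

variable {E : Env} {Q Q' : ℕ → St → Prop} {s : St}

theorem wp.mono {c : Cmd} (h : wp E c Q s) (hQ : ∀ t s', Q t s' → Q' t s') : wp E c Q' s := by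
  obtain ⟨t, s', h1, h2⟩ := h
  exact ⟨t, s', h1, hQ t s' h2⟩

theorem wp_skip : wp E .skip Q s ↔ Q 0 s :=
  ⟨fun ⟨_, _, h, hQ⟩ => by cases h; exact hQ, fun h => ⟨_, _, .skip, h⟩⟩

theorem wp_asg {x e} : wp E (.asg x e) Q s ↔ e.ok E s ∧ Q 1 (s.setV x (e.ev E s)) :=
  ⟨fun ⟨_, _, h, hQ⟩ => by cases h with | asg h => exact ⟨h, hQ⟩,
    fun h => ⟨_, _, .asg h.1, h.2⟩⟩

theorem wp_put {k i e} : wp E (.put k i e) Q s ↔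
    i.ok E s ∧ e.ok E s ∧ Q 1 (s.setA k (i.ev E s) (e.ev E s)) :=
  ⟨fun ⟨_, _, h, hQ⟩ => by cases h with | put h h' => exact ⟨h, h', hQ⟩,
    fun h => ⟨_, _, .put h.1 h.2.1, h.2.2⟩⟩

theorem wp_out {i e} : wp E (.out i e) Q s ↔
    i.ok E s ∧ e.ok E s ∧ i.ev E s < E.n ∧ Q 1 (s.setO (i.ev E s) (e.ev E s)) :=
  ⟨fun ⟨_, _, h, hQ⟩ => by cases h with | out h h' h'' => exact ⟨h, h', h'', hQ⟩,
    fun h => ⟨_, _, .out h.1 h.2.1 h.2.2.1, h.2.2.2⟩⟩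

theorem wp_cap {i j} : wp E (.cap i j) Q s ↔
    i.ok E s ∧ j.ok E s ∧ j.ev E s < E.m ∧ Q 1 (s.setC (i.ev E s) (E.cp (j.ev E s))) :=
  ⟨fun ⟨_, _, h, hQ⟩ => by cases h with | cap h h' h'' => exact ⟨h, h', h'', hQ⟩,
    fun h => ⟨_, _, .cap h.1 h.2.1 h.2.2.1, h.2.2.2⟩⟩

theorem wp_seq {a b} : wp E (.seq a b) Q s ↔
    wp E a (fun t s' => wp E b (fun t' s'' => Q (t + t') s'') s') s :=
  ⟨fun ⟨_, _, h, hQ⟩ => by cases h with | seq h h' => exact ⟨_, _, h, _, _, h', hQ⟩,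
    fun ⟨_, _, h, _, _, h', hQ⟩ => ⟨_, _, .seq h h', hQ⟩⟩

theorem wp_ite {c a b} : wp E (.ite c a b) Q s ↔
    c.ok E s ∧ (c.ev E s → wp E a (fun t s' => Q (t + 1) s') s) ∧
      (¬ c.ev E s → wp E b (fun t s' => Q (t + 1) s') s) := by
  constructor
  · rintro ⟨_, _, h, hQ⟩
    cases h with
    | iteT h h' h'' => exact ⟨h, fun _ => ⟨_, _, h'', hQ⟩, fun hn => absurd h' hn⟩
    | iteF h h' h'' => exact ⟨h, fun hn => absurd hn h', fun _ => ⟨_, _, h'', hQ⟩⟩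
  · rintro ⟨h, h1, h2⟩
    by_cases hc : c.ev E s
    · obtain ⟨_, _, h3, h4⟩ := h1 hc
      exact ⟨_, _, .iteT h hc h3, h4⟩
    · obtain ⟨_, _, h3, h4⟩ := h2 hc
      exact ⟨_, _, .iteF h hc h3, h4⟩

/-- The loop rule: `J p s` is an invariant with potential `p`. -/
theorem wp_loop {c : Cd} {a : Cmd} (J : ℕ → St → Prop) (hok : ∀ p s, J p s → c.ok E s)
    (hbody : ∀ p s, J p s → c.ev E s →
      wp E a (fun t s' => ∃ p', J p' s' ∧ t + 1 + p' ≤ p) s)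
    {p : ℕ} (h0 : J p s)
    (hQ : ∀ t p' s', J p' s' → ¬ c.ev E s' → t + p' ≤ p + 1 → Q t s') :
    wp E (.loop c a) Q s := by
  induction p using Nat.strong_induction_on generalizing s Q with
  | _ p ih =>
    by_cases hc : c.ev E s
    · obtain ⟨t, s', h1, p', h2, h3⟩ := hbody p s h0 hc
      obtain ⟨t', s'', h4, h5⟩ := ih p' (by omega) h2
        (Q := fun t' s'' => Q (t + t' + 1) s'')
        (fun t' p'' s'' h4 h5 h6 => hQ _ p'' s'' h4 h5 (by omega))
      exact ⟨_, _, .loopT (hok p s h0) hc h1 h4, h5⟩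
    · exact ⟨1, s, .loopF (hok p s h0) hc, hQ 1 p s h0 hc (by omega)⟩

end wp

namespace St

variable (s : St)

theorem v_setV (x : Vr) (k : ℕ) (y : Vr) :
    (s.setV x k).v y = if y = x then k else s.v y := Function.update_apply _ _ _ _

theorem a_setA (k : Ar) (i x : ℕ) (k' : Ar) :
    (s.setA k i x).a k' = if k' = k then Function.update (s.a k) i x else s.a k' := by
  by_cases h : k' = k
  · subst h; simp [setA]
  · simp [setA, h]

theorem setV_setV (x : Vr) (k k' : ℕ) : (s.setV x k).setV x k' = s.setV x k' := by
  simp [setV]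

theorem setV_self (x : Vr) : s.setV x (s.v x) = s := by simp [setV]

end St

theorem St.simps : (∀ (s : St) x k y, (s.setV x k).v y = if y = x then k else s.v y) ∧
    (∀ (s : St) x k, (s.setV x k).a = s.a) ∧ (∀ (s : St) x k, (s.setV x k).o = s.o) ∧
    (∀ (s : St) x k, (s.setV x k).rc = s.rc) ∧ (∀ (s : St) k i x, (s.setA k i x).v = s.v) ∧
    (∀ (s : St) k i x, (s.setA k i x).o = s.o) ∧ (∀ (s : St) k i x, (s.setA k i x).rc = s.rc) ∧
    (∀ (s : St) k i x k', (s.setA k i x).a k' =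
      if k' = k then Function.update (s.a k) i x else s.a k') ∧
    (∀ (s : St) i x, (s.setO i x).v = s.v) ∧ (∀ (s : St) i x, (s.setO i x).a = s.a) ∧
    (∀ (s : St) i x, (s.setO i x).o = Function.update s.o i x) ∧
    (∀ (s : St) i x, (s.setO i x).rc = s.rc) ∧ (∀ (s : St) i x, (s.setC i x).v = s.v) ∧
    (∀ (s : St) i x, (s.setC i x).a = s.a) ∧ (∀ (s : St) i x, (s.setC i x).o = s.o) ∧
    (∀ (s : St) i x, (s.setC i x).rc = Function.update s.rc i x) :=
  ⟨St.v_setV, fun _ _ _ => rfl, fun _ _ _ => rfl, fun _ _ _ => rfl, fun _ _ _ _ => rfl,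
    fun _ _ _ _ => rfl, fun _ _ _ _ => rfl, St.a_setA, fun _ _ _ => rfl, fun _ _ _ => rfl,
    fun _ _ _ => rfl, fun _ _ _ => rfl, fun _ _ _ => rfl, fun _ _ _ => rfl, fun _ _ _ => rfl,
    fun _ _ _ => rfl⟩

infixr:50 " ;; " => Cmd.seq

/-! ### The program -/

/-- Put the node with flow `i` and vertex `v` on the list with index `h`. -/
def pushC (h i v : Ex) : Cmd :=
  .asg .cnt (.add (.v .cnt) (.c 1)) ;;
  .put .ci (.v .cnt) i ;;
  .put .cv (.v .cnt) v ;;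
  .put .nx (.v .cnt) (.get .hh h) ;;
  .put .hh h (.v .cnt)

/-- Find the level for the key `d`, from the level `l` on. -/
def walkC : Cmd :=
  .loop (.lt (.v .d) (.get .ub (.add (.v .l) (.c 1)))) (.asg .l (.add (.v .l) (.c 1)))

/-- Give the node `y` the key `d`. -/
def improveC : Cmd :=
  .put .key (.v .y) (.v .d) ;;
  .put .pv (.v .y) (.v .v) ;;
  .put .pr (.v .y) (.v .ad) ;;
  .asg .l (.v .f) ;;
  walkC ;;
  .put .lev (.v .y) (.v .l) ;;
  .ite (.lt (.v .l) (.c 2))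
    (.asg .t (.add (.v .e) (.get .wh (.v .q))) ;;
      .ite (.lt (.v .d) (.add (.v .t) (.v .qq))) .skip (.asg .t (.add (.v .t) (.v .qq))) ;;
      pushC (.add (.add (.v .kk) (.c 1)) (.v .t)) (.v .i) (.get .hd (.v .q)))
    (.ite (.lt (.v .f) (.v .l)) (pushC (.v .l) (.v .i) (.get .hd (.v .q))) .skip)

/-- Relax the edge `q`. -/
def relaxC : Cmd :=
  .ite (.capLt (.get .cx (.v .q)) (.v .i)) .skip
    (.asg .y (.add (.v .r) (.get .hd (.v .q))) ;;
      .asg .d (.add (.v .cur) (.get .wt (.v .q))) ;;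
      .asg .f (.get .lev (.v .y)) ;;
      -- Level `0`, the initial content of memory, marks a node that has not been seen; its search
      -- for a level starts at `1`.
      .ite (.lt (.v .f) (.c 1)) (.asg .f (.c 1) ;; improveC)
        (.ite (.lt (.v .d) (.get .key (.v .y))) improveC .skip)) ;;
  .asg .q (.get .an (.v .q))

/-- Overwrite the record `a` with the node `x`. -/
def overC : Cmd :=
  .put .rp (.v .a) (.get .pv (.v .x)) ;;
  .put .rr (.v .a) (.get .pr (.v .x)) ;;
  .put .rf (.v .a) (.v .i) ;;
  .cap (.v .a) (.v .i)

/-- Make a new record of the node `x`. -/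
def newC : Cmd :=
  .asg .rc (.add (.v .rc) (.c 1)) ;;
  .put .rd (.v .rc) (.v .cur) ;;
  .put .rp (.v .rc) (.get .pv (.v .x)) ;;
  .put .rr (.v .rc) (.get .pr (.v .x)) ;;
  .put .rf (.v .rc) (.v .i) ;;
  .ite (.lt (.c 0) (.v .a)) (.put .rn (.v .rc) (.adr (.v .a))) (.put .rn (.v .rc) (.c 0)) ;;
  .put .hr (.v .v) (.v .rc) ;;
  .out (.v .v) (.adr (.v .rc)) ;;
  .cap (.v .rc) (.v .i)

/-- Record the settled node `x`, if it is useful. -/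
def recordC : Cmd :=
  .asg .a (.get .hr (.v .v)) ;;
  .ite (.lt (.c 0) (.v .a))
    (.ite (.capLt (.get .rf (.v .a)) (.v .i))
      (.ite (.lt (.get .rd (.v .a)) (.v .cur)) newC overC) .skip)
    newC

/-- Settle the first node of the last level. -/
def settleC : Cmd :=
  .asg .c (.get .hh (.v .kk)) ;;
  .put .hh (.v .kk) (.get .nx (.v .c)) ;;
  .asg .i (.get .ci (.v .c)) ;;
  .asg .v (.get .cv (.v .c)) ;;
  .asg .r (.get .row (.v .i)) ;;
  .asg .x (.add (.v .r) (.v .v)) ;;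
  recordC ;;
  .asg .ad (.adr (.get .hr (.v .v))) ;;
  .asg .q (.get .ah (.v .v)) ;;
  .loop (.lt (.c 0) (.v .q)) relaxC

/-- The node of the cell `c`. -/
def cellE : Ex := .add (.get .row (.get .ci (.v .c))) (.get .cv (.v .c))

/-- The minimum key `g` of level `j`. -/
def minC : Cmd :=
  .loop (.lt (.c 0) (.v .c))
    (.asg .x cellE ;;
      .ite (.lt (.get .lev (.v .x)) (.add (.v .j) (.c 1)))
        (.ite (.lt (.get .key (.v .x)) (.v .g)) (.asg .g (.get .key (.v .x))) .skip) .skip ;;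
      .asg .c (.get .nx (.v .c)))

/-- New bounds of the levels after `j`. -/
def boundsC : Cmd :=
  .put .ub (.add (.v .j) (.c 1)) (.get .ub (.v .j)) ;;
  .asg .l (.add (.v .j) (.c 2)) ;;
  .loop (.lt (.v .l) (.add (.v .kk) (.c 1)))
    (.put .ub (.v .l) (.add (.v .cur) (.get .pw (.v .l))) ;;
      .asg .l (.add (.v .l) (.c 1)))

/-- Distribute the items of level `j`. -/
def spreadC : Cmd :=
  .loop (.lt (.c 0) (.v .c))
    (.asg .x cellE ;;
      .ite (.lt (.get .lev (.v .x)) (.add (.v .j) (.c 1)))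
        (.asg .d (.get .key (.v .x)) ;;
          .asg .l (.add (.v .j) (.c 1)) ;;
          walkC ;;
          .put .lev (.v .x) (.v .l) ;;
          pushC (.v .l) (.get .ci (.v .c)) (.get .cv (.v .c))) .skip ;;
      .asg .c (.get .nx (.v .c)))

/-- Distribute level `j`, or drop it if it holds no more items. -/
def redisC : Cmd :=
  .asg .h (.get .hh (.v .j)) ;;
  .put .hh (.v .j) (.c 0) ;;
  .asg .g (.get .ub (.v .j)) ;;
  .asg .c (.v .h) ;;
  minC ;;
  .ite (.lt (.v .g) (.get .ub (.v .j)))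
    (.asg .cur (.v .g) ;; boundsC ;; .asg .c (.v .h) ;; spreadC ;; .asg .j (.v .kk)) .skip

/-- Open the next top bucket. -/
def advC : Cmd :=
  .asg .e (.add (.v .e) (.v .qq)) ;;
  .put .ub (.c 1) (.add (.v .e) (.v .qq)) ;;
  .asg .x (.add (.add (.v .kk) (.c 1)) (.v .e)) ;;
  .put .hh (.c 1) (.get .hh (.v .x)) ;;
  .put .hh (.v .x) (.c 0)

/-- One step of the main loop. -/
def stepC : Cmd :=
  .ite (.lt (.c 0) (.get .hh (.v .j)))
    (.ite (.lt (.v .j) (.v .kk)) redisC settleC)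
    (.ite (.lt (.c 1) (.v .j)) (.asg .j (.get .dec (.v .j))) advC)

/-- The main loop. -/
def mainC : Cmd := .loop (.lt (.v .e) (.add (.v .em) (.c 1))) stepC

/-- Read the edges. -/
def readC : Cmd :=
  .asg .n (.inp (.c 0)) ;;
  .asg .m (.inp (.c 1)) ;;
  .asg .s (.inp (.c 2)) ;;
  .asg .p (.c 3) ;;
  .loop (.lt (.v .i) (.v .m))
    (.asg .q (.add (.v .i) (.c 1)) ;;
      .asg .u (.inp (.v .p)) ;;
      .asg .w (.inp (.add (.v .p) (.c 2))) ;;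
      .put .hd (.v .q) (.inp (.add (.v .p) (.c 1))) ;;
      .put .wt (.v .q) (.v .w) ;;
      .put .cx (.v .q) (.v .i) ;;
      .put .an (.v .q) (.get .ah (.v .u)) ;;
      .put .ah (.v .u) (.v .q) ;;
      .put .row (.v .i) (.v .r) ;;
      .asg .r (.add (.v .r) (.v .n)) ;;
      .asg .p (.add (.v .p) (.c 3)) ;;
      .ite (.lt (.v .mx) (.v .w)) (.asg .mx (.v .w)) .skip ;;
      .asg .i (.v .q))

/-- The number of levels and the width of the top buckets. -/
def levelsC : Cmd :=
  .asg .pp (.v .m) ;;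
  .asg .qq (.c 1) ;;
  .asg .kk (.c 2) ;;
  .put .dec (.c 2) (.c 1) ;;
  .loop (.lt (.v .pp) (.v .mx))
    (.asg .pp (.add (.v .pp) (.v .pp)) ;;
      .asg .qq (.add (.v .qq) (.v .qq)) ;;
      .put .dec (.add (.v .kk) (.c 1)) (.v .kk) ;;
      .asg .kk (.add (.v .kk) (.c 1))) ;;
  .asg .j (.v .kk) ;;
  .asg .t (.c 1) ;;
  .loop (.lt (.c 1) (.v .j))
    (.put .pw (.v .j) (.v .t) ;;
      .asg .t (.add (.v .t) (.v .t)) ;;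
      .asg .j (.get .dec (.v .j)))

/-- Round the costs down to multiples of the width, and insert the sources. -/
def startC : Cmd :=
  .asg .i (.c 0) ;;
  .loop (.lt (.v .i) (.v .m))
    (.asg .q (.add (.v .i) (.c 1)) ;;
      .asg .t (.c 0) ;;
      .loop (.lt (.add (.v .t) (.v .qq)) (.add (.get .wt (.v .q)) (.c 1)))
        (.asg .t (.add (.v .t) (.v .qq))) ;;
      .put .wh (.v .q) (.v .t) ;;
      .asg .em (.add (.v .em) (.v .mx)) ;;
      .put .lev (.add (.get .row (.v .i)) (.v .s)) (.c 1) ;;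
      pushC (.c 1) (.v .i) (.v .s) ;;
      .asg .i (.v .q)) ;;
  .put .ub (.c 1) (.v .qq)

/-- The whole program. -/
def solverC : Cmd := readC ;; levelsC ;; startC ;; mainC

/-! ### Lists in memory -/

/-- The list of nodes in the cells that start at a given cell. -/
inductive Ch (I : Inst) (nx ci cv : ℕ → ℕ) : ℕ → List ℕ → Prop
  | nil : Ch I nx ci cv 0 []
  | cons {c : ℕ} {l : List ℕ} : 0 < c → ci c < I.m → cv c < I.n → nx c < c →
      Ch I nx ci cv (nx c) l → Ch I nx ci cv c (I.node (ci c) (cv c) :: l)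

/-- Cells link only to smaller cells, so writing to cells above the first one of a chain leaves the
chain intact. Cells are never reused, hence a list can be traversed while new entries are made
elsewhere. -/
theorem Ch.congr {I : Inst} {nx ci cv nx' ci' cv' : ℕ → ℕ} {b : ℕ}
    (h1 : ∀ c ≤ b, nx' c = nx c) (h2 : ∀ c ≤ b, ci' c = ci c) (h3 : ∀ c ≤ b, cv' c = cv c)
    {c : ℕ} {l : List ℕ} (h : Ch I nx ci cv c l) (hc : c ≤ b) : Ch I nx' ci' cv' c l := by
  induction h with
  | nil => exact .nil
  | @cons c l a1 a2 a3 a4 _ ih =>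
    have ih := ih (by omega)
    rw [← h1 c hc] at ih
    have := Ch.cons (I := I) (nx := nx') (ci := ci') (cv := cv') a1 (by rwa [h2 c hc])
      (by rwa [h3 c hc]) (by rwa [h1 c hc]) ih
    rwa [h2 c hc, h3 c hc] at this

theorem Ch.ne_nil_iff {I : Inst} {nx ci cv : ℕ → ℕ} {c : ℕ} {l : List ℕ} (h : Ch I nx ci cv c l) :
    0 < c ↔ l ≠ [] := by
  cases h with
  | nil => simp
  | cons h => simp [h]

/-- All lists of the queue. -/
def ChAll (I : Inst) (nx ci cv hh : ℕ → ℕ) (cnt : ℕ) (lst : ℕ → List ℕ) : Prop :=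
  ∀ k, Ch I nx ci cv (hh k) (lst k) ∧ hh k ≤ cnt

theorem ChAll.push {I : Inst} {nx ci cv hh : ℕ → ℕ} {cnt : ℕ} {lst : ℕ → List ℕ}
    (h : ChAll I nx ci cv hh cnt lst) {i v : ℕ} (hi : i < I.m) (hv : v < I.n) (k : ℕ) :
    ChAll I (Function.update nx (cnt + 1) (hh k)) (Function.update ci (cnt + 1) i)
      (Function.update cv (cnt + 1) v) (Function.update hh k (cnt + 1)) (cnt + 1)
      (Function.update lst k (I.node i v :: lst k)) := by
  have u : ∀ (f : ℕ → ℕ) (x c : ℕ), c ≤ cnt → Function.update f (cnt + 1) x c = f c :=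
    fun f x c hc => Function.update_of_ne (by omega) _ _
  intro k'
  obtain ⟨h1, h2⟩ := h k'
  rcases eq_or_ne k' k with rfl | hk
  · simp only [Function.update_self]
    refine ⟨?_, le_rfl⟩
    have := Ch.cons (I := I) (c := cnt + 1) (l := lst k')
      (nx := Function.update nx (cnt + 1) (hh k')) (ci := Function.update ci (cnt + 1) i)
      (cv := Function.update cv (cnt + 1) v) (by omega) (by simpa using hi) (by simpa using hv)
      (by simp only [Function.update_self]; omega)
      (by
        rw [Function.update_self]
        exact h1.congr (u nx _) (u ci _) (u cv _) h2)
    simpa using this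
  · rw [Function.update_of_ne hk, Function.update_of_ne hk]
    exact ⟨h1.congr (u nx _) (u ci _) (u cv _) h2, by omega⟩

theorem ChAll.set {I : Inst} {nx ci cv hh : ℕ → ℕ} {cnt : ℕ} {lst : ℕ → List ℕ}
    (h : ChAll I nx ci cv hh cnt lst) {k c : ℕ} {l : List ℕ} (hc : Ch I nx ci cv c l)
    (hle : c ≤ cnt) : ChAll I nx ci cv (Function.update hh k c) cnt (Function.update lst k l) := by
  intro k'
  rcases eq_or_ne k' k with rfl | hk
  · simp only [Function.update_self]; exact ⟨hc, hle⟩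
  · rw [Function.update_of_ne hk, Function.update_of_ne hk]; exact h k'

/-- The adjacency list of a vertex; the edge `e` is stored as `e + 1`. -/
inductive Adj (an : ℕ → ℕ) : ℕ → List ℕ → Prop
  | nil : Adj an 0 []
  | cons {e : ℕ} {l : List ℕ} : Adj an (an (e + 1)) l → Adj an (e + 1) (e :: l)

/-- The edges among the first `k` ones that leave `u`. -/
def Inst.outE (I : Inst) (k u : ℕ) : List ℕ := ((List.range k).filter (I.tl · = u)).reverse

theorem Inst.mem_outE (I : Inst) {k u e : ℕ} : e ∈ I.outE k u ↔ e < k ∧ I.tl e = u := by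
  simp [Inst.outE]

/-- The data which are computed before the main loop. -/
structure Stat (I : Inst) (kk qq em : ℕ) (row pw dec ah an hd wt wh cx : ℕ → ℕ) : Prop where
  kk_eq : kk = I.K
  qq_eq : qq = 2 ^ (I.K - 2)
  em_eq : em = I.m * I.mx
  row_eq : ∀ i < I.m, row i = i * I.n
  pw_eq : ∀ i, 2 ≤ i → i ≤ I.K → pw i = 2 ^ (I.K - i)
  dec_eq : ∀ j, 2 ≤ j → j ≤ I.K → dec j = j - 1
  adj : ∀ u < I.n, Adj an (ah u) (I.outE I.m u)
  hd_eq : ∀ e < I.m, hd (e + 1) = I.hd e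
  wt_eq : ∀ e < I.m, wt (e + 1) = I.wt e
  wh_eq : ∀ e < I.m, qq ∣ wh (e + 1) ∧ wh (e + 1) ≤ I.wt e ∧ I.wt e < wh (e + 1) + qq
  cx_eq : ∀ e < I.m, cx (e + 1) = e

/-! ### Potential and invariant -/

namespace Inst

variable (I : Inst)

/-- The width of the top buckets. -/
def Q : ℕ := 2 ^ (I.K - 2)

/-- A bound on the distances. -/
def EM : ℕ := I.m * I.mx

/-- The number of lists. -/
def HB : ℕ := I.K + 2 + I.EM + 3 * I.Q + I.mx

/-- The vertices which may be reached. -/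
def vs : Finset ℕ := insert I.s ((Finset.range I.m).image I.hd)

/-- The nodes which may be reached. -/
def X : Finset ℕ := (Finset.product (Finset.range I.m) I.vs).image fun p => I.node p.1 p.2

/-- The number of edges that leave the vertex of a node. -/
def dg (x : ℕ) : ℕ := (I.outE I.m (x % I.n)).length

/-- Each entry carries `16` units in `pot`: `6` for the scan for the minimum and `10` for the
distribution. -/
def potL (lst : ℕ → List ℕ) : ℕ := ∑ k ∈ Finset.range I.HB, (lst k).length

/-- An item at level `l` holds `20` units for each level ahead of it, which pay for the search and
the new entry. The extra `10 * (K + 2)` units are released on arrival at level `K`: every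
redistribution sends its minimum there, and this pays for the new bounds and for raising `j` to `K`.
-/
def LV (l : ℕ) : ℕ := 10 * (I.K + 2) * (if l < I.K then 1 else 0) + 20 * (I.K - l)

def potV (lev : ℕ → ℕ) : ℕ := ∑ x ∈ I.X, I.LV (lev x)

/-- Each outgoing edge of an unsettled node pays for its relaxation, and the summand `1` for
settling the node itself. -/
def potS (S : Finset ℕ) : ℕ := ∑ x ∈ I.X \ S, (I.dg x + 1)

/-- While `e ≤ EM`, this is the number of top buckets that are still to be opened before the search
ends. -/
def potE (e : ℕ) : ℕ := (I.EM + I.Q - e) / I.Q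

/-- The potential. -/
def pot (lst : ℕ → List ℕ) (lev : ℕ → ℕ) (S : Finset ℕ) (j e : ℕ) : ℕ :=
  -- The term `4 * j` pays for stepping back through empty levels.
  16 * I.potL lst + I.potV lev + 50 * I.potS S + 4 * j + 10 * I.potE e

variable {I}

theorem potL_update {k : ℕ} (hk : k < I.HB) (lst : ℕ → List ℕ) (l : List ℕ) :
    I.potL (Function.update lst k l) + (lst k).length = I.potL lst + l.length := by
  unfold potL
  rw [← Finset.add_sum_erase _ _ (Finset.mem_range.2 hk),
    ← Finset.add_sum_erase _ (fun k => (lst k).length) (Finset.mem_range.2 hk),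
    Function.update_self, Finset.sum_congr rfl fun x hx => by
      rw [Function.update_of_ne (Finset.ne_of_mem_erase hx)]]
  omega

theorem potV_update {y : ℕ} (hy : y ∈ I.X) (lev : ℕ → ℕ) (l : ℕ) :
    I.potV (Function.update lev y l) + I.LV (lev y) = I.potV lev + I.LV l := by
  unfold potV
  rw [← Finset.add_sum_erase _ _ hy, ← Finset.add_sum_erase _ (fun x => I.LV (lev x)) hy,
    Function.update_self, Finset.sum_congr rfl fun x hx => by
      rw [Function.update_of_ne (Finset.ne_of_mem_erase hx)]]
  omega

theorem potS_insert {x : ℕ} (hx : x ∈ I.X) {S : Finset ℕ} (hS : x ∉ S) :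
    I.potS (insert x S) + (I.dg x + 1) = I.potS S := by
  unfold potS
  have h : x ∈ I.X \ S := Finset.mem_sdiff.2 ⟨hx, hS⟩
  rw [← Finset.sum_erase_add _ _ h]
  congr 2
  ext y
  simp only [Finset.mem_sdiff, Finset.mem_insert, Finset.mem_erase]
  tauto

theorem LV_le {l l' : ℕ} (h : l ≤ l') (hK : l' ≤ I.K) : I.LV l' + 20 * (l' - l) ≤ I.LV l := by
  unfold LV
  split_ifs <;> omega

theorem LV_K {l : ℕ} (h : l < I.K) : I.LV I.K + 20 * (I.K - l) + 10 * (I.K + 2) ≤ I.LV l := by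
  unfold LV
  simp [h]; omega

theorem Reach.mem_vs {i v d : ℕ} (h : I.Reach i v d) : v ∈ I.vs := by
  cases h with
  | src => exact Finset.mem_insert_self _ _
  | step _ he _ =>
    exact Finset.mem_insert_of_mem (Finset.mem_image_of_mem _ (Finset.mem_range.2 he))

theorem hd_mem_vs {e : ℕ} (he : e < I.m) : I.hd e ∈ I.vs :=
  Finset.mem_insert_of_mem (Finset.mem_image_of_mem _ (Finset.mem_range.2 he))

theorem node_mem_X {i v : ℕ} (hi : i < I.m) (hv : v ∈ I.vs) : I.node i v ∈ I.X :=
  Finset.mem_image.2 ⟨(i, v), Finset.mem_product.2 ⟨Finset.mem_range.2 hi, hv⟩, rfl⟩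

theorem dg_node {i v : ℕ} (hv : v < I.n) : I.dg (I.node i v) = (I.outE I.m v).length := by
  unfold dg node
  rw [Nat.add_comm, Nat.add_mul_mod_self_right, Nat.mod_eq_of_lt hv]

theorem node_lt {i v : ℕ} (hi : i < I.m) (hv : v < I.n) : I.node i v < I.m * I.n := by
  unfold node
  calc i * I.n + v < i * I.n + I.n := by omega
    _ = (i + 1) * I.n := by ring
    _ ≤ I.m * I.n := Nat.mul_le_mul_right _ hi

theorem vs_lt {v : ℕ} (hv : v ∈ I.vs) : v < I.n := by
  rcases Finset.mem_insert.1 hv with rfl | hv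
  · exact I.s_lt
  · obtain ⟨e, he, rfl⟩ := Finset.mem_image.1 hv
    exact I.hd_lt e (Finset.mem_range.1 he)

theorem X_subset : I.X ⊆ Finset.range (I.m * I.n) := by
  intro x hx
  obtain ⟨⟨i, v⟩, h, rfl⟩ := Finset.mem_image.1 hx
  obtain ⟨h1, h2⟩ := Finset.mem_product.1 h
  exact Finset.mem_range.2 (node_lt (Finset.mem_range.1 h1) (vs_lt h2))

end Inst

/-- The environment belongs to the instance, and its words are large enough. -/
structure Fit (I : Inst) (E : Env) (CM : ℕ) : Prop where
  n : E.n = I.n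
  m : E.m = I.m
  cp : E.cp = I.cp
  W : E.B + 32 * (I.m * I.n + 2) + 4 * I.HB + 4 * CM + I.m + I.n + 100 ≤ E.W

/-- The invariant of the main loop and of the loops inside it. -/
structure LInv (I : Inst) (E : Env) (lst : ℕ → List ℕ) (S : Finset ℕ) (recs : ℕ → List ℕ)
    (ρ : ℕ → ℕ) (jj : ℕ) (rem : List ℕ) (r x₀ : ℕ) (rest : List ℕ) (s : St) : Prop where
  st : Stat I (s.v .kk) (s.v .qq) (s.v .em) (s.a .row) (s.a .pw) (s.a .dec) (s.a .ah) (s.a .an)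
    (s.a .hd) (s.a .wt) (s.a .wh) (s.a .cx)
  qi : QI I.K I.Q (s.a .key) (s.a .lev) (s.a .ub) lst S (s.v .e) (s.v .cur) jj rem r
  di : DI I (s.a .key) (s.a .lev) S x₀ rest
  ri : RI I E.B (s.a .key) (s.a .lev) S (s.a .rd) (s.a .rp) (s.a .rr) (s.a .rf) (s.a .pv)
    (s.a .pr) recs (s.v .rc) ρ
  ch : ChAll I (s.a .nx) (s.a .ci) (s.a .cv) (s.a .hh) (s.v .cnt) lst
  rch : ∀ v < I.n, RCh E.B (s.a .rn) (recs v) ∧ s.a .hr v = (recs v).headD 0 ∧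
    s.o v = adrOf E.B ((recs v).headD 0)
  rcc : ∀ v < I.n, ∀ a ∈ recs v, s.rc a = I.cp (s.a .rf a)
  el : s.v .e ≤ I.EM + I.Q

/-! ### Finding a level and relaxing the edges of a settled node -/

theorem walk_spec {E : Env} {s : St} {K : ℕ} (hK : K + 1 ≤ E.W) (h0 : s.a .ub (K + 1) = 0)
    (hl : s.v .l ≤ K) :
    wp E walkC (fun t s' => ∃ l, s' = s.setV .l l ∧ s.v .l ≤ l ∧ l ≤ K ∧
      (∀ i, s.v .l < i → i ≤ l → s.v .d < s.a .ub i) ∧ s.a .ub (l + 1) ≤ s.v .d ∧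
      t ≤ 2 * (l - s.v .l) + 1) s := by
  refine wp_loop (J := fun p s' => ∃ l, s' = s.setV .l l ∧ s.v .l ≤ l ∧ l ≤ K ∧
      (∀ i, s.v .l < i → i ≤ l → s.v .d < s.a .ub i) ∧ p = 2 * (K - l))
    ?_ ?_ (p := 2 * (K - s.v .l)) ⟨s.v .l, (s.setV_self _).symm, le_rfl, hl, by omega, rfl⟩ ?_
  · rintro p _ ⟨l, rfl, -, hlK, -⟩
    simp [Cd.ok, Ex.ok, Ex.ev, St.simps]
    omega
  · rintro p _ ⟨l, rfl, h1, hlK, h2, rfl⟩ hc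
    simp only [Cd.ev, Ex.ev, St.simps, reduceCtorEq, if_false, if_true] at hc
    have hlt : l < K := by
      rcases hlK.lt_or_eq with h | h
      · exact h
      · rw [h, h0] at hc; omega
    simp only [wp_asg, Ex.ok, Ex.ev, St.simps, if_true, St.setV_setV]
    refine ⟨⟨trivial, by omega, by omega⟩, 2 * (K - (l + 1)), ⟨l + 1, rfl, by omega, by omega,
      fun i hi hi' => ?_, rfl⟩, by omega⟩
    rcases (show i ≤ l ∨ i = l + 1 by omega) with h | rfl
    · exact h2 i hi h
    · exact hc
  · rintro t p _ ⟨l, rfl, h1, hlK, h2, rfl⟩ hc ht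
    simp only [Cd.ev, Ex.ev, St.simps, reduceCtorEq, if_false, if_true] at hc
    exact ⟨l, rfl, h1, hlK, h2, not_lt.1 hc, by omega⟩

/-- The variables while the node of flow `i` and vertex `u` is being settled. -/
structure Ctx (I : Inst) (E : Env) (recs : ℕ → List ℕ) (i u b : ℕ) (S : Finset ℕ) (s : St) :
    Prop where
  vi : s.v .i = i
  vv : s.v .v = u
  vr : s.v .r = i * I.n
  vad : s.v .ad = E.B + 32 * b
  hi : i < I.m
  hu : u < I.n
  hb : b ∈ recs u
  hd : s.a .rd b = s.v .cur
  hc : I.cp i ≤ I.cp (s.a .rf b)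
  hS : I.node i u ∈ S
  hkey : s.a .key (I.node i u) = s.v .cur
  vj : s.v .j = I.K

theorem LInv.mem_X {I : Inst} {E : Env} {lst : ℕ → List ℕ} {S : Finset ℕ} {recs : ℕ → List ℕ}
    {ρ : ℕ → ℕ} {jj : ℕ} {rem : List ℕ} {r x₀ : ℕ} {rest : List ℕ} {s : St}
    (h : LInv I E lst S recs ρ jj rem r x₀ rest s) {x : ℕ} (hx : s.a .lev x ≠ 0) : x ∈ I.X := by
  obtain ⟨i, hi, v, rfl, hr⟩ := h.di.snd x hx
  exact Inst.node_mem_X hi hr.mem_vs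

theorem LInv.S_subset {I : Inst} {E : Env} {lst : ℕ → List ℕ} {S : Finset ℕ} {recs : ℕ → List ℕ}
    {ρ : ℕ → ℕ} {jj : ℕ} {rem : List ℕ} {r x₀ : ℕ} {rest : List ℕ} {s : St}
    (h : LInv I E lst S recs ρ jj rem r x₀ rest s) : S ⊆ I.X := fun x hx => h.mem_X <| by
  have := (h.qi.Sk x hx).1
  have := I.K2
  omega

section

variable {I : Inst} {E : Env} {CM : ℕ} {lst : ℕ → List ℕ} {S : Finset ℕ} {recs : ℕ → List ℕ}
  {ρ : ℕ → ℕ} {r : ℕ} {rest : List ℕ} {s : St}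

/-- The length of the walk to the new level is paid by the fall of `potV`, which is `20` for each
level gained. The allowance of `33` covers a possible new entry, worth `16`, and the bounded number
of other steps. -/
theorem improve_spec {i u b e : ℕ} (hE : Fit I E CM)
    (h : LInv I E lst S recs ρ I.K [] r (I.node i u) (e :: rest) s)
    (hx : Ctx I E recs i u b S s) (he : e < I.m) (htl : I.tl e = u) (hq : s.v .q = e + 1)
    (hy : s.v .y = I.node i (I.hd e)) (hd : s.v .d = s.v .cur + I.wt e)
    (hf : s.v .f = max 1 (s.a .lev (I.node i (I.hd e)))) (hcp : I.cp i ≤ I.cp e)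
    (himp : s.a .lev (I.node i (I.hd e)) = 0 ∨ s.v .d < s.a .key (I.node i (I.hd e)))
    (hcnt : s.v .cnt ≤ CM) (heE : s.v .e ≤ I.EM) :
    wp E improveC (fun t s' => ∃ lst', LInv I E lst' S recs ρ I.K [] r (I.node i u) rest s' ∧
      Ctx I E recs i u b S s' ∧ s'.v .q = e + 1 ∧ s'.v .cnt ≤ s.v .cnt + 1 ∧ s'.v .e = s.v .e ∧
      s'.a .an = s.a .an ∧
      t + 16 * I.potL lst' + I.potV (s'.a .lev) ≤
        16 * I.potL lst + I.potV (s.a .lev) + 33) s := by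
  have hW := hE.W
  have hHB : I.HB = I.K + 2 + I.EM + 3 * I.Q + I.mx := rfl
  have hK2 := I.K2
  have hwt := I.wt_le e he
  set y := I.node i (I.hd e) with hyd
  have hkk := h.st.kk_eq
  have hqq : s.v .qq = I.Q := h.st.qq_eq
  have hhd := h.st.hd_eq e he
  obtain ⟨whd, whl, whu⟩ := h.st.wh_eq e he
  obtain ⟨ub2, ecur, cure, -⟩ := h.qi.ph (by omega)
  -- Settled nodes have been seen and have keys at most `cur`, which is at most the new key, so they
  -- are never improved.
  have hyS : y ∉ S := by
    intro hyS
    have := h.qi.Sk y hyS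
    rcases himp with h' | h'
    · omega
    · omega
  have hlevK : s.a .lev y ≤ I.K := h.qi.levK y
  have hfK : s.v .f ≤ I.K := by omega
  have hud : ∀ x, I.node i u = x → x ≠ y := fun x hx' e => hyS (by rw [← e, ← hx']; exact hx.hS)
  have DR := fun l (hl : l ≠ 0) => h.di.relax (l := l) hx.hi he (by rw [htl]) (by
    have := (h.qi.Sk _ hx.hS).1
    omega) hcp hyS hl (by rw [hx.hkey, ← hd]; exact himp)
  rw [hx.hkey, ← hd, ← hyd] at DR
  have RR := fun l => h.ri.relax (l := l) (d := s.v .d) (b := b) he hcp hyS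
    (by rw [htl]; exact hx.hb) (by rw [hx.hd, hd]) hx.hc
  rw [← hyd, htl] at RR
  have hle : s.a .lev y = 0 ∨ s.v .d ≤ s.a .key y := himp.imp_right le_of_lt
  simp only [improveC, wp_seq, wp_put, wp_asg, Ex.ok, Ex.ev, true_and, St.simps]
  refine (walk_spec (K := I.K) (by omega) ?_ ?_).mono ?_
  · simp only [St.simps]; exact h.qi.ub0
  · simp only [St.simps, if_true]; exact hfK
  rintro t _ ⟨l, rfl, h1, h2, h3, h4, h5⟩
  simp only [St.simps, reduceCtorEq, if_false, if_true] at h1 h3 h4 h5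
  simp only [pushC, wp_seq, wp_put, wp_asg, wp_ite, wp_skip, Cd.ok, Cd.ev, Ex.ok, Ex.ev, true_and,
    St.simps, reduceCtorEq, if_false, if_true, and_true, St.setV_setV]
  have hyX : y ∈ I.X := Inst.node_mem_X hx.hi (Inst.hd_mem_vs he)
  have hl1 : 1 ≤ l := by omega
  have hll : s.a .lev y ≤ l := by omega
  have PV := Inst.potV_update hyX (s.a .lev) l
  have LVl := Inst.LV_le hll h2
  have DRl := DR l (by omega)
  have keyne : ∀ x ∈ S, ∀ k, Function.update (s.a .key) y k x = s.a .key x := fun x hx' k =>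
    Function.update_of_ne (fun h' => hyS (by rw [← h']; exact hx')) _ _
  have top : l < 2 → ∀ e', I.Q ∣ e' → s.v .e + I.Q ≤ e' → e' ≤ s.v .d → s.v .d < e' + I.Q →
      QI I.K I.Q (Function.update (s.a .key) y (s.v .d)) (Function.update (s.a .lev) y l)
        (s.a .ub) (Function.update lst (I.K + 1 + e') (y :: lst (I.K + 1 + e'))) S (s.v .e)
        (s.v .cur) I.K [] r ∧
      16 * I.potL (Function.update lst (I.K + 1 + e') (y :: lst (I.K + 1 + e'))) =
        16 * I.potL lst + 16 := by
    intro hl2 e' d1 d2 d3 d4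
    obtain rfl : l = 1 := by omega
    refine ⟨h.qi.placeTop hyS hle (by omega) d1 d2 d3 d4, ?_⟩
    have := Inst.potL_update (I := I) (k := I.K + 1 + e') (by omega) lst
      (y :: lst (I.K + 1 + e'))
    rw [List.length_cons] at this
    omega
  have low : ¬ l < 2 → QI I.K I.Q (Function.update (s.a .key) y (s.v .d))
      (Function.update (s.a .lev) y l) (s.a .ub)
      (if s.a .lev y < l then Function.update lst l (y :: lst l) else lst) S (s.v .e) (s.v .cur)
      I.K [] r := by
    intro hl2
    refine h.qi.place hyS hle (by omega) hll (by omega) h2 ?_ (fun _ => h4) (by simp) (by simp)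
    intro k hk hkl
    -- Beyond the old level the walk itself has compared with the bound; up to the old level the
    -- bound already held for the old, greater key.
    by_cases hk' : s.v .f < k
    · exact h3 k hk' hkl
    · rcases himp with h' | h'
      · omega
      · exact h'.trans (h.qi.up y k hyS hk (by omega))
  have dge : l < 2 → s.v .e + I.Q ≤ s.v .d := by
    intro hl2
    obtain rfl : l = 1 := by omega
    rw [← ub2]; exact h4
  have hcurX := h.el
  have cx : ∀ s' : St, s'.v .i = s.v .i → s'.v .v = s.v .v → s'.v .r = s.v .r →
      s'.v .ad = s.v .ad → s'.a .rd = s.a .rd → s'.v .cur = s.v .cur → s'.a .rf = s.a .rf →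
      s'.a .key = Function.update (s.a .key) y (s.v .d) → s'.v .j = s.v .j →
      Ctx I E recs i u b S s' := by
    intro s' e1 e2 e3 e4 e5 e6 e7 e8 e9
    refine ⟨by rw [e1, hx.vi], by rw [e2, hx.vv], by rw [e3, hx.vr], by rw [e4, hx.vad], hx.hi,
      hx.hu, hx.hb, by rw [e5, e6, hx.hd], by rw [e7]; exact hx.hc, hx.hS, ?_, by rw [e9, hx.vj]⟩
    rw [e8, e6, keyne _ hx.hS, hx.hkey]
  have inv : ∀ (lst' : ℕ → List ℕ) (s' : St),
      QI I.K I.Q (Function.update (s.a .key) y (s.v .d)) (Function.update (s.a .lev) y l)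
        (s.a .ub) lst' S (s.v .e) (s.v .cur) I.K [] r →
      ChAll I (s'.a .nx) (s'.a .ci) (s'.a .cv) (s'.a .hh) (s'.v .cnt) lst' →
      s'.v .kk = s.v .kk → s'.v .qq = s.v .qq → s'.v .em = s.v .em → s'.v .rc = s.v .rc →
      s'.v .e = s.v .e → s'.v .cur = s.v .cur → s'.o = s.o → s'.rc = s.rc →
      s'.a .key = Function.update (s.a .key) y (s.v .d) →
      s'.a .lev = Function.update (s.a .lev) y l →
      s'.a .pv = Function.update (s.a .pv) y (s.v .v) →
      s'.a .pr = Function.update (s.a .pr) y (s.v .ad) →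
      (∀ k ∈ ([.row, .pw, .dec, .ah, .an, .hd, .wt, .wh, .cx, .rd, .rp, .rr, .rn, .rf, .hr,
        .ub] : List Ar), s'.a k = s.a k) →
      LInv I E lst' S recs ρ I.K [] r (I.node i u) rest s' := by
    intro lst' s' q c e1 e2 e3 e4 e5 e6 e7 e8 e9 e10 e11 e12 ha
    simp only [List.forall_mem_cons, List.not_mem_nil, false_imp_iff, implies_true, and_true] at ha
    obtain ⟨a1, a2, a3, a4, a5, a6, a7, a8, a9, a10, a11, a12, a13, a14, a15, a16⟩ := ha
    refine ⟨?_, ?_, ?_, ?_, c, ?_, ?_, ?_⟩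
    · rw [e1, e2, e3, a1, a2, a3, a4, a5, a6, a7, a8, a9]; exact h.st
    · rw [e9, e10, a16, e5, e6]; exact q
    · rw [e9, e10]; exact DRl
    · rw [e9, e10, a10, a11, a12, a14, e11, e12, e4, hx.vv, hx.vad]; exact RR l
    · rw [a13, a15, e7]; exact h.rch
    · rw [e8, a14]; exact h.rcc
    · rw [e5]; exact h.el
  have push := fun k => h.ch.push hx.hi (I.hd_lt e he) k
  rw [← hyd] at push
  -- Both starts are multiples of `Q`, so a bucket that contains a key beyond the opened bucket
  -- starts beyond it.
  have bucket : ∀ {e' d : ℕ}, I.Q ∣ e' → s.v .e + I.Q ≤ d → d < e' + I.Q → s.v .e + I.Q ≤ e' := by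
    intro e' d d1 d2 d3
    obtain ⟨a, ha⟩ := h.qi.eQ
    obtain ⟨c, rfl⟩ := d1
    rw [ha] at d2 ⊢
    have : a < c := by
      by_contra hc
      have := Nat.mul_le_mul_left I.Q (not_lt.1 hc)
      omega
    have := Nat.mul_le_mul_left I.Q (show a + 1 ≤ c from this)
    rw [Nat.mul_add, Nat.mul_one] at this
    exact this
  have hQ0 := h.qi.Q_pos
  rw [hqq] at whd whu
  simp only [hy, hq, hkk, hqq, hhd, hx.vi]
  -- As `cur` lies in `[e, e + Q)` and the cost in `[wh, wh + Q)`, the new key lies in the bucket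
  -- that starts at `e + wh` or in the next one. One comparison decides, so no division is needed.
  refine ⟨by omega, fun hl2 => ⟨by omega, by omega, fun hd1 => ?_, fun hd1 => ?_⟩, fun hl2 =>
    ⟨fun hfl => ?_, fun hfl => ?_⟩⟩
  · obtain ⟨T1, T2⟩ := top hl2 _ (dvd_add h.qi.eQ whd)
      (bucket (dvd_add h.qi.eQ whd) (dge hl2) hd1) (by omega) hd1
    refine ⟨by omega, by omega, by omega, _, inv _ _ T1 (push _) ?_ ?_ ?_ ?_ ?_ ?_ ?_ ?_ ?_ ?_ ?_ ?_
      ?_, cx _ ?_ ?_ ?_ ?_ ?_ ?_ ?_ ?_ ?_, ?_, ?_⟩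
    all_goals simp [St.simps, hx.vi]
    omega
  · obtain ⟨T1, T2⟩ := top hl2 _ (dvd_add (dvd_add h.qi.eQ whd) dvd_rfl)
      (bucket (dvd_add (dvd_add h.qi.eQ whd) dvd_rfl) (dge hl2) (by omega)) (by omega) (by omega)
    refine ⟨by omega, by omega, by omega, by omega, _, inv _ _ T1 (push _) ?_ ?_ ?_ ?_ ?_ ?_ ?_ ?_
      ?_ ?_ ?_ ?_ ?_, cx _ ?_ ?_ ?_ ?_ ?_ ?_ ?_ ?_ ?_, ?_, ?_⟩
    all_goals simp [St.simps, hx.vi]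
    omega
  · have T1 := low hl2
    rw [if_pos (by omega)] at T1
    have T2 := Inst.potL_update (I := I) (k := l) (by omega) lst (y :: lst l)
    rw [List.length_cons] at T2
    refine ⟨by omega, _, inv _ _ T1 (push _) ?_ ?_ ?_ ?_ ?_ ?_ ?_ ?_
      ?_ ?_ ?_ ?_ ?_, cx _ ?_ ?_ ?_ ?_ ?_ ?_ ?_ ?_ ?_, ?_, ?_⟩
    all_goals simp [St.simps, hx.vi]
    omega
  · have T1 := low hl2
    rw [if_neg (by omega)] at T1
    refine ⟨_, inv _ _ T1 h.ch ?_ ?_ ?_ ?_ ?_ ?_ ?_ ?_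
      ?_ ?_ ?_ ?_ ?_, cx _ ?_ ?_ ?_ ?_ ?_ ?_ ?_ ?_ ?_, ?_, ?_⟩
    all_goals simp [St.simps, hx.vi]
    omega

end

section

variable {I : Inst} {E : Env} {CM : ℕ} {lst : ℕ → List ℕ} {S : Finset ℕ} {recs : ℕ → List ℕ}
  {ρ : ℕ → ℕ} {jj r x₀ : ℕ} {rest rem : List ℕ} {s : St}

theorem LInv.setV (h : LInv I E lst S recs ρ jj rem r x₀ rest s) (x : Vr) (k : ℕ)
    (hx : x ∉ ([.kk, .qq, .em, .rc, .e, .cur, .cnt] : List Vr)) :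
    LInv I E lst S recs ρ jj rem r x₀ rest (s.setV x k) := by
  simp only [List.mem_cons, List.not_mem_nil, or_false, not_or] at hx
  obtain ⟨h1, h2, h3, h4, h5, h6, h7⟩ := hx
  have e : ∀ y, y ≠ x → (s.setV x k).v y = s.v y := fun y hy => Function.update_of_ne hy _ _
  refine ⟨?_, ?_, h.di, ?_, ?_, h.rch, h.rcc, ?_⟩
  · rw [e _ (Ne.symm h1), e _ (Ne.symm h2), e _ (Ne.symm h3)]; exact h.st
  · rw [e _ (Ne.symm h5), e _ (Ne.symm h6)]; exact h.qi
  · rw [e _ (Ne.symm h4)]; exact h.ri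
  · rw [e _ (Ne.symm h7)]; exact h.ch
  · rw [e _ (Ne.symm h5)]; exact h.el

theorem Ctx.setV {i u b : ℕ} (h : Ctx I E recs i u b S s) (x : Vr) (k : ℕ)
    (hx : x ∉ ([.i, .v, .r, .ad, .cur, .j] : List Vr)) : Ctx I E recs i u b S (s.setV x k) := by
  simp only [List.mem_cons, List.not_mem_nil, or_false, not_or] at hx
  obtain ⟨h1, h2, h3, h4, h5, h6⟩ := hx
  have e : ∀ y, y ≠ x → (s.setV x k).v y = s.v y := fun y hy => Function.update_of_ne hy _ _
  refine ⟨?_, ?_, ?_, ?_, h.hi, h.hu, h.hb, ?_, h.hc, h.hS, ?_, ?_⟩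
  · rw [e _ (Ne.symm h1)]; exact h.vi
  · rw [e _ (Ne.symm h2)]; exact h.vv
  · rw [e _ (Ne.symm h3)]; exact h.vr
  · rw [e _ (Ne.symm h4)]; exact h.vad
  · rw [e _ (Ne.symm h5)]; exact h.hd
  · rw [e _ (Ne.symm h5)]; exact h.hkey
  · rw [e _ (Ne.symm h6)]; exact h.vj

theorem relax_spec {i u b e : ℕ} (hE : Fit I E CM)
    (h : LInv I E lst S recs ρ I.K [] r (I.node i u) (e :: rest) s)
    (hx : Ctx I E recs i u b S s) (he : e < I.m) (htl : I.tl e = u) (hq : s.v .q = e + 1)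
    (hcnt : s.v .cnt ≤ CM) (heE : s.v .e ≤ I.EM) :
    wp E relaxC (fun t s' => ∃ lst', LInv I E lst' S recs ρ I.K [] r (I.node i u) rest s' ∧
      Ctx I E recs i u b S s' ∧ s'.v .q = s.a .an (e + 1) ∧ s'.a .an = s.a .an ∧
      s'.v .e = s.v .e ∧
      t + s'.v .cnt + 16 * I.potL lst' + I.potV (s'.a .lev) ≤
        s.v .cnt + 16 * I.potL lst + I.potV (s.a .lev) + 49) s := by
  have hW := hE.W
  have hHB : I.HB = I.K + 2 + I.EM + 3 * I.Q + I.mx := rfl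
  have hK2 := I.K2
  have hwt := I.wt_le e he
  have hhd := h.st.hd_eq e he
  have hcx := h.st.cx_eq e he
  have hwe := h.st.wt_eq e he
  have hvi := hx.vi
  have hvr := hx.vr
  have hn := Inst.node_lt hx.hi (I.hd_lt e he)
  have hmn : I.m * I.n ≤ 32 * (I.m * I.n) := by omega
  have hnode : i * I.n + I.hd e = I.node i (I.hd e) := rfl
  obtain ⟨-, ecur, cure, -⟩ := h.qi.ph (by omega)
  have noimp : (I.cp i ≤ I.cp e → s.a .lev (I.node i (I.hd e)) ≠ 0 ∧
      s.a .key (I.node i (I.hd e)) ≤ s.v .cur + I.wt e) →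
      LInv I E lst S recs ρ I.K [] r (I.node i u) rest s := fun hc =>
    { h with di := h.di.skip hx.hi he (by rw [htl]) (by rw [hx.hkey]; exact hc) }
  simp only [relaxC, wp_seq, wp_asg, wp_ite, wp_skip, Cd.ok, Cd.ev, Ex.ok, Ex.ev, true_and,
    St.simps, reduceCtorEq, if_false, if_true, and_true, St.setV_setV, hq, hcx, hhd, hwe, hvi, hvr,
    hnode]
  rw [hE.cp]
  refine ⟨⟨by rw [hE.m]; exact he, by rw [hE.m]; exact hx.hi⟩, fun hc => ?_, fun hc =>
    ⟨by omega, by omega, by omega, fun hl => ⟨by omega, ?_⟩, fun hl => ⟨fun hd => ?_, fun hd => ?_⟩⟩⟩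
  · have := noimp fun h' => absurd h' (not_le.2 hc)
    refine ⟨lst, this.setV _ _ (by decide), hx.setV _ _ (by decide), by omega⟩
  · have l0 : s.a .lev (I.node i (I.hd e)) = 0 := by omega
    refine (improve_spec hE (e := e) (i := i) (b := b)
      (((h.setV _ _ ?_).setV _ _ ?_).setV _ _ ?_)
      (((hx.setV _ _ ?_).setV _ _ ?_).setV _ _ ?_) he htl ?_ ?_ ?_ ?_ (not_lt.1 hc)
      ?_ ?_ ?_).mono ?_
    all_goals try simp [St.simps, hq, l0, hcnt, heE]
    intro t s' lst' a1 a2 a3 a4 a5 a6 a7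
    exact ⟨lst', a1.setV _ _ (by decide), a2.setV _ _ (by decide), by rw [a3, a6], a6, a5, by omega⟩
  · have l0 : s.a .lev (I.node i (I.hd e)) ≠ 0 := by omega
    refine (improve_spec hE (e := e) (i := i) (b := b)
      (((h.setV _ _ ?_).setV _ _ ?_).setV _ _ ?_)
      (((hx.setV _ _ ?_).setV _ _ ?_).setV _ _ ?_) he htl ?_ ?_ ?_ ?_ (not_lt.1 hc)
      ?_ ?_ ?_).mono ?_
    all_goals try simp [St.simps, hq, hd, hcnt, heE]
    · omega
    intro t s' lst' a1 a2 a3 a4 a5 a6 a7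
    exact ⟨lst', a1.setV _ _ (by decide), a2.setV _ _ (by decide), by rw [a3, a6], a6, a5, by omega⟩
  · have := noimp fun h' => ⟨by omega, by omega⟩
    refine ⟨lst, (((this.setV _ _ ?_).setV _ _ ?_).setV _ _ ?_).setV _ _ ?_,
      (((hx.setV _ _ ?_).setV _ _ ?_).setV _ _ ?_).setV _ _ ?_, by omega⟩
    all_goals decide

theorem relaxAll_spec {i u b : ℕ} (hE : Fit I E CM)
    (h : LInv I E lst S recs ρ I.K [] r (I.node i u) rest s)
    (hx : Ctx I E recs i u b S s) (hr : ∀ e ∈ rest, e < I.m ∧ I.tl e = u)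
    (hq : Adj (s.a .an) (s.v .q) rest) (heE : s.v .e ≤ I.EM)
    (hcnt : s.v .cnt + 16 * I.potL lst + I.potV (s.a .lev) + 50 * rest.length ≤ CM) :
    wp E (.loop (.lt (.c 0) (.v .q)) relaxC) (fun t s' => ∃ lst',
      LInv I E lst' S recs ρ I.K [] r (I.node i u) [] s' ∧ Ctx I E recs i u b S s' ∧
      s'.v .e = s.v .e ∧ t + s'.v .cnt + 16 * I.potL lst' + I.potV (s'.a .lev) ≤
        s.v .cnt + 16 * I.potL lst + I.potV (s.a .lev) + 50 * rest.length + 1) s := by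
  refine wp_loop (J := fun p s' => ∃ lst' rest',
      LInv I E lst' S recs ρ I.K [] r (I.node i u) rest' s' ∧ Ctx I E recs i u b S s' ∧
      (∀ e ∈ rest', e < I.m ∧ I.tl e = u) ∧ Adj (s'.a .an) (s'.v .q) rest' ∧
      s'.v .e = s.v .e ∧ p ≤ CM ∧
      p = s'.v .cnt + 16 * I.potL lst' + I.potV (s'.a .lev) + 50 * rest'.length)
    ?_ ?_ ⟨lst, rest, h, hx, hr, hq, rfl, hcnt, rfl⟩ ?_
  · intro p s' _
    simp [Cd.ok, Ex.ok]
  · rintro p s' ⟨lst', rest', a1, a2, a3, a4, a5, a6, rfl⟩ hc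
    simp only [Cd.ev, Ex.ev] at hc
    generalize hg : s'.v .q = g at a4 hc
    cases a4 with
    | nil => omega
    | @cons e l a4 =>
      obtain ⟨he, htl⟩ := a3 e List.mem_cons_self
      rw [List.length_cons] at a6
      refine (relax_spec hE a1 a2 he htl hg (by omega) (by omega)).mono ?_
      rintro t s'' ⟨lst'', b1, b2, b3, b4, b5, b6⟩
      refine ⟨_, ⟨lst'', l, b1, b2, fun e he => a3 e (List.mem_cons_of_mem _ he), ?_,
        by rw [b5, a5], ?_, rfl⟩, ?_⟩
      · rw [b3, b4]; exact a4
      · omega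
      · rw [List.length_cons]; omega
  · rintro t p s' ⟨lst', rest', a1, a2, a3, a4, a5, a6, rfl⟩ hc ht
    simp only [Cd.ev, Ex.ev] at hc
    generalize hg : s'.v .q = g at a4 hc
    cases a4 with
    | nil => exact ⟨lst', a1, a2, a5, by simpa using by omega⟩
    | cons => omega

end

/-- Only the variables in `vs` and the arrays in `as` have changed. -/
structure Keep (vs : List Vr) (as : List Ar) (s s' : St) : Prop where
  v : ∀ y ∉ vs, s'.v y = s.v y
  a : ∀ k ∉ as, s'.a k = s.a k

/-- The invariant of the records, together with their representation. -/
structure Rec (I : Inst) (E : Env) (S : Finset ℕ) (recs : ℕ → List ℕ) (ρ : ℕ → ℕ) (s : St) :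
    Prop where
  ri : RI I E.B (s.a .key) (s.a .lev) S (s.a .rd) (s.a .rp) (s.a .rr) (s.a .rf) (s.a .pv)
    (s.a .pr) recs (s.v .rc) ρ
  rch : ∀ v < I.n, RCh E.B (s.a .rn) (recs v) ∧ s.a .hr v = (recs v).headD 0 ∧
    s.o v = adrOf E.B ((recs v).headD 0)
  rcc : ∀ v < I.n, ∀ a ∈ recs v, s.rc a = I.cp (s.a .rf a)

/-- The node `(i, v)` has been settled and its record has been made. -/
def Recorded (I : Inst) (E : Env) (S : Finset ℕ) (i v : ℕ) (s s' : St) : Prop :=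
  ∃ recs' ρ', Rec I E (insert (I.node i v) S) recs' ρ' s' ∧
    (∃ b ∈ recs' v, s'.a .hr v = b ∧ s'.a .rd b = s.v .cur ∧ I.cp i ≤ I.cp (s'.a .rf b)) ∧
    Keep [.a, .rc] [.rd, .rp, .rr, .rf, .rn, .hr] s s'

/-! ### Recording a settled node -/

section

variable {I : Inst} {E : Env} {CM : ℕ} {S : Finset ℕ} {recs : ℕ → List ℕ} {ρ : ℕ → ℕ} {s : St}
  {i v : ℕ}

theorem new_spec (hE : Fit I E CM) (h : Rec I E S recs ρ s)
    (hi : i < I.m) (hv : v < I.n) (vi : s.v .i = i) (vv : s.v .v = v)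
    (vx : s.v .x = I.node i v) (hS : I.node i v ∉ S) (hl : s.a .lev (I.node i v) ≠ 0)
    (hk : s.a .key (I.node i v) = s.v .cur) (hrc : s.v .rc ≤ I.m * I.n)
    (va : s.v .a = (recs v).headD 0)
    (ha : ∀ a ∈ (recs v).head?, s.a .rd a < s.v .cur ∧ I.cp (s.a .rf a) < I.cp i) :
    wp E newC (fun t s' => Recorded I E S i v s s' ∧ t ≤ 10) s := by
  have hW := hE.W
  have hal : ∀ v' < I.n, ∀ b ∈ recs v', b ≠ s.v .rc + 1 := fun v' hv' b hb => by
    have := (h.ri.own v' hv' b hb).2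
    omega
  have hhd : (recs v).headD 0 ≤ s.v .rc := by
    cases hr : recs v with
    | nil => simp
    | cons b l => exact (h.ri.own v hv b (by simp [hr])).2
  obtain ⟨ρ', hR⟩ := h.ri.new hi hv hS hl (by rw [hk]; exact ha)
  rw [hk] at hR
  have key : ∀ (s' : St), s'.a .key = s.a .key → s'.a .lev = s.a .lev →
      s'.a .rd = Function.update (s.a .rd) (s.v .rc + 1) (s.v .cur) →
      s'.a .rp = Function.update (s.a .rp) (s.v .rc + 1) (s.a .pv (I.node i v)) →
      s'.a .rr = Function.update (s.a .rr) (s.v .rc + 1) (s.a .pr (I.node i v)) →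
      s'.a .rf = Function.update (s.a .rf) (s.v .rc + 1) i →
      s'.a .rn = Function.update (s.a .rn) (s.v .rc + 1) (adrOf E.B ((recs v).headD 0)) →
      s'.a .hr = Function.update (s.a .hr) v (s.v .rc + 1) →
      s'.a .pv = s.a .pv → s'.a .pr = s.a .pr → s'.v .rc = s.v .rc + 1 →
      s'.o = Function.update s.o v (E.B + 32 * (s.v .rc + 1)) →
      s'.rc = Function.update s.rc (s.v .rc + 1) (I.cp i) →
      Keep [.a, .rc] [.rd, .rp, .rr, .rf, .rn, .hr] s s' → Recorded I E S i v s s' := by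
    intro s' e1 e2 e3 e4 e5 e6 e7 e8 e9 e10 e11 e12 e13 k
    refine ⟨Function.update recs v ((s.v .rc + 1) :: recs v), ρ', ⟨?_, ?_, ?_⟩,
      ⟨s.v .rc + 1, by simp, by rw [e8, Function.update_self], by rw [e3, Function.update_self],
        by rw [e6, Function.update_self]⟩, k⟩
    · rw [e1, e2, e3, e4, e5, e6, e9, e10, e11]; exact hR
    · rw [e7, e8, e12]
      intro v' hv'
      obtain ⟨h1, h2, h3⟩ := h.rch v' hv'
      have hn : s.v .rc + 1 ∉ recs v' := fun hm => hal v' hv' _ hm rfl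
      rcases eq_or_ne v' v with rfl | hvv
      · simp only [Function.update_self]
        exact ⟨⟨Function.update_self _ _ _, h1.update hn⟩, rfl, by simp [adrOf]⟩
      · simp only [Function.update_of_ne hvv]
        exact ⟨h1.update hn, h2, h3⟩
    · rw [e6, e13]
      intro v' hv' a ha
      by_cases har : a = s.v .rc + 1
      · rw [har, Function.update_self, Function.update_self]
      · rw [Function.update_of_ne har, Function.update_of_ne har]
        rcases eq_or_ne v' v with rfl | hvv
        · rw [Function.update_self] at ha
          exact h.rcc v' hv' a ((List.mem_cons.1 ha).resolve_left har)
        · rw [Function.update_of_ne hvv] at ha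
          exact h.rcc v' hv' a ha
  simp only [newC, wp_seq, wp_put, wp_asg, wp_ite, wp_out, wp_cap, Cd.ok,
    Cd.ev, Ex.ok, Ex.ev, true_and, St.simps, reduceCtorEq, if_false, if_true, and_true,
    vi, vv, vx, va, hE.cp, hE.m, hE.n]
  refine ⟨by omega, by omega, fun hp => ⟨by omega, by omega, hv, hi, ?_, by omega⟩,
    fun hp => ⟨by omega, by omega, hv, hi, ?_, by omega⟩⟩
  · refine key _ ?_ ?_ ?_ ?_ ?_ ?_ ?_ ?_ ?_ ?_ ?_ ?_ ?_ ⟨?_, ?_⟩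
    all_goals simp +contextual [St.simps]
    rw [adrOf, if_neg]
    simpa using hp.ne'
  · refine key _ ?_ ?_ ?_ ?_ ?_ ?_ ?_ ?_ ?_ ?_ ?_ ?_ ?_ ⟨?_, ?_⟩
    all_goals simp +contextual [St.simps]
    rw [adrOf, if_pos]
    simpa using hp

theorem Rec.asgA (h : Rec I E S recs ρ s) (k : ℕ) : Rec I E S recs ρ (s.setV .a k) :=
  ⟨h.ri, h.rch, h.rcc⟩

theorem Recorded.ofA {k : ℕ} {s' : St} (h : Recorded I E S i v (s.setV .a k) s') :
    Recorded I E S i v s s' := by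
  obtain ⟨recs', ρ', h1, h2, h3, h4⟩ := h
  refine ⟨recs', ρ', h1, h2, fun y hy => ?_, h4⟩
  rw [h3 y hy]
  exact Function.update_of_ne (fun e => hy (by simp [e])) _ _

/-- By `hlow`, a record with at least the flow of `i` has distance at least `cur`, and by `hle` at
most `cur`. So against the head there are three cases: greater flow and distance give a new record,
greater flow at equal distance overwrites the head, and otherwise the distances agree and the head
already serves. In every case the head then has distance `cur` and accommodates the flow, so it can
act as predecessor for the relaxations that follow. -/
theorem record_spec (hE : Fit I E CM) (h : Rec I E S recs ρ s)
    (hi : i < I.m) (hv : v < I.n) (vi : s.v .i = i) (vv : s.v .v = v)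
    (vx : s.v .x = I.node i v) (hS : I.node i v ∉ S) (hl : s.a .lev (I.node i v) ≠ 0)
    (hk : s.a .key (I.node i v) = s.v .cur) (hle : ∀ x ∈ S, s.a .key x ≤ s.v .cur)
    (hlow : ∀ a ∈ recs v, I.cp i ≤ I.cp (s.a .rf a) → s.v .cur ≤ s.a .rd a)
    (hrc : s.v .rc ≤ I.m * I.n) :
    wp E recordC (fun t s' => Recorded I E S i v s s' ∧ t ≤ 14) s := by
  have hW := hE.W
  obtain ⟨c1, c2, c3⟩ := h.rch v hv
  have head : ∀ a ∈ recs v, s.a .rd a ≤ s.v .cur := by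
    intro a ha
    obtain ⟨g1, g2, g3⟩ := h.ri.good v hv a ha
    rw [← g3]; exact hle _ g2
  simp only [recordC, wp_seq, wp_asg, Ex.ok, Ex.ev, true_and, vv, c2]
  have new : (∀ a ∈ (recs v).head?, s.a .rd a < s.v .cur ∧ I.cp (s.a .rf a) < I.cp i) →
      wp E newC (fun t s' => Recorded I E S i v s s' ∧ t ≤ 10) (s.setV .a ((recs v).headD 0)) :=
    fun ha => (new_spec hE (h.asgA _) hi hv vi vv vx hS hl hk hrc rfl ha).mono
      fun t s' h' => ⟨h'.1.ofA, h'.2⟩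
  rw [wp_ite]
  refine ⟨⟨by simp [Ex.ok], by simp [Ex.ok]⟩, fun hp => ?_, fun hp => ?_⟩
  swap
  · refine (new ?_).mono fun t s' h' => ⟨h'.1, by omega⟩
    intro a ha
    have := (h.ri.own v hv a (List.mem_of_mem_head? ha)).1
    simp [Cd.ev, Ex.ev, St.simps, List.headD_eq_head?_getD, Option.mem_def.1 ha] at hp
    omega
  obtain ⟨a, l, hr⟩ : ∃ a l, recs v = a :: l := by
    cases hr : recs v with
    | nil => simp [Cd.ev, Ex.ev, St.simps, hr] at hp
    | cons a l => exact ⟨a, l, rfl⟩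
  have ham : a ∈ recs v := by simp [hr]
  obtain ⟨g1, g2, g3⟩ := h.ri.good v hv a ham
  have hoa := h.ri.own v hv a ham
  simp only [hr, List.headD_cons, List.head?_cons, Option.mem_some_iff, forall_eq'] at new c2 c3 ⊢
  have had := head a ham
  rw [wp_ite]
  refine ⟨?_, fun hc => ?_, fun hc => ?_⟩
  · simp [Cd.ok, Ex.ok, Ex.ev, St.simps, hE.m, vi, hi, g1]
  · rw [wp_ite]
    simp only [Cd.ev, Ex.ev, St.simps, reduceCtorEq, if_false, if_true, hE.cp, vi] at hc
    refine ⟨by simp [Cd.ok, Ex.ok], fun hd => ?_, fun hd => ?_⟩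
    · simp only [Cd.ev, Ex.ev, St.simps, reduceCtorEq, if_false, if_true] at hd
      exact (new ⟨hd, hc⟩).mono fun t s' h' => ⟨h'.1, by omega⟩
    · simp only [Cd.ev, Ex.ev, St.simps, reduceCtorEq, if_false, if_true] at hd
      obtain ⟨ρ', hR⟩ := h.ri.overwrite hi hv hS hl hr (by omega) hc
      simp only [overC, wp_seq, wp_put, wp_cap, Ex.ok, Ex.ev, true_and, St.simps, reduceCtorEq,
        if_false, if_true, vi, vx, hE.cp, hE.m]
      refine ⟨hi, ⟨recs, ρ', ⟨?_, h.rch, ?_⟩, ⟨a, ham, ?_, ?_, ?_⟩, ⟨?_, ?_⟩⟩, by omega⟩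
      · simp only [St.simps, reduceCtorEq, if_false, if_true]; exact hR
      · intro v' hv' b hb
        simp only [St.simps, reduceCtorEq, if_false, if_true]
        rcases eq_or_ne b a with rfl | hba
        · rw [Function.update_self, Function.update_self]
        · rw [Function.update_of_ne hba, Function.update_of_ne hba]
          exact h.rcc v' hv' b hb
      · simpa [St.simps] using c2
      · simp [St.simps]; omega
      · simp [St.simps]
      · simp +contextual [St.simps]
      · simp +contextual [St.simps]
  · simp only [Cd.ev, Ex.ev, St.simps, reduceCtorEq, if_false, if_true, hE.cp, vi] at hc
    have hda := hlow a ham (not_lt.1 hc)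
    have hR := h.ri.skip hv hS ham (by omega) (not_lt.1 hc)
    rw [wp_skip]
    refine ⟨⟨recs, ρ, ⟨hR, h.rch, h.rcc⟩, ⟨a, ham, c2, ?_, not_lt.1 hc⟩, ⟨?_, ?_⟩⟩, by omega⟩
    · simp [St.simps]; omega
    · simp +contextual [St.simps]
    · simp [St.simps]

end

/-! ### Settling a node -/

section

variable {I : Inst} {E : Env} {CM : ℕ} {lst : ℕ → List ℕ} {S : Finset ℕ} {recs : ℕ → List ℕ}
  {ρ : ℕ → ℕ} {jj r x₀ : ℕ} {rest rem : List ℕ} {s : St}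

theorem LInv.rc_le (h : LInv I E lst S recs ρ jj rem r x₀ rest s) : s.v .rc ≤ I.m * I.n :=
  h.ri.rcS.trans <| (Finset.card_le_card (h.S_subset.trans Inst.X_subset)).trans
    (Finset.card_range _).le

/-- The potential of a state of the main loop. -/
def Inst.potSt (I : Inst) (lst : ℕ → List ℕ) (S : Finset ℕ) (s : St) : ℕ :=
  -- With the number of used cells included, a bound on this potential bounds the cell addresses as
  -- well.
  s.v .cnt + I.pot lst (s.a .lev) S (s.v .j) (s.v .e)

/-- The node leaves its list and the unsettled set. The released `16 + 50 * (dg + 1)` units pay for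
recording the node and for relaxing all its outgoing edges. -/
theorem settle_spec (hE : Fit I E CM) (h : LInv I E lst S recs ρ I.K [] r x₀ [] s)
    {x : ℕ} {t : List ℕ} (hl : lst I.K = x :: t) (hj : s.v .j = I.K) (he : s.v .e ≤ I.EM)
    (hp : I.potSt lst S s ≤ CM) :
    wp E settleC (fun t' s' => ∃ lst' S' recs' ρ' x₀', LInv I E lst' S' recs' ρ' I.K [] r x₀' [] s' ∧
      s'.v .j = I.K ∧ s'.v .e = s.v .e ∧ t' + 3 + I.potSt lst' S' s' ≤ I.potSt lst S s) s := by
  have hW := hE.W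
  have hHB : I.HB = I.K + 2 + I.EM + 3 * I.Q + I.mx := rfl
  have hK2 := I.K2
  have hkk := h.st.kk_eq
  obtain ⟨hch, hle⟩ := h.ch I.K
  rw [hl] at hch
  generalize hc : s.a .hh I.K = c at hch hle
  cases hch with
  | @cons c l c1 hi hv c4 c5 =>
  set i := s.a .ci c with hidef
  set v := s.a .cv c with hvdef
  obtain ⟨q1, q2, q3, q4⟩ := h.qi.pop hl
  have hrow := h.st.row_eq i hi
  have hX : I.node i v ∈ I.X := h.mem_X (by omega)
  have hnode : i * I.n + v = I.node i v := rfl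
  have hn := Inst.node_lt hi hv
  simp only [settleC, wp_seq, wp_put, wp_asg, Ex.ok, Ex.ev, true_and,
    St.simps, reduceCtorEq, if_false, if_true, hkk, hc, ← hidef, ← hvdef, hrow, hnode]
  refine ⟨by omega, (record_spec (S := S) (recs := recs) (ρ := ρ) (i := i) (v := v) hE
    ⟨?_, ?_, ?_⟩ hi hv ?_ ?_ ?_ q2 ?_ ?_ ?_ ?_ ?_).mono ?_⟩
  all_goals try simp only [St.simps, reduceCtorEq, if_false, if_true]
  · exact h.ri
  · exact h.rch
  · exact h.rcc
  · omega
  · exact q4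
  · exact fun y hy => (h.qi.Sk y hy).2
  -- A walk for a greater flow is also a walk for the flow of `i`. As the node of `i` is not settled
  -- yet, `DI.lower` makes the distance of such a record at least `cur`.
  · intro a ha hca
    obtain ⟨g1, g2, g3⟩ := h.ri.good v hv a ha
    have := (h.di.snd_node hv (by rw [(h.qi.Sk _ g2).1]; omega)).2
    rw [g3] at this
    rcases h.di.lower h.qi.Uc hi (this.mono hca) with h' | h'
    · exact absurd h'.1 q2
    · exact h'
  · exact h.rc_le
  rintro t' s' ⟨⟨recs', ρ', R, ⟨b, hb, hhr, hrd, hcb⟩, kv, ka⟩, ht'⟩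
  simp only [St.simps, reduceCtorEq, if_false] at kv ka hrd
  simp only [List.mem_cons, List.not_mem_nil, or_false, not_or] at kv ka
  have av := fun y h1 h2 => kv y ⟨h1, h2⟩
  have aa := fun y h1 h2 h3 h4 h5 h6 => ka y ⟨h1, h2, h3, h4, h5, h6⟩
  have v1 := av .v (by decide) (by decide)
  have v2 := av .i (by decide) (by decide)
  have v3 := av .r (by decide) (by decide)
  have v4 := av .cur (by decide) (by decide)
  have v5 := av .j (by decide) (by decide)
  have v6 := av .kk (by decide) (by decide)
  have v7 := av .qq (by decide) (by decide)
  have v8 := av .em (by decide) (by decide)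
  have v9 := av .e (by decide) (by decide)
  have v10 := av .cnt (by decide) (by decide)
  simp only [reduceCtorEq, if_false, if_true] at v1 v2 v3 v4 v5 v6 v7 v8 v9 v10
  have a1 := aa .key (by decide) (by decide) (by decide) (by decide) (by decide) (by decide)
  have a2 := aa .lev (by decide) (by decide) (by decide) (by decide) (by decide) (by decide)
  have a3 := aa .ub (by decide) (by decide) (by decide) (by decide) (by decide) (by decide)
  have a4 := aa .nx (by decide) (by decide) (by decide) (by decide) (by decide) (by decide)
  have a5 := aa .ci (by decide) (by decide) (by decide) (by decide) (by decide) (by decide)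
  have a6 := aa .cv (by decide) (by decide) (by decide) (by decide) (by decide) (by decide)
  have a7 := aa .hh (by decide) (by decide) (by decide) (by decide) (by decide) (by decide)
  have b1 := aa .row (by decide) (by decide) (by decide) (by decide) (by decide) (by decide)
  have b2 := aa .pw (by decide) (by decide) (by decide) (by decide) (by decide) (by decide)
  have b3 := aa .dec (by decide) (by decide) (by decide) (by decide) (by decide) (by decide)
  have b4 := aa .ah (by decide) (by decide) (by decide) (by decide) (by decide) (by decide)
  have b5 := aa .an (by decide) (by decide) (by decide) (by decide) (by decide) (by decide)
  have b6 := aa .hd (by decide) (by decide) (by decide) (by decide) (by decide) (by decide)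
  have b7 := aa .wt (by decide) (by decide) (by decide) (by decide) (by decide) (by decide)
  have b8 := aa .wh (by decide) (by decide) (by decide) (by decide) (by decide) (by decide)
  have b9 := aa .cx (by decide) (by decide) (by decide) (by decide) (by decide) (by decide)
  simp only [reduceCtorEq, if_false, if_true] at a1 a2 a3 a4 a5 a6 a7 b1 b2 b3 b4 b5 b6 b7 b8 b9
  clear kv ka av aa
  have hb1 : b ≤ I.m * I.n + 1 := by
    have h1 := (R.ri.own v hv b hb).2
    have h2 := R.ri.rcS
    have h3 : insert (I.node i v) S ⊆ Finset.range (I.m * I.n) :=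
      (Finset.insert_subset hX h.S_subset).trans Inst.X_subset
    have h4 := Finset.card_le_card h3
    rw [Finset.card_range] at h4
    omega
  have hb0 := (R.ri.own v hv b hb).1
  simp only [v1, hhr]
  refine ⟨by omega, ?_⟩
  have hrest : ∀ e ∈ I.outE I.m v, e < I.m ∧ I.tl e = v := fun e he => I.mem_outE.1 he
  have L : LInv I E (Function.update lst I.K t) (insert (I.node i v) S) recs' ρ' I.K [] r
      (I.node i v) (I.outE I.m v) s' := by
    refine ⟨?_, ?_, ?_, R.ri, ?_, R.rch, R.rcc, ?_⟩
    · rw [v6, v7, v8, b1, b2, b3, b4, b5, b6, b7, b8, b9]; exact h.st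
    · rw [a1, a2, a3, v9, v4]; exact q1
    · rw [a1, a2]
      exact h.di.insert _ fun i' _ e he hx =>
        I.mem_outE.2 ⟨he, (I.node_inj (I.tl_lt e he) hv hx).2⟩
    · rw [a4, a5, a6, a7, v10]; exact h.ch.set c5 (by omega)
    · rw [v9]; exact h.el
  have C : Ctx I E recs' i v b (insert (I.node i v) S) (s'.setV .ad (E.B + 32 * b)) := by
    refine ⟨?_, ?_, ?_, ?_, hi, hv, hb, ?_, hcb, Finset.mem_insert_self _ _, ?_, ?_⟩
    all_goals simp only [St.simps, reduceCtorEq, if_false, if_true]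
    · exact v2
    · exact v1
    · exact v3
    · rw [v4]; exact hrd
    · rw [v4, a1]; exact q4
    · rw [v5]; exact hj
  have PL := Inst.potL_update (I := I) (k := I.K) (by omega) lst t
  rw [hl, List.length_cons] at PL
  have PS := Inst.potS_insert hX q2
  rw [Inst.dg_node hv] at PS
  have hpd : I.potSt lst S s = s.v .cnt + (16 * I.potL lst + I.potV (s.a .lev) + 50 * I.potS S +
    4 * s.v .j + 10 * I.potE (s.v .e)) := rfl
  refine (relaxAll_spec hE ((L.setV .ad _ ?_).setV .q _ ?_) (C.setV .q _ ?_) hrest ?_ ?_ ?_).mono ?_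
  · decide
  · decide
  · decide
  · simp only [St.simps, reduceCtorEq, if_false, if_true, b4, b5]
    exact h.st.adj v hv
  · simp only [St.simps, reduceCtorEq, if_false]
    omega
  · simp only [St.simps, reduceCtorEq, if_false, a2]
    omega
  · simp only [St.simps, reduceCtorEq, if_false, a2]
    rintro t'' s'' ⟨lst', L', C', he', ht''⟩
    have hj' := C'.vj
    refine ⟨lst', _, recs', ρ', _, L', hj', by rw [he', v9], ?_⟩
    have : I.potSt lst' (insert (I.node i v) S) s'' = s''.v .cnt + (16 * I.potL lst' +
      I.potV (s''.a .lev) + 50 * I.potS (insert (I.node i v) S) +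
      4 * s''.v .j + 10 * I.potE (s''.v .e)) := rfl
    rw [he', v9, hj', ← hj] at this
    omega

end

/-- Only the variables in `vs` have changed. -/
structure KeepV (vs : List Vr) (s s' : St) : Prop where
  v : ∀ y ∉ vs, s'.v y = s.v y
  a : s'.a = s.a
  o : s'.o = s.o
  rc : s'.rc = s.rc

theorem KeepV.refl (vs : List Vr) (s : St) : KeepV vs s s := ⟨fun _ _ => rfl, rfl, rfl, rfl⟩

theorem KeepV.setV {vs : List Vr} {s s' : St} (h : KeepV vs s s') {x : Vr} (hx : x ∈ vs) (k : ℕ) :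
    KeepV vs s (s'.setV x k) :=
  ⟨fun y hy => (Function.update_of_ne (fun e => hy (by rw [e]; exact hx)) _ _).trans (h.v y hy),
    h.a, h.o, h.rc⟩

/-! ### Redistributing a level -/

section

variable {I : Inst} {E : Env} {CM : ℕ} {lst : ℕ → List ℕ} {S : Finset ℕ} {recs : ℕ → List ℕ}
  {ρ : ℕ → ℕ} {jj r x₀ : ℕ} {rest rem : List ℕ} {s : St}

theorem min_spec {j : ℕ} {l : List ℕ} (hW : I.m * I.n + j + 2 ≤ E.W)
    (hrow : ∀ i < I.m, s.a .row i = i * I.n) (hj : s.v .j = j)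
    (hc : Ch I (s.a .nx) (s.a .ci) (s.a .cv) (s.v .c) l) :
    wp E minC (fun t s' => KeepV [.c, .x, .g] s s' ∧ s'.v .g ≤ s.v .g ∧
      (∀ y ∈ l, s.a .lev y ≤ j → s'.v .g ≤ s.a .key y) ∧
      (s'.v .g = s.v .g ∨ ∃ y ∈ l, s.a .lev y ≤ j ∧ s.a .key y = s'.v .g) ∧
      t ≤ 6 * l.length + 1) s := by
  refine wp_loop (J := fun p s' => ∃ l', KeepV [.c, .x, .g] s s' ∧ s'.v .g ≤ s.v .g ∧
      Ch I (s.a .nx) (s.a .ci) (s.a .cv) (s'.v .c) l' ∧ (∀ y ∈ l', y ∈ l) ∧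
      (∀ y ∈ l, s.a .lev y ≤ j → s'.v .g ≤ s.a .key y ∨ y ∈ l') ∧
      (s'.v .g = s.v .g ∨ ∃ y ∈ l, s.a .lev y ≤ j ∧ s.a .key y = s'.v .g) ∧ p = 6 * l'.length)
    ?_ ?_ ⟨l, .refl _ _, le_rfl, hc, fun _ h => h, fun _ h _ => Or.inr h, Or.inl rfl, rfl⟩ ?_
  · intro p s' _
    simp [Cd.ok, Ex.ok]
  · rintro p s' ⟨l', k, hg, hc', hsub, hmin, hat, rfl⟩ hpos
    simp only [Cd.ev, Ex.ev] at hpos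
    generalize hcc : s'.v .c = c at hc' hpos
    cases hc' with
    | nil => omega
    | @cons c l' c1 hi hv c4 c5 =>
    have hn := Inst.node_lt hi hv
    have vj : s'.v .j = j := (k.v .j (by decide)).trans hj
    have hnode : s.a .ci c * I.n + s.a .cv c = I.node (s.a .ci c) (s.a .cv c) := rfl
    simp only [cellE, wp_seq, wp_asg, wp_ite, wp_skip, Cd.ok, Cd.ev, Ex.ok, Ex.ev, true_and,
      St.simps, reduceCtorEq, if_false, if_true, k.a, hcc, hrow _ hi, vj, hnode]
    set x := I.node (s.a .ci c) (s.a .cv c)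
    have hx : x ∈ l := hsub x List.mem_cons_self
    have hsub' : ∀ y ∈ l', y ∈ l := fun y hy => hsub y (List.mem_cons_of_mem _ hy)
    refine ⟨by omega, ⟨by omega, by omega⟩, fun hlev => ⟨fun hk => ?_, fun hk => ?_⟩,
      fun hlev => ?_⟩
    · refine ⟨_, ⟨l', ((k.setV ?_ _).setV ?_ _).setV ?_ _, ?_, c5, hsub', ?_, Or.inr ?_, rfl⟩, ?_⟩
      · simp
      · simp
      · simp
      · omega
      · intro y hy hyl
        rcases hmin y hy hyl with h' | h'
        · left; omega
        · rcases List.mem_cons.1 h' with rfl | h'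
          · exact Or.inl le_rfl
          · exact Or.inr h'
      · exact ⟨x, hx, by omega, rfl⟩
      · rw [List.length_cons]; omega
    · refine ⟨_, ⟨l', (k.setV ?_ _).setV ?_ _, hg, c5, hsub', ?_, hat, rfl⟩, ?_⟩
      · simp
      · simp
      · intro y hy hyl
        rcases hmin y hy hyl with h' | h'
        · exact Or.inl h'
        · rcases List.mem_cons.1 h' with rfl | h'
          · exact Or.inl (not_lt.1 hk)
          · exact Or.inr h'
      · rw [List.length_cons]; omega
    · refine ⟨_, ⟨l', (k.setV ?_ _).setV ?_ _, hg, c5, hsub', ?_, hat, rfl⟩, ?_⟩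
      · simp
      · simp
      · intro y hy hyl
        rcases hmin y hy hyl with h' | h'
        · exact Or.inl h'
        · rcases List.mem_cons.1 h' with rfl | h'
          · omega
          · exact Or.inr h'
      · rw [List.length_cons]; omega
  · rintro t p s' ⟨l', k, hg, hc', hsub, hmin, hat, rfl⟩ hpos ht
    simp only [Cd.ev, Ex.ev] at hpos
    generalize s'.v .c = c at hc' hpos
    cases hc' with
    | cons => omega
    | nil =>
      exact ⟨k, hg, fun y hy hyl => (hmin y hy hyl).resolve_right (by simp), hat, by omega⟩

theorem bounds_spec {j K Q : ℕ} (hjK : j < K) (hW : s.v .cur + Q + K + 3 ≤ E.W)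
    (hpw : ∀ i, 2 ≤ i → i ≤ K → s.a .pw i = 2 ^ (K - i) ∧ 2 ^ (K - i) ≤ Q)
    (hj : s.v .j = j) (hkk : s.v .kk = K) :
    wp E boundsC (fun t s' => (∀ y, y ≠ .l → s'.v y = s.v y) ∧ (∀ k, k ≠ .ub → s'.a k = s.a k) ∧
      s'.o = s.o ∧ s'.rc = s.rc ∧ s'.a .ub (j + 1) = s.a .ub j ∧
      (∀ i, j + 2 ≤ i → i ≤ K → s'.a .ub i = s.v .cur + 2 ^ (K - i)) ∧
      (∀ i, i ≤ j ∨ K < i → s'.a .ub i = s.a .ub i) ∧ t ≤ 3 * K + 3) s := by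
  simp only [boundsC, wp_seq, wp_put, wp_asg, Ex.ok, Ex.ev, true_and,
      St.simps, hj]
  refine ⟨by omega, by omega, wp_loop (J := fun p s' => ∃ l, s'.v .l = l ∧ j + 2 ≤ l ∧ l ≤ K + 1 ∧
      (∀ y, y ≠ .l → s'.v y = s.v y) ∧ (∀ k, k ≠ .ub → s'.a k = s.a k) ∧
      s'.o = s.o ∧ s'.rc = s.rc ∧ s'.a .ub (j + 1) = s.a .ub j ∧
      (∀ i, j + 2 ≤ i → i < l → s'.a .ub i = s.v .cur + 2 ^ (K - i)) ∧
      (∀ i, i ≤ j ∨ l ≤ i → s'.a .ub i = s.a .ub i) ∧ p = 3 * (K + 1 - l)) ?_ ?_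
      (p := 3 * (K + 1 - (j + 2))) ⟨j + 2, ?_, le_rfl, by omega, ?_, ?_, rfl, rfl, ?_, ?_, ?_, rfl⟩ ?_⟩
  · rintro p s' ⟨l, hl, -, hlK, hv, -⟩
    simp [Cd.ok, Ex.ok, Ex.ev, hv .kk (by decide), hkk]
    omega
  · rintro p s' ⟨l, hl, hjl, hlK, hv, ha, ho, hrc, h1, h2, h3, rfl⟩ hc
    simp only [Cd.ev, Ex.ev, hl, hv .kk (by decide), hkk] at hc
    obtain ⟨p1, p2⟩ := hpw l (by omega) (by omega)
    simp only [wp_seq, wp_put, wp_asg, Ex.ok, Ex.ev, true_and, St.simps, if_true, hl, hv .cur (by decide), ha .pw (by decide), p1]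
    refine ⟨by omega, ⟨by omega, by omega⟩, _, ⟨l + 1, rfl, by omega, by omega, ?_, ?_, ho, hrc,
      ?_, ?_, ?_, rfl⟩, by omega⟩
    · intro y hy; rw [if_neg hy]; exact hv y hy
    · intro y hy; rw [if_neg hy]; exact ha y hy
    · rw [Function.update_of_ne (by omega)]; exact h1
    · intro i hi hil
      rcases (show i < l ∨ i = l by omega) with h' | rfl
      · rw [Function.update_of_ne (by omega)]; exact h2 i hi h'
      · rw [Function.update_self]
    · intro i hi
      rw [Function.update_of_ne (by omega)]; exact h3 i (by omega)
  · simp [St.simps]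
  · intro y hy; simp [St.simps, hy]
  · intro y hy; simp [St.simps, hy]
  · simp [St.simps]
  · intro i hi hi'; omega
  · intro i hi
    simp only [St.simps, if_true]
    rw [Function.update_of_ne (by omega)]
  · rintro t p s' ⟨l, hl, hjl, hlK, hv, ha, ho, hrc, h1, h2, h3, rfl⟩ hc ht
    simp only [Cd.ev, Ex.ev, hl, hv .kk (by decide), hkk] at hc
    exact ⟨hv, ha, ho, hrc, h1, fun i hi hi' => h2 i hi (by omega), fun i hi => h3 i (by omega),
      by omega⟩

/-- Besides the payment for each entry, the extra units of the minimal item `y₀` are gained. The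
invariant of the loop sets them aside once `y₀` has arrived at the last level, since duplicates of
it may follow. -/
theorem spread_spec {j y₀ : ℕ} (hE : Fit I E CM)
    (h : LInv I E lst S recs ρ I.K rem j x₀ [] s) (hjK : j < I.K) (hj0 : 1 ≤ j) (hj : s.v .j = j)
    (hc : Ch I (s.a .nx) (s.a .ci) (s.a .cv) (s.v .c) rem) (hcl : s.v .c ≤ s.v .cnt)
    (hy : y₀ ∈ rem) (hyl : s.a .lev y₀ = j) (hyk : s.a .key y₀ = s.v .cur)
    (hub : ∀ i, j + 2 ≤ i → i ≤ I.K → s.v .cur < s.a .ub i)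
    (hCM : s.v .cnt + 16 * I.potL lst + I.potV (s.a .lev) + 10 * rem.length ≤ CM) :
    wp E spreadC (fun t s' => ∃ lst', LInv I E lst' S recs ρ I.K [] j x₀ [] s' ∧
      s'.v .j = s.v .j ∧ s'.v .e = s.v .e ∧
      t + s'.v .cnt + 16 * I.potL lst' + I.potV (s'.a .lev) + 10 * (I.K + 2) ≤
        s.v .cnt + 16 * I.potL lst + I.potV (s.a .lev) + 10 * rem.length + 1) s := by
  have hW := hE.W
  have hHB : I.HB = I.K + 2 + I.EM + 3 * I.Q + I.mx := rfl
  have hK2 := I.K2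
  refine wp_loop (J := fun p s' => ∃ lst' rem', LInv I E lst' S recs ρ I.K rem' j x₀ [] s' ∧
      s'.v .j = s.v .j ∧ s'.v .e = s.v .e ∧ s'.v .cur = s.v .cur ∧ s'.a .ub = s.a .ub ∧
      s'.a .key = s.a .key ∧
      Ch I (s'.a .nx) (s'.a .ci) (s'.a .cv) (s'.v .c) rem' ∧ s'.v .c ≤ s'.v .cnt ∧
      (y₀ ∈ rem' ∧ s'.a .lev y₀ = j ∨ s'.a .lev y₀ = I.K) ∧ p ≤ CM ∧
      p = s'.v .cnt + 16 * I.potL lst' + I.potV (s'.a .lev) + 10 * rem'.length +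
        (if s'.a .lev y₀ = I.K then 10 * (I.K + 2) else 0))
    ?_ ?_ ⟨lst, rem, h, rfl, rfl, rfl, rfl, rfl, hc, hcl, Or.inl ⟨hy, hyl⟩, hCM,
      by rw [if_neg (by omega)]; rfl⟩ ?_
  · intro p s' _
    simp [Cd.ok, Ex.ok]
  · rintro p s' ⟨lst', rem', h', e1, e2, e3, e4, e5, hc', hcl', hy', hp, rfl⟩ hpos
    simp only [Cd.ev, Ex.ev] at hpos
    generalize hcc : s'.v .c = c at hc' hpos hcl'
    cases hc' with
    | nil => omega
    | @cons c l' c1 hi hv c4 c5 =>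
    have hn := Inst.node_lt hi hv
    have hrow := h'.st.row_eq _ hi
    have hnode : s'.a .ci c * I.n + s'.a .cv c = I.node (s'.a .ci c) (s'.a .cv c) := rfl
    simp only [cellE, wp_seq, wp_asg, wp_put, wp_ite, wp_skip, Cd.ok, Cd.ev, Ex.ok, Ex.ev, true_and,
      St.simps, reduceCtorEq, if_false, if_true, hcc, hrow, e1, hj, hnode, List.length_cons] at hp ⊢
    set x := I.node (s'.a .ci c) (s'.a .cv c) with hxd
    obtain ⟨x1, x2⟩ := h'.qi.ex x List.mem_cons_self
    refine ⟨by omega, by omega, fun hlev => ⟨by omega, ?_⟩, fun hlev => ?_⟩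
    · have hxj : s'.a .lev x = j := by omega
      obtain ⟨xS, xk⟩ := x2 hxj
      refine (walk_spec (K := I.K) (by omega) ?_ ?_).mono ?_
      · simp only [St.simps]; exact h'.qi.ub0
      · simp only [St.simps, if_true]; omega
      rintro t _ ⟨l, rfl, l1, l2, l3, l4, l5⟩
      simp only [St.simps, reduceCtorEq, if_false, if_true] at l1 l3 l4 l5
      simp only [pushC, wp_seq, wp_put, wp_asg, Ex.ok, Ex.ev, true_and,
        St.simps, reduceCtorEq, if_false, if_true, hcc]
      refine ⟨by omega, ?_⟩
      have hxX : x ∈ I.X := h'.mem_X (by omega)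
      have PV := Inst.potV_update hxX (s'.a .lev) l
      have PL := Inst.potL_update (I := I) (k := l) (by omega) lst' (x :: lst' l)
      have PLV := Inst.LV_le (I := I) (show s'.a .lev x ≤ l by omega) l2
      rw [List.length_cons] at PL
      have hup : ∀ i, 2 ≤ i → i ≤ l → s'.a .key x < s'.a .ub i := by
        intro i hi hil
        rcases (show i ≤ j ∨ i = j + 1 ∨ j + 1 < i by omega) with h1 | rfl | h1
        · exact h'.qi.up x i xS hi (by omega)
        · exact xk
        · exact l3 i h1 hil
      have Q1 := h'.qi.place (d := s'.a .key x) xS (Or.inr le_rfl) (h'.qi.Uc x xS (by omega))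
        (show s'.a .lev x ≤ l by omega) (by omega) l2 hup (fun _ => l4)
        (fun e => absurd e (by omega)) (fun _ e => absurd e (by omega))
      rw [if_pos (by omega), Function.update_eq_self] at Q1
      have Q2 := Q1.skipRem (by rw [Function.update_self]; omega)
      have C1 := h'.ch.push hi hv l
      have D1 := h'.di.relevel (y := x) (l := l) (by omega) (by omega)
      have R1 := h'.ri.relevel (y := x) (l := l) (by omega)
      have inv : ∀ s'' : St, (∀ y, y ≠ .x → y ≠ .d → y ≠ .l → y ≠ .cnt → y ≠ .c → s''.v y = s'.v y) →
          (∀ k, k ≠ .lev → k ≠ .nx → k ≠ .ci → k ≠ .cv → k ≠ .hh → s''.a k = s'.a k) →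
          s''.o = s'.o → s''.rc = s'.rc → s''.a .lev = Function.update (s'.a .lev) x l →
          ChAll I (s''.a .nx) (s''.a .ci) (s''.a .cv) (s''.a .hh) (s''.v .cnt)
            (Function.update lst' l (x :: lst' l)) →
          LInv I E (Function.update lst' l (x :: lst' l)) S recs ρ I.K l' j x₀ [] s'' := by
        intro s'' hv ha ho hrc hlv hch
        have a := fun k h1 h2 h3 h4 h5 => ha k h1 h2 h3 h4 h5
        refine ⟨?_, ?_, ?_, ?_, hch, ?_, ?_, ?_⟩
        · have st := h'.st
          rwa [← hv .kk (by decide) (by decide) (by decide) (by decide) (by decide),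
            ← hv .qq (by decide) (by decide) (by decide) (by decide) (by decide),
            ← hv .em (by decide) (by decide) (by decide) (by decide) (by decide),
            ← ha .row (by decide) (by decide) (by decide) (by decide) (by decide),
            ← ha .pw (by decide) (by decide) (by decide) (by decide) (by decide),
            ← ha .dec (by decide) (by decide) (by decide) (by decide) (by decide),
            ← ha .ah (by decide) (by decide) (by decide) (by decide) (by decide),
            ← ha .an (by decide) (by decide) (by decide) (by decide) (by decide),
            ← ha .hd (by decide) (by decide) (by decide) (by decide) (by decide),
            ← ha .wt (by decide) (by decide) (by decide) (by decide) (by decide),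
            ← ha .wh (by decide) (by decide) (by decide) (by decide) (by decide),
            ← ha .cx (by decide) (by decide) (by decide) (by decide) (by decide)] at st
        · rw [hlv, ha .key (by decide) (by decide) (by decide) (by decide) (by decide),
            ha .ub (by decide) (by decide) (by decide) (by decide) (by decide),
            hv .e (by decide) (by decide) (by decide) (by decide) (by decide),
            hv .cur (by decide) (by decide) (by decide) (by decide) (by decide)]
          exact Q2
        · rw [hlv, ha .key (by decide) (by decide) (by decide) (by decide) (by decide)]
          exact D1
        · rw [hlv, ha .key (by decide) (by decide) (by decide) (by decide) (by decide),
            ha .rd (by decide) (by decide) (by decide) (by decide) (by decide),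
            ha .rp (by decide) (by decide) (by decide) (by decide) (by decide),
            ha .rr (by decide) (by decide) (by decide) (by decide) (by decide),
            ha .rf (by decide) (by decide) (by decide) (by decide) (by decide),
            ha .pv (by decide) (by decide) (by decide) (by decide) (by decide),
            ha .pr (by decide) (by decide) (by decide) (by decide) (by decide),
            hv .rc (by decide) (by decide) (by decide) (by decide) (by decide)]
          exact R1
        · rw [ha .rn (by decide) (by decide) (by decide) (by decide) (by decide),
            ha .hr (by decide) (by decide) (by decide) (by decide) (by decide), ho]
          exact h'.rch
        · rw [ha .rf (by decide) (by decide) (by decide) (by decide) (by decide), hrc]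
          exact h'.rcc
        · rw [hv .e (by decide) (by decide) (by decide) (by decide) (by decide)]
          exact h'.el
      have hcn : ∀ (f : ℕ → ℕ) (y b : ℕ), b ≤ s'.v .cnt →
          Function.update f (s'.v .cnt + 1) y b = f b :=
        fun f y b hb => Function.update_of_ne (by omega) _ _
      have bonus : (y₀ ∈ l' ∧ Function.update (s'.a .lev) x l y₀ = j ∨
          Function.update (s'.a .lev) x l y₀ = I.K) ∧
          I.potV (Function.update (s'.a .lev) x l) + 20 * (l - j) +
            (if Function.update (s'.a .lev) x l y₀ = I.K then 10 * (I.K + 2) else 0) ≤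
          I.potV (s'.a .lev) + if s'.a .lev y₀ = I.K then 10 * (I.K + 2) else 0 := by
        rcases eq_or_ne y₀ x with hyx | hyx
        -- All bounds from level `j + 2` on exceed the minimum, so the walk of the minimal item
        -- cannot stop before the last level.
        · have hlK : l = I.K := by
            by_contra hne
            have := hub (l + 1) (by omega) (by omega)
            rw [e4] at l4
            rw [← hyx, e5, hyk] at l4
            omega
          have := Inst.LV_K hjK
          rw [hyx, Function.update_self, if_pos hlK, if_neg (by omega)]
          rw [hxj, hlK] at PV
          exact ⟨Or.inr hlK, by rw [hlK]; omega⟩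
        · rw [Function.update_of_ne hyx]
          exact ⟨hy'.imp_left fun hh => ⟨(List.mem_cons.1 hh.1).resolve_left hyx, hh.2⟩, by omega⟩
      rw [hcn _ _ c hcl']
      refine ⟨_, ⟨_, l', inv _ ?_ ?_ rfl rfl ?_ C1, e1.trans hj, e2, e3, e4, e5,
        c5.congr (hcn _ _) (hcn _ _) (hcn _ _) (by omega), by omega, ?_, ?_, rfl⟩, ?_⟩
      · intro y h1 h2 h3 h4 h5; simp [St.simps, h1, h2, h3, h4, h5]
      · intro y h1 h2 h3 h4 h5; simp [St.simps, h1, h2, h3, h4, h5]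
      · simp [St.simps]
      · exact bonus.1
      · have := bonus.2
        omega
      · have := bonus.2
        omega
    · have hxj : s'.a .lev x ≠ j := by omega
      refine ⟨_, ⟨lst', l', LInv.setV (LInv.setV { h' with qi := h'.qi.skipRem hxj } _ _ ?_) _ _ ?_,
        e2, e3, e4, e5, c5, by omega, ?_, ?_, rfl⟩, ?_⟩
      · decide
      · decide
      · refine hy'.imp_left fun hh => ⟨(List.mem_cons.1 hh.1).resolve_left ?_, hh.2⟩
        rintro rfl
        exact hxj hh.2
      · omega
      · omega
  · rintro t p s' ⟨lst', rem', h', e1, e2, e3, e4, e5, hc', hcl', hy', hp, rfl⟩ hpos ht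
    simp only [Cd.ev, Ex.ev] at hpos
    generalize s'.v .c = c at hc' hpos
    cases hc' with
    | cons => omega
    | nil =>
      have hK : s'.a .lev y₀ = I.K := hy'.resolve_left (by simp)
      rw [if_pos hK, List.length_nil] at ht
      exact ⟨lst', h', e1, e2, by omega⟩

end

section

variable {I : Inst} {E : Env} {CM : ℕ} {lst : ℕ → List ℕ} {S : Finset ℕ} {recs : ℕ → List ℕ}
  {ρ : ℕ → ℕ} {r x₀ : ℕ} {s : St}

/-- Clearing the list releases `16` units for each entry. If all entries are stale, this pays for
the scan alone; otherwise it pays for scan and distribution, and the arrival of the minimum at level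
`K` pays the costs proportional to `K`. -/
theorem redis_spec {j : ℕ} (hE : Fit I E CM) (h : LInv I E lst S recs ρ j [] r x₀ [] s)
    (hj : s.v .j = j) (hjK : j < I.K) (hl : lst j ≠ []) (he : s.v .e ≤ I.EM)
    (hp : I.potSt lst S s ≤ CM) :
    wp E redisC (fun t s' => ∃ lst' r', LInv I E lst' S recs ρ (s'.v .j) [] r' x₀ [] s' ∧
      s'.v .e = s.v .e ∧ t + 3 + I.potSt lst' S s' ≤ I.potSt lst S s) s := by
  have hW := hE.W
  have hHB : I.HB = I.K + 2 + I.EM + 3 * I.Q + I.mx := rfl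
  have hK2 := I.K2
  have hkk := h.st.kk_eq
  have hj1 := h.qi.j1
  obtain ⟨hch, hle⟩ := h.ch j
  have valid : ∀ x ∈ lst j, s.a .lev x ≤ j → s.a .lev x = j ∧ s.a .key x < s.a .ub j ∧
      s.a .key x < s.v .e + I.Q := by
    intro x hx hlx
    have := h.qi.ent j x hj1 hjK.le hx
    have hlj : s.a .lev x = j := by omega
    have hS : x ∉ S := fun hS => by have := (h.qi.Sk x hS).1; omega
    refine ⟨hlj, ?_⟩
    rcases (show j = 1 ∨ 1 < j by omega) with rfl | hj
    · rw [h.qi.ub1]; exact ⟨h.qi.ent1 x hx, h.qi.ent1 x hx⟩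
    · rw [← (h.qi.ph hj).1]
      exact ⟨h.qi.up x j hS hj hlj.ge, h.qi.up x 2 hS le_rfl (by omega)⟩
  have hpd : I.potSt lst S s = s.v .cnt + (16 * I.potL lst + I.potV (s.a .lev) + 50 * I.potS S +
    4 * s.v .j + 10 * I.potE (s.v .e)) := rfl
  have PL := Inst.potL_update (I := I) (k := j) (by omega) lst []
  rw [List.length_nil] at PL
  have hlen : 1 ≤ (lst j).length := List.length_pos_iff.2 hl
  simp only [redisC, wp_seq, wp_put, wp_asg, Ex.ok, Ex.ev, true_and,
    St.simps, reduceCtorEq, if_false, if_true, hj]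
  refine ⟨by omega, (min_spec (I := I) (E := E) (j := j) (l := lst j) (by omega) ?_ ?_ ?_).mono ?_⟩
  · simp only [St.simps, reduceCtorEq, if_false]; exact h.st.row_eq
  · simp [St.simps, hj]
  · simp only [St.simps, reduceCtorEq, if_false, if_true]; exact hch
  rintro t s₂ ⟨k, g1, g2, g3, ht⟩
  have kv := k.v
  have ka := k.a
  simp only [St.simps, reduceCtorEq, if_false, if_true] at kv g1 g2 g3
  have va : ∀ y, y ≠ .c → y ≠ .x → y ≠ .g → s₂.v y = _ := fun y h1 h2 h3 => kv y (by simp [h1, h2, h3])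
  have v1 := va .j (by decide) (by decide) (by decide)
  have v2 := va .kk (by decide) (by decide) (by decide)
  have v3 := va .h (by decide) (by decide) (by decide)
  have v4 := va .e (by decide) (by decide) (by decide)
  have v5 := va .cnt (by decide) (by decide) (by decide)
  have v6 := va .qq (by decide) (by decide) (by decide)
  have v7 := va .em (by decide) (by decide) (by decide)
  have v8 := va .rc (by decide) (by decide) (by decide)
  have v9 := va .cur (by decide) (by decide) (by decide)
  simp only [reduceCtorEq, if_false, if_true] at v1 v2 v3 v4 v5 v6 v7 v8 v9
  have aa : ∀ y, y ≠ .hh → s₂.a y = s.a y := fun y hy => by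
    rw [ka]; simp [St.simps, hy]
  have ahh : s₂.a .hh = Function.update (s.a .hh) j 0 := by rw [ka]; simp [St.simps]
  have ho : s₂.o = s.o := by rw [k.o]; simp [St.simps]
  have hrc : s₂.rc = s.rc := by rw [k.rc]; simp [St.simps]
  have inv : ∀ (jj : ℕ) (rem : List ℕ) (r' : ℕ) (s' : St), 
      QI I.K I.Q (s.a .key) (s.a .lev) (s'.a .ub) (Function.update lst j []) S (s.v .e) (s'.v .cur)
        jj rem r' →
      (∀ y, y ≠ .c → y ≠ .cur → y ≠ .l → s'.v y = s₂.v y) → (∀ y, y ≠ .ub → s'.a y = s₂.a y) →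
      s'.o = s₂.o → s'.rc = s₂.rc →
      LInv I E (Function.update lst j []) S recs ρ jj rem r' x₀ [] s' := by
    intro jj rem r' s' q bv ba bo brc
    have st := h.st
    have di := h.di
    have ri := h.ri
    have ch : ChAll I (s.a .nx) (s.a .ci) (s.a .cv) (Function.update (s.a .hh) j 0) (s.v .cnt)
      (Function.update lst j []) := h.ch.set .nil (Nat.zero_le _)
    have rch := h.rch
    have rcc := h.rcc
    have el := h.el
    rw [← ahh] at ch
    have e := fun y h1 h2 => ((ba y h1).trans (aa y h2)).symm
    rw [e .nx (by decide) (by decide), e .ci (by decide) (by decide), e .cv (by decide) (by decide),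
      ← ba .hh (by decide)] at ch
    rw [e .key (by decide) (by decide), e .lev (by decide) (by decide)] at di q
    rw [e .key (by decide) (by decide), e .lev (by decide) (by decide),
      e .rd (by decide) (by decide), e .rp (by decide) (by decide), e .rr (by decide) (by decide),
      e .rf (by decide) (by decide), e .pv (by decide) (by decide), e .pr (by decide) (by decide),
      ← v8, ← bv .rc (by decide) (by decide) (by decide)] at ri
    rw [e .rn (by decide) (by decide), e .hr (by decide) (by decide), ← ho, ← bo] at rch
    rw [e .rf (by decide) (by decide), ← hrc, ← brc] at rcc
    rw [← v4, ← bv .e (by decide) (by decide) (by decide)] at el q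
    rw [← v5, ← bv .cnt (by decide) (by decide) (by decide)] at ch
    rw [← v2, ← v6, ← v7, ← bv .kk (by decide) (by decide) (by decide), 
      ← bv .qq (by decide) (by decide) (by decide), ← bv .em (by decide) (by decide) (by decide),
      e .row (by decide) (by decide), e .pw (by decide) (by decide), e .dec (by decide) (by decide),
      e .ah (by decide) (by decide), e .an (by decide) (by decide), e .hd (by decide) (by decide),
      e .wt (by decide) (by decide), e .wh (by decide) (by decide),
      e .cx (by decide) (by decide)] at st
    exact ⟨st, q, di, ri, ch, rch, rcc, el⟩
  -- The scan started from `ub j`, which exceeds the key of every valid entry, so the result is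
  -- below `ub j` exactly if there is a valid entry.
  rw [wp_ite]
  simp only [Cd.ok, Cd.ev, Ex.ok, Ex.ev, true_and, v1, aa .ub (by decide), hj]
  refine ⟨fun hg => ?_, fun hg => ?_⟩
  swap
  · have Q1 := h.qi.clear (fun x hx hlx => by
      have h1 := g2 x hx hlx.le
      have h2 := (valid x hx hlx.le).2.1
      omega) hjK
    have L1 := inv j [] r s₂ (by rw [aa .ub (by decide), v9]; exact Q1) (fun _ _ _ _ => rfl)
      (fun _ _ => rfl) rfl rfl
    rw [wp_skip]
    refine ⟨_, r, by rw [v1, hj]; exact L1, v4, ?_⟩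
    have : I.potSt (Function.update lst j []) S s₂ = s₂.v .cnt +
      (16 * I.potL (Function.update lst j []) + I.potV (s₂.a .lev) + 50 * I.potS S +
      4 * s₂.v .j + 10 * I.potE (s₂.v .e)) := rfl
    rw [v5, aa .lev (by decide), v1, v4] at this
    omega
  · obtain ⟨y₀, hy, hyl, hyk⟩ := g3.resolve_left (by omega)
    obtain ⟨y1, y2, y3⟩ := valid y₀ hy hyl
    simp only [wp_seq, wp_asg, Ex.ok, Ex.ev, true_and]
    refine (bounds_spec (j := j) (K := I.K) (Q := I.Q) hjK ?_ ?_ ?_ ?_).mono ?_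
    · simp only [St.simps, if_true]
      omega
    · intro i hi hiK
      simp only [St.simps, aa .pw (by decide)]
      exact ⟨h.st.pw_eq i hi hiK, Nat.pow_le_pow_right (by omega) (by omega)⟩
    · simp [St.simps, v1, hj]
    · simp [St.simps, v2, hkk]
    rintro t₂ s₃ ⟨w1, w2, w3, w4, w5, w6, w7, ht₂⟩
    simp only [St.simps, if_true, aa .ub (by decide)] at w1 w2 w5 w6 w7
    rw [w1 .h (by decide)]
    simp only [reduceCtorEq, if_false, v3]
    have hcur : s₃.v .cur = s.a .key y₀ := by rw [w1 .cur (by decide), if_pos rfl, hyk]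
    have Q1 := h.qi.openLevel hjK hy y1 (fun x hx hlx => by rw [hyk]; exact g2 x hx hlx.le) w5
      (fun i hi hiK => by rw [w6 i hi hiK, hyk]) w7
    have L1 := inv I.K (lst j) j (s₃.setV .c (s.a .hh j)) ?_ ?_ ?_ ?_ ?_
    rotate_left
    · simp only [St.simps, reduceCtorEq, if_false, hcur]; exact Q1
    · intro y a1 a2 a3
      simp only [St.simps, a1, if_false]
      rw [w1 y a3, if_neg a2]
    · exact fun y hy => w2 y hy
    · exact w3
    · exact w4
    have ea : ∀ y, y ≠ .ub → y ≠ .hh → s₃.a y = s.a y := fun y h1 h2 => (w2 y h1).trans (aa y h2)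
    have ev : ∀ y, y ≠ .cur → y ≠ .l → s₃.v y = s₂.v y := fun y h1 h2 => by 
      rw [w1 y h2, if_neg h1]
    have hlev := ea .lev (by decide) (by decide)
    have hcnt : s₃.v .cnt = s.v .cnt := (ev .cnt (by decide) (by decide)).trans v5
    refine (spread_spec (y₀ := y₀) hE L1 hjK hj1 ?_ ?_ ?_ hy ?_ ?_ ?_ ?_).mono ?_
    all_goals simp only [St.simps, reduceCtorEq, if_false, if_true, hlev, hcnt]
    · rw [ev .j (by decide) (by decide), v1, hj]
    · rw [ea .nx (by decide) (by decide), ea .ci (by decide) (by decide),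
        ea .cv (by decide) (by decide)]; exact hch
    · exact hle
    · exact y1
    · rw [ea .key (by decide) (by decide), hcur]
    · intro i hi hiK
      rw [w6 i hi hiK, hcur, hyk]
      exact Nat.lt_add_of_pos_right (by positivity)
    · omega
    rintro t₃ s₄ ⟨lst', L, f1, f2, ht₃⟩
    have hk4 : s₄.v .kk = I.K := L.st.kk_eq
    have hj4 : s₃.v .e = s.v .e := (ev .e (by decide) (by decide)).trans v4
    refine ⟨lst', j, ?_, by rw [f2, hj4], ?_⟩
    · rw [hk4]; exact L.setV _ _ (by decide)
    have : I.potSt lst' S (s₄.setV .j (s₄.v .kk)) = s₄.v .cnt +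
      (16 * I.potL lst' + I.potV (s₄.a .lev) + 50 * I.potS S +
      4 * s₄.v .kk + 10 * I.potE (s₄.v .e)) := rfl
    rw [f2, hj4, hk4] at this
    rw [hk4]
    omega

end

/-! ### The main loop -/

section

variable {I : Inst} {E : Env} {CM : ℕ} {lst : ℕ → List ℕ} {S : Finset ℕ} {recs : ℕ → List ℕ}
  {ρ : ℕ → ℕ} {r x₀ : ℕ} {s : St}

/-- Moving a whole bucket to level `1` leaves the number of entries unchanged, and the fall of
`potE` by one pays for it. -/
theorem adv_spec (hE : Fit I E CM) (h : LInv I E lst S recs ρ 1 [] r x₀ [] s)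
    (hj : s.v .j = 1) (hl : lst 1 = []) (he : s.v .e ≤ I.EM) :
    wp E advC (fun t s' => ∃ lst', LInv I E lst' S recs ρ (s'.v .j) [] r x₀ [] s' ∧
      t + 3 + I.potSt lst' S s' ≤ I.potSt lst S s) s := by
  have hW := hE.W
  have hHB : I.HB = I.K + 2 + I.EM + 3 * I.Q + I.mx := rfl
  have hK2 := I.K2
  have hkk := h.st.kk_eq
  have hqq : s.v .qq = I.Q := h.st.qq_eq
  have hQ := h.qi.Q_pos
  have hpd : I.potSt lst S s = s.v .cnt + (16 * I.potL lst + I.potV (s.a .lev) + 50 * I.potS S +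
    4 * s.v .j + 10 * I.potE (s.v .e)) := rfl
  have Q1 := h.qi.advance hl
  obtain ⟨c1, c2⟩ := h.ch (I.K + 1 + (s.v .e + I.Q))
  have C1 := (h.ch.set (k := 1) c1 c2).set (k := I.K + 1 + (s.v .e + I.Q)) .nil (Nat.zero_le _)
  have P1 := Inst.potL_update (I := I) (k := 1) (by omega) lst (lst (I.K + 1 + (s.v .e + I.Q)))
  have P2 := Inst.potL_update (I := I) (k := I.K + 1 + (s.v .e + I.Q)) (by omega)
    (Function.update lst 1 (lst (I.K + 1 + (s.v .e + I.Q)))) []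
  rw [Function.update_of_ne (by omega), List.length_nil] at P2
  rw [hl, List.length_nil] at P1
  have PE : I.potE (s.v .e + I.Q) + 1 = I.potE (s.v .e) := by
    unfold Inst.potE
    rw [← Nat.add_div_right _ hQ]
    congr 1
    omega
  simp only [advC, wp_seq, wp_put, wp_asg, Ex.ok, Ex.ev, true_and,
    St.simps, reduceCtorEq, if_false, if_true, hj, hkk, hqq]
  refine ⟨by omega, by omega, by omega, by omega, by omega, by omega, _, ⟨?_, ?_, ?_, ?_, C1, ?_, ?_, ?_⟩, ?_⟩
  all_goals try simp only [St.simps, reduceCtorEq, if_false, if_true]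
  · exact h.st
  · exact Q1
  · exact h.di
  · exact h.ri
  · exact h.rch
  · exact h.rcc
  · omega
  · simp only [Inst.potSt, Inst.pot, St.simps, reduceCtorEq, if_false, if_true] at hpd ⊢
    omega

theorem step_spec (hE : Fit I E CM) (h : LInv I E lst S recs ρ (s.v .j) [] r x₀ [] s)
    (he : s.v .e ≤ I.EM) (hp : I.potSt lst S s ≤ CM) :
    wp E stepC (fun t s' => ∃ lst' S' recs' ρ' r' x₀', LInv I E lst' S' recs' ρ' (s'.v .j) [] r'
      x₀' [] s' ∧ t + 1 + I.potSt lst' S' s' ≤ I.potSt lst S s) s := by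
  have hW := hE.W
  have hkk := h.st.kk_eq
  have hjK := h.qi.jK
  have hj1 := h.qi.j1
  have hch := (h.ch (s.v .j)).1.ne_nil_iff
  unfold stepC
  rw [wp_ite]
  refine ⟨by simp [Cd.ok, Ex.ok], fun hc => ?_, fun hc => ?_⟩
  all_goals simp only [Cd.ev, Ex.ev, hch, not_not] at hc; rw [wp_ite]
  · refine ⟨by simp [Cd.ok, Ex.ok], fun hk => ?_, fun hk => ?_⟩
    all_goals simp only [Cd.ev, Ex.ev, hkk] at hk
    · refine (redis_spec hE h rfl hk hc he hp).mono ?_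
      rintro t s' ⟨lst', r', L, -, ht⟩
      exact ⟨lst', S, recs, ρ, r', x₀, L, by omega⟩
    · have hjK' : s.v .j = I.K := by omega
      rw [hjK'] at h hc
      obtain ⟨x, l, hl⟩ := List.exists_cons_of_ne_nil hc
      refine (settle_spec hE h hl hjK' he hp).mono ?_
      rintro t s' ⟨lst', S', recs', ρ', x', L, hj', -, ht⟩
      exact ⟨lst', S', recs', ρ', r, x', by rw [hj']; exact L, by omega⟩
  · refine ⟨by simp [Cd.ok, Ex.ok]; omega, fun hk => ?_, fun hk => ?_⟩
    all_goals simp only [Cd.ev, Ex.ev] at hk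
    · have hd := h.st.dec_eq (s.v .j) hk hjK
      simp only [wp_asg, Ex.ok, Ex.ev, true_and, hd]
      refine ⟨lst, S, recs, ρ, r, x₀, ?_, ?_⟩
      · have L : LInv I E lst S recs ρ (s.v .j - 1) [] r x₀ [] s :=
          { h with qi := h.qi.down hc hk }
        have := L.setV .j (s.v .j - 1) (by decide)
        simpa [St.simps] using this
      · simp only [Inst.potSt, Inst.pot, St.simps, reduceCtorEq, if_false, if_true]
        omega
    · have hj : s.v .j = 1 := by omega
      rw [hj] at h hc
      refine (adv_spec hE h hj hc he).mono ?_
      rintro t s' ⟨lst', L, ht⟩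
      exact ⟨lst', S, recs, ρ, r, x₀, L, by omega⟩

/-- Each round lowers the potential by at least its number of steps, so the potential at the start
bounds the running time. -/
theorem main_spec (hE : Fit I E CM) (h : LInv I E lst S recs ρ (s.v .j) [] r x₀ [] s)
    (hp : I.potSt lst S s ≤ CM) :
    wp E mainC (fun t s' => ∃ lst' S' recs' ρ' r' x₀', LInv I E lst' S' recs' ρ' (s'.v .j) [] r'
      x₀' [] s' ∧ I.EM < s'.v .e ∧ t ≤ CM + 1) s := by
  have hW := hE.W
  have hHB : I.HB = I.K + 2 + I.EM + 3 * I.Q + I.mx := rfl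
  refine wp_loop (J := fun p s' => ∃ lst' S' recs' ρ' r' x₀',
      LInv I E lst' S' recs' ρ' (s'.v .j) [] r' x₀' [] s' ∧ p = I.potSt lst' S' s' ∧ p ≤ CM)
    ?_ ?_ ⟨lst, S, recs, ρ, r, x₀, h, rfl, hp⟩ ?_
  · rintro p s' ⟨lst', S', recs', ρ', r', x₀', h', rfl, hp'⟩
    have : s'.v .em = I.EM := h'.st.em_eq
    simp [Cd.ok, Ex.ok, Ex.ev, this]
    omega
  · rintro p s' ⟨lst', S', recs', ρ', r', x₀', h', rfl, hp'⟩ hc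
    have : s'.v .em = I.EM := h'.st.em_eq
    simp only [Cd.ev, Ex.ev, this] at hc
    refine (step_spec hE h' (by omega) hp').mono ?_
    rintro t s'' ⟨lst'', S'', recs'', ρ'', r'', x₀'', L, ht⟩
    exact ⟨_, ⟨lst'', S'', recs'', ρ'', r'', x₀'', L, rfl, by omega⟩, ht⟩
  · rintro t p s' ⟨lst', S', recs', ρ', r', x₀', h', rfl, hp'⟩ hc ht
    have : s'.v .em = I.EM := h'.st.em_eq
    simp only [Cd.ev, Ex.ev, this] at hc
    exact ⟨lst', S', recs', ρ', r', x₀', h', by omega, by omega⟩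

end

/-! ### Initialisation: reading the edges, choosing the levels, inserting the sources -/

theorem Keep.refl (vs : List Vr) (as : List Ar) (s : St) : Keep vs as s s :=
  ⟨fun _ _ => rfl, fun _ _ => rfl⟩

theorem Keep.setV {vs : List Vr} {as : List Ar} {s s' : St} (h : Keep vs as s s') {x : Vr} (k : ℕ)
    (hx : x ∈ vs) : Keep vs as s (s'.setV x k) :=
  ⟨fun y hy => (Function.update_of_ne (fun e => hy (by rw [e]; exact hx)) _ _).trans (h.v y hy),
    h.a⟩

theorem Keep.setA {vs : List Vr} {as : List Ar} {s s' : St} (h : Keep vs as s s') {x : Ar}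
    (i k : ℕ) (hx : x ∈ as) : Keep vs as s (s'.setA x i k) :=
  ⟨h.v, fun y hy => (Function.update_of_ne (fun e => hy (by rw [e]; exact hx)) _ _).trans (h.a y hy)⟩

theorem Adj.congr {an an' : ℕ → ℕ} {a : ℕ} {l : List ℕ} (h : Adj an a l)
    (he : ∀ e ∈ l, an' (e + 1) = an (e + 1)) : Adj an' a l := by
  induction h with
  | nil => exact .nil
  | @cons e l _ ih =>
    refine .cons ?_
    rw [he e List.mem_cons_self]
    exact ih fun e' h' => he e' (List.mem_cons_of_mem _ h')

/-- The first `k` edges have been read. -/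
structure Base (I : Inst) (k : ℕ) (s : St) : Prop where
  vn : s.v .n = I.n
  vm : s.v .m = I.m
  vs : s.v .s = I.s
  vmx : s.v .mx = (Finset.range k).sup I.wt
  row : ∀ i < k, s.a .row i = i * I.n
  adj : ∀ u < I.n, Adj (s.a .an) (s.a .ah u) (I.outE k u)
  hd : ∀ e < k, s.a .hd (e + 1) = I.hd e
  wt : ∀ e < k, s.a .wt (e + 1) = I.wt e
  cx : ∀ e < k, s.a .cx (e + 1) = e
  zv : ∀ x ∈ ([.em, .e, .cur, .cnt, .rc] : List Vr), s.v x = 0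
  za : ∀ x ∈ ([.key, .lev, .hh, .ub, .hr] : List Ar), ∀ i, s.a x i = 0
  zo : ∀ i, s.o i = 0

theorem Base.keep {I : Inst} {k : ℕ} {s s' : St} {vs : List Vr} {as : List Ar} (h : Base I k s)
    (hk : Keep vs as s s') (ho : s'.o = s.o)
    (hv : ∀ x ∈ ([.n, .m, .s, .mx, .em, .e, .cur, .cnt, .rc] : List Vr), x ∉ vs)
    (ha : ∀ x ∈ ([.row, .an, .ah, .hd, .wt, .cx, .key, .lev, .hh, .ub, .hr] : List Ar), x ∉ as) :
    Base I k s' := by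
  have ev := fun x hx => hk.v x (hv x hx)
  have ea := fun x hx => hk.a x (ha x hx)
  refine ⟨?_, ?_, ?_, ?_, ?_, ?_, ?_, ?_, ?_, ?_, ?_, ?_⟩
  · rw [ev .n (by simp)]; exact h.vn
  · rw [ev .m (by simp)]; exact h.vm
  · rw [ev .s (by simp)]; exact h.vs
  · rw [ev .mx (by simp)]; exact h.vmx
  · rw [ea .row (by simp)]; exact h.row
  · rw [ea .an (by simp), ea .ah (by simp)]; exact h.adj
  · rw [ea .hd (by simp)]; exact h.hd
  · rw [ea .wt (by simp)]; exact h.wt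
  · rw [ea .cx (by simp)]; exact h.cx
  · intro x hx; rw [ev x (by simp at hx ⊢; tauto)]; exact h.zv x hx
  · intro x hx; rw [ea x (by simp at hx ⊢; tauto)]; exact h.za x hx
  · rw [ho]; exact h.zo

/-- The input of the environment is the given instance. -/
structure Given (I : Inst) (E : Env) : Prop where
  n : E.n = I.n
  m : E.m = I.m
  in0 : E.inp 0 = I.n
  in1 : E.inp 1 = I.m
  in2 : E.inp 2 = I.s
  tl : ∀ e < I.m, E.inp (3 + 3 * e) = I.tl e
  hd : ∀ e < I.m, E.inp (3 + 3 * e + 1) = I.hd e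
  wt : ∀ e < I.m, E.inp (3 + 3 * e + 2) = I.wt e

theorem Inst.outE_succ (I : Inst) (k u : ℕ) :
    I.outE (k + 1) u = if I.tl k = u then k :: I.outE k u else I.outE k u := by
  unfold Inst.outE
  rw [List.range_succ, List.filter_append, List.reverse_append]
  by_cases h : I.tl k = u <;> simp [h]

/-- Memory is zero at the start, which already means empty adjacency lists, unseen nodes and empty
outputs. So no pass over the vertices is needed and the time depends on `m` alone. -/
theorem read_spec {I : Inst} {E : Env} {s : St} (hE : Given I E)
    (hW : I.m * I.n + 3 * I.m + I.n + 100 ≤ E.W) (hz : ∀ x, s.v x = 0) (ha : ∀ k i, s.a k i = 0)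
    (ho : ∀ i, s.o i = 0) :
    wp E readC (fun t s' => Base I I.m s' ∧ t ≤ 15 * I.m + 5) s := by
  have hO : E.O = 3 + (I.m + I.m + I.m) := by rw [Env.O, hE.m]
  simp only [readC, wp_seq, wp_asg, Ex.ok, Ex.ev, hE.in0, hE.in1, hE.in2, hO]
  refine ⟨by omega, by omega, by omega, by omega, wp_loop
    (J := fun p s' => ∃ k ≤ I.m, Base I k s' ∧ s'.v .i = k ∧ s'.v .r = k * I.n ∧
      s'.v .p = 3 + 3 * k ∧ p = 15 * (I.m - k)) ?_ ?_ (p := 15 * I.m)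
    ⟨0, Nat.zero_le _, ⟨?_, ?_, ?_, ?_, ?_, ?_, ?_, ?_, ?_, ?_, ?_, ?_⟩, ?_, ?_, ?_, rfl⟩ ?_⟩
  · rintro p s' -
    simp [Cd.ok, Ex.ok]
  · rintro p s' ⟨k, hk, B, vi, vr, vp, rfl⟩ hc
    simp only [Cd.ev, Ex.ev, vi, B.vm] at hc
    have hmul : k * I.n + I.n ≤ I.m * I.n := by
      calc k * I.n + I.n = (k + 1) * I.n := by ring
        _ ≤ I.m * I.n := Nat.mul_le_mul_right _ hc
    have inv : ∀ s'' : St, s''.v .n = s'.v .n → s''.v .m = s'.v .m → s''.v .s = s'.v .s →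
        s''.v .mx = max (s'.v .mx) (I.wt k) →
        s''.a .row = Function.update (s'.a .row) k (k * I.n) →
        s''.a .an = Function.update (s'.a .an) (k + 1) (s'.a .ah (I.tl k)) →
        s''.a .ah = Function.update (s'.a .ah) (I.tl k) (k + 1) →
        s''.a .hd = Function.update (s'.a .hd) (k + 1) (I.hd k) →
        s''.a .wt = Function.update (s'.a .wt) (k + 1) (I.wt k) →
        s''.a .cx = Function.update (s'.a .cx) (k + 1) k →
        (∀ x ∈ ([.em, .e, .cur, .cnt, .rc] : List Vr), s''.v x = s'.v x) →
        (∀ x ∈ ([.key, .lev, .hh, .ub, .hr] : List Ar), s''.a x = s'.a x) →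
        s''.o = s'.o → Base I (k + 1) s'' := by
      intro s'' e1 e2 e3 e4 e5 e6 e7 e8 e9 e10 e11 e12 e13
      have up : ∀ (f g : ℕ → ℕ), (∀ e < k, f (e + 1) = g e) → ∀ e < k + 1,
          Function.update f (k + 1) (g k) (e + 1) = g e := by
        intro f g h e he
        rcases (show e = k ∨ e < k by omega) with rfl | he
        · rw [Function.update_self]
        · rw [Function.update_of_ne (by omega)]; exact h e he
      refine ⟨by rw [e1, B.vn], by rw [e2, B.vm], by rw [e3, B.vs], ?_, ?_, ?_, ?_, ?_, ?_, ?_, ?_,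
        by rw [e13]; exact B.zo⟩
      · rw [e4, B.vmx, Finset.range_add_one, Finset.sup_insert, max_comm]
      · intro i hi
        rw [e5]
        rcases (show i = k ∨ i < k by omega) with rfl | hi
        · rw [Function.update_self]
        · rw [Function.update_of_ne (by omega)]; exact B.row i hi
      · intro u hu
        rw [e6, e7, I.outE_succ]
        have old : Adj (Function.update (s'.a .an) (k + 1) (s'.a .ah (I.tl k))) (s'.a .ah u)
            (I.outE k u) := (B.adj u hu).congr fun e he =>
          Function.update_of_ne (by have := (I.mem_outE.1 he).1; omega) _ _
        split_ifs with h
        · subst h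
          rw [Function.update_self]
          refine .cons ?_
          rw [Function.update_self]
          exact old
        · rw [Function.update_of_ne (Ne.symm h)]; exact old
      · rw [e8]; exact up _ _ B.hd
      · rw [e9]; exact up _ _ B.wt
      · rw [e10]; exact up _ id B.cx
      · intro x hx; rw [e11 x hx]; exact B.zv x hx
      · intro x hx; rw [e12 x hx]; exact B.za x hx
    simp only [wp_seq, wp_asg, wp_put, wp_ite, wp_skip, Cd.ok, Cd.ev, Ex.ok, Ex.ev, true_and,
      St.simps, reduceCtorEq, if_false, if_true, vi, vr, vp, hE.tl k hc, hE.hd k hc, hE.wt k hc, hO,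
      B.vn]
    refine ⟨by omega, by omega, by omega, by omega, by omega, by omega, fun hx => ?_, fun hx => ?_⟩
    · refine ⟨_, ⟨k + 1, hc, inv _ ?_ ?_ ?_ ?_ ?_ ?_ ?_ ?_ ?_ ?_ ?_ ?_ ?_, ?_, ?_, ?_, rfl⟩, ?_⟩
      all_goals try simp [St.simps]
      · omega
      · ring
      · omega
      · omega
    · refine ⟨_, ⟨k + 1, hc, inv _ ?_ ?_ ?_ ?_ ?_ ?_ ?_ ?_ ?_ ?_ ?_ ?_ ?_, ?_, ?_, ?_, rfl⟩, ?_⟩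
      all_goals try simp [St.simps]
      · omega
      · ring
      · omega
      · omega
  all_goals try simp [St.simps, hz, ha, ho]
  · simp [Inst.outE]
    exact fun _ _ => .nil
  · intro t p s' hk B vr vp hp hc ht
    simp only [Cd.ev, Ex.ev, B.vm] at hc
    have hk' : s'.v .i = I.m := by omega
    rw [hk'] at B
    exact ⟨B, by omega⟩

/-- Doubling `m` until it reaches `mx` finds the least `K` with `mx ≤ m * 2 ^ (K - 2)`; minimality
is `hK`. The predecessors of the levels are tabulated on the way up and then used to tabulate the
powers of two on the way down. -/
theorem levels_spec {I : Inst} {E : Env} {s : St}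
    (hW : 4 * I.HB + I.m + 100 ≤ E.W) (h : Base I I.m s)
    (hmx : I.mx = (Finset.range I.m).sup I.wt) (hK : ∀ k, k + 2 < I.K → I.m * 2 ^ k < I.mx) :
    wp E levelsC (fun t s' => Base I I.m s' ∧ s'.v .kk = I.K ∧ s'.v .qq = I.Q ∧ s'.v .j = 1 ∧
      (∀ i, 2 ≤ i → i ≤ I.K → s'.a .pw i = 2 ^ (I.K - i)) ∧
      (∀ j, 2 ≤ j → j ≤ I.K → s'.a .dec j = j - 1) ∧ t ≤ 9 * I.K + 10) s := by
  have hHB : I.HB = I.K + 2 + I.EM + 3 * I.Q + I.mx := rfl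
  have hK2 := I.K2
  have hQ : I.Q = 2 ^ (I.K - 2) := rfl
  have vmx : s.v .mx = I.mx := by rw [h.vmx, hmx]
  have hp2 : ∀ a b, a ≤ b → 2 ^ a ≤ 2 ^ b := fun a b h => Nat.pow_le_pow_right (by omega) h
  simp only [levelsC, wp_seq, wp_asg, wp_put, Ex.ok, Ex.ev, true_and, h.vm]
  refine ⟨by omega, by omega, by omega, by omega, wp_loop
    (J := fun p s' => ∃ k, 2 ≤ k ∧ k ≤ I.K ∧ Keep [.pp, .qq, .kk] [.dec] s s' ∧ s'.o = s.o ∧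
      s'.v .pp = I.m * 2 ^ (k - 2) ∧ s'.v .qq = 2 ^ (k - 2) ∧ s'.v .kk = k ∧
      (∀ j, 2 ≤ j → j ≤ k → s'.a .dec j = j - 1) ∧ p = 5 * (I.K - k)) ?_ ?_
      (p := 5 * (I.K - 2)) ⟨2, le_rfl, hK2, ?_, ?_, ?_, ?_, ?_, ?_, rfl⟩ ?_⟩
  · rintro p s' -
    simp [Cd.ok, Ex.ok]
  · rintro p s' ⟨k, k2, kK, kp, ho, vpp, vqq, vkk, hdec, rfl⟩ hc
    simp only [Cd.ev, Ex.ev, vpp, kp.v .mx (by decide), vmx] at hc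
    have hlt : k < I.K := by
      rcases kK.lt_or_eq with h | rfl
      · exact h
      · have := I.mx_le; omega
    have := hp2 (k - 2) (I.K - 2) (by omega)
    have e : k + 1 - 2 = k - 2 + 1 := by omega
    simp only [wp_seq, wp_asg, wp_put, Ex.ok, Ex.ev, true_and, St.simps, reduceCtorEq,
      if_false, if_true, vpp, vqq, vkk]
    refine ⟨by omega, by omega, by omega, by omega, _, ⟨k + 1, by omega, hlt,
      ((((kp.setV _ ?_).setV _ ?_).setA _ _ ?_).setV _ ?_), ho, ?_, ?_, rfl, ?_, rfl⟩, by omega⟩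
    · simp
    · simp
    · simp
    · simp
    · rw [e, pow_succ]; ring
    · rw [e, pow_succ]; ring
    · intro j hj hjk
      rcases (show j = k + 1 ∨ j ≤ k by omega) with rfl | hjk
      · rw [Function.update_self]; omega
      · rw [Function.update_of_ne (by omega)]; exact hdec j hj hjk
  · exact ((((Keep.refl _ _ _).setV _ (by simp)).setV _ (by simp)).setV _ (by simp)).setA _ _
      (by simp)
  · simp [St.simps]
  · simp [St.simps]
  · simp [St.simps]
  · simp [St.simps]
  · intro j hj hj'
    obtain rfl : j = 2 := by omega
    simp [St.simps]
  · rintro t p s' ⟨k, k2, kK, kp, ho, vpp, vqq, vkk, hdec, rfl⟩ hc ht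
    simp only [Cd.ev, Ex.ev, vpp, kp.v .mx (by decide), vmx] at hc
    obtain rfl : k = I.K := by
      rcases kK.lt_or_eq with h' | h'
      · have := hK (k - 2) (by omega); omega
      · exact h'
    refine ⟨by omega, wp_loop
      (J := fun p s'' => ∃ j, 1 ≤ j ∧ j ≤ I.K ∧ Keep [.j, .t] [.pw] s' s'' ∧ s''.o = s'.o ∧
        s''.v .j = j ∧ s''.v .t = 2 ^ (I.K - j) ∧
        (∀ i, j < i → i ≤ I.K → s''.a .pw i = 2 ^ (I.K - i)) ∧ p = 4 * (j - 1)) ?_ ?_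
        (p := 4 * (I.K - 1)) ⟨I.K, by omega, le_rfl, ?_, ?_, ?_, ?_, ?_, rfl⟩ ?_⟩
    · rintro p s' -
      simp [Cd.ok, Ex.ok]; omega
    · rintro p s'' ⟨j, j1, jK, jp, jo, vj, vt, hpw, rfl⟩ hc
      simp only [Cd.ev, Ex.ev, vj] at hc
      have := hp2 (I.K - j) (I.K - 2) (by omega)
      simp only [wp_seq, wp_asg, wp_put, Ex.ok, Ex.ev, true_and, St.simps, reduceCtorEq,
        if_false, if_true, vj, vt, jp.a .dec (by decide), hdec j hc jK]
      refine ⟨by omega, _, ⟨j - 1, by omega, by omega,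
        (((jp.setA _ _ ?_).setV _ ?_).setV _ ?_), jo, rfl, ?_, ?_, rfl⟩, by omega⟩
      · simp
      · simp
      · simp
      · rw [show I.K - (j - 1) = I.K - j + 1 by omega, pow_succ]; ring
      · intro i hi hiK
        rcases (show i = j ∨ j < i by omega) with rfl | hij
        · rw [Function.update_self]
        · rw [Function.update_of_ne (by omega)]; exact hpw i hij hiK
    · exact ((Keep.refl _ _ _).setV _ (by simp)).setV _ (by simp)
    · simp [St.simps]
    · simp [St.simps, vkk]
    · simp [St.simps]
    · intro i hi hiK; omega
    · rintro t' p s'' ⟨j, j1, jK, jp, jo, vj, vt, hpw, rfl⟩ hc ht'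
      simp only [Cd.ev, Ex.ev, vj] at hc
      have B1 := h.keep kp ho (by decide) (by decide)
      have B2 := B1.keep jp jo (by decide) (by decide)
      refine ⟨B2, by rw [jp.v .kk (by decide), vkk], by rw [jp.v .qq (by decide), vqq, hQ],
        by omega, fun i hi hiK => hpw i (by omega) hiK, ?_, by omega⟩
      rw [jp.a .dec (by decide)]
      exact hdec

/-- Rounding by repeated addition takes at most `M` rounds. With `M = m` for each of the `m` edges
this stays within the quadratic bound. -/
theorem round_spec {E : Env} {s : St} {w Q M : ℕ} (hQ : 0 < Q) (hw : s.a .wt (s.v .q) = w)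
    (hq : s.v .qq = Q) (hM : w ≤ M * Q) (ht : s.v .t = 0) (hW : w + Q + 1 ≤ E.W) :
    wp E (.loop (.lt (.add (.v .t) (.v .qq)) (.add (.get .wt (.v .q)) (.c 1)))
        (.asg .t (.add (.v .t) (.v .qq)))) (fun t s' => ∃ k, s' = s.setV .t k ∧ Q ∣ k ∧ k ≤ w ∧
        w < k + Q ∧ t ≤ 2 * M + 1) s := by
  refine wp_loop (J := fun p s' => ∃ k, s' = s.setV .t k ∧ Q ∣ k ∧ k ≤ w ∧ p = 2 * ((w - k) / Q))
    ?_ ?_ (p := 2 * (w / Q)) ⟨0, by rw [← ht]; exact (s.setV_self _).symm, dvd_zero _,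
      Nat.zero_le _, rfl⟩ ?_
  · rintro p _ ⟨k, rfl, -, hk, -⟩
    simp [Cd.ok, Ex.ok, Ex.ev, St.simps, hq, hw]
    omega
  · rintro p _ ⟨k, rfl, hd, hk, rfl⟩ hc
    simp only [Cd.ev, Ex.ev, St.simps, reduceCtorEq, if_false, if_true, hq, hw] at hc
    simp only [wp_asg, Ex.ok, Ex.ev, St.simps, reduceCtorEq, if_false, if_true, hq,
      St.setV_setV]
    refine ⟨⟨trivial, trivial, by omega⟩, _, ⟨k + Q, rfl, dvd_add hd dvd_rfl, by omega, rfl⟩, ?_⟩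
    have : (w - (k + Q)) / Q + 1 = (w - k) / Q := by
      rw [← Nat.add_div_right _ hQ]
      congr 1
      omega
    omega
  · rintro t p _ ⟨k, rfl, hd, hk, rfl⟩ hc ht
    simp only [Cd.ev, Ex.ev, St.simps, reduceCtorEq, if_false, if_true, hq, hw] at hc
    have : w / Q ≤ M := Nat.div_le_of_le_mul (by rw [Nat.mul_comm]; exact hM)
    exact ⟨k, rfl, hd, hk, by omega, by omega⟩

/-- The potential at the start of the main loop. -/
def Inst.pot₀ (I : Inst) : ℕ :=
  17 * I.m + I.X.card * (30 * I.K + 20) + 50 * I.potS ∅ + 4 + 10 * I.potE 0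

/-- The sources of all copies enter level `1` of the bucket `[0, Q)`, with key `0` from the initial
memory. All bounds except `ub 1` are still `0`, which is consistent because no item has a level
above `1`. -/
theorem start_spec {I : Inst} {E : Env} {s : St} {CM : ℕ} (hE : Fit I E CM) (hCM : I.m ≤ CM)
    (h : Base I I.m s)
    (hmx : I.mx = (Finset.range I.m).sup I.wt) (hkk : s.v .kk = I.K) (hqq : s.v .qq = I.Q)
    (hj : s.v .j = 1) (hpw : ∀ i, 2 ≤ i → i ≤ I.K → s.a .pw i = 2 ^ (I.K - i))
    (hdec : ∀ j, 2 ≤ j → j ≤ I.K → s.a .dec j = j - 1) :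
    wp E startC (fun t s' => ∃ lst, LInv I E lst ∅ (fun _ => []) (fun _ => 0) (s'.v .j) [] 0 0 [] s' ∧
      I.potSt lst ∅ s' ≤ I.pot₀ ∧ t ≤ I.m * (2 * I.m + 13) + 3) s := by
  have hW := hE.W
  have hHB : I.HB = I.K + 2 + I.EM + 3 * I.Q + I.mx := rfl
  have hEM : I.EM = I.m * I.mx := rfl
  have hK2 := I.K2
  have hQ : 0 < I.Q := by unfold Inst.Q; positivity
  have vmx : s.v .mx = I.mx := by rw [h.vmx, hmx]
  simp only [startC, wp_seq, wp_asg, wp_put, Ex.ok, Ex.ev]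
  refine ⟨by omega, wp_loop (J := fun p s' => ∃ k ≤ I.m, ∃ l : List ℕ,
      Keep [.i, .q, .t, .em, .cnt] [.wh, .lev, .nx, .ci, .cv, .hh] s s' ∧ s'.o = s.o ∧
      s'.v .i = k ∧ s'.v .em = k * I.mx ∧ s'.v .cnt = k ∧
      (∀ e < k, I.Q ∣ s'.a .wh (e + 1) ∧ s'.a .wh (e + 1) ≤ I.wt e ∧
        I.wt e < s'.a .wh (e + 1) + I.Q) ∧
      (∀ x, s'.a .lev x ≤ 1 ∧ (s'.a .lev x ≠ 0 → ∃ i < k, x = I.node i I.s)) ∧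
      (∀ i < k, s'.a .lev (I.node i I.s) = 1 ∧ I.node i I.s ∈ l) ∧
      (∀ x ∈ l, s'.a .lev x = 1) ∧ l.length = k ∧
      ChAll I (s'.a .nx) (s'.a .ci) (s'.a .cv) (s'.a .hh) (s'.v .cnt)
        (Function.update (fun _ => []) 1 l) ∧ p = (2 * I.m + 13) * (I.m - k))
      ?_ ?_ (p := (2 * I.m + 13) * (I.m - 0)) ⟨0, Nat.zero_le _, [], 
        (Keep.refl _ _ _).setV _ (by simp), rfl, ?_, ?_, ?_, by omega, ?_, by omega, by simp, rfl,
        ?_, rfl⟩ ?_⟩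
  · rintro p s' -
    simp [Cd.ok, Ex.ok]
  · rintro p s' ⟨k, hk, l, K, ho, vi, vem, vcnt, hwh, hlev, hsrc, hl, hlen, hch, rfl⟩ hc
    simp only [Cd.ev, Ex.ev, vi, K.v .m (by decide), h.vm] at hc
    have hmul : k * I.mx + I.mx ≤ I.m * I.mx := by
      calc k * I.mx + I.mx = (k + 1) * I.mx := by ring
        _ ≤ I.m * I.mx := Nat.mul_le_mul_right _ hc
    have hwt := I.wt_le k hc
    have hn := Inst.node_lt hc I.s_lt
    have hnode : k * I.n + I.s = I.node k I.s := rfl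
    have hpq := hch.push hc I.s_lt 1
    simp only [wp_seq, wp_asg, wp_put, Ex.ok, Ex.ev, true_and, vi]
    refine ⟨by omega, by omega, (round_spec (w := I.wt k) (Q := I.Q) (M := I.m) hQ ?_ ?_ ?_ ?_ ?_).mono
      ?_⟩
    · simp [St.simps, K.a .wt (by decide), h.wt k hc]
    · simp [St.simps, K.v .qq (by decide), hqq]
    · exact hwt.trans I.mx_le
    · simp [St.simps]
    · omega
    rintro t _ ⟨w, rfl, w1, w2, w3, ht⟩
    simp only [pushC, wp_seq, wp_asg, wp_put, Ex.ok, Ex.ev, true_and, St.simps, reduceCtorEq,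
      if_false, if_true, vi, vem, vcnt, K.v .mx (by decide), vmx, K.a .row (by decide),
      h.row k hc, K.v .s (by decide), h.vs, hnode]
    rw [vcnt] at hpq
    have hmem : ∀ i < k + 1, i = k ∨ i < k := fun i hi => by omega
    refine ⟨by omega, by omega, by omega, by omega, by omega, by omega, _, ⟨k + 1, hc,
      I.node k I.s :: l, ?_, ho, rfl, by ring, rfl, ?_, ?_, ?_, ?_, by rw [List.length_cons, hlen],
      ?_, rfl⟩, ?_⟩
    · exact (((((((((((K.setV _ (by simp)).setV _ (by simp)).setV _ (by simp)).setA _ _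
        (by simp)).setV _ (by simp)).setA _ _ (by simp)).setV _ (by simp)).setA _ _
        (by simp)).setA _ _ (by simp)).setA _ _ (by simp)).setA _ _ (by simp)).setV _ (by simp)
    · intro e he
      rcases hmem e he with rfl | he
      · rw [Function.update_self]; exact ⟨w1, w2, w3⟩
      · rw [Function.update_of_ne (by omega)]; exact hwh e he
    · intro x
      rcases eq_or_ne x (I.node k I.s) with rfl | hx
      · rw [Function.update_self]
        exact ⟨le_rfl, fun _ => ⟨k, by omega, rfl⟩⟩
      · rw [Function.update_of_ne hx]
        refine ⟨(hlev x).1, fun h' => ?_⟩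
        obtain ⟨i, hi, hxi⟩ := (hlev x).2 h'
        exact ⟨i, by omega, hxi⟩
    · intro i hi
      rcases eq_or_ne (I.node i I.s) (I.node k I.s) with hx | hx
      · rw [hx, Function.update_self]; exact ⟨rfl, List.mem_cons_self⟩
      · rw [Function.update_of_ne hx]
        rcases hmem i hi with rfl | hi
        · exact absurd rfl hx
        · exact ⟨(hsrc i hi).1, List.mem_cons_of_mem _ (hsrc i hi).2⟩
    · intro x hx
      rcases eq_or_ne x (I.node k I.s) with rfl | hxk
      · rw [Function.update_self]
      · rw [Function.update_of_ne hxk]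
        exact hl x ((List.mem_cons.1 hx).resolve_left hxk)
    · simpa using hpq
    · have : I.m - k = I.m - (k + 1) + 1 := by omega
      rw [this, Nat.mul_add]
      omega
  · simp [St.simps]
  · simp [St.simps, h.zv]
  · simp [St.simps, h.zv]
  · intro x
    simp [St.simps, h.za]
  · intro k
    have : Function.update (fun _ => ([] : List ℕ)) 1 [] = fun _ => [] := Function.update_eq_self _ _
    simp only [St.simps, h.za .hh (by simp), this]
    exact ⟨.nil, Nat.zero_le _⟩
  · rintro t p s' ⟨k, hk, l, K, ho, vi, vem, vcnt, hwh, hlev, hsrc, hl, hlen, hch, rfl⟩ hc ht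
    simp only [Cd.ev, Ex.ev, vi, K.v .m (by decide), h.vm] at hc
    obtain rfl : k = I.m := by omega
    have hze : s'.v .e = 0 := (K.v .e (by decide)).trans (h.zv _ (by simp))
    have hzc : s'.v .cur = 0 := (K.v .cur (by decide)).trans (h.zv _ (by simp))
    have hzr : s'.v .rc = 0 := (K.v .rc (by decide)).trans (h.zv _ (by simp))
    have hzk : ∀ x, s'.a .key x = 0 := by rw [K.a .key (by decide)]; exact h.za _ (by simp)
    have hzu : ∀ x, s'.a .ub x = 0 := by rw [K.a .ub (by decide)]; exact h.za _ (by simp)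
    have hzh : ∀ x, s'.a .hr x = 0 := by rw [K.a .hr (by decide)]; exact h.za _ (by simp)
    have vqq : s'.v .qq = I.Q := (K.v .qq (by decide)).trans hqq
    have vkk : s'.v .kk = I.K := (K.v .kk (by decide)).trans hkk
    have vj : s'.v .j = 1 := (K.v .j (by decide)).trans hj
    have hu : ∀ i, 2 ≤ i → Function.update (s'.a .ub) 1 I.Q i = 0 := fun i hi => by
      rw [Function.update_of_ne (by omega), hzu]
    have hlu : ∀ i, i ≠ 1 → Function.update (fun _ => ([] : List ℕ)) 1 l i = [] := fun i hi => by
      rw [Function.update_of_ne hi]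
    refine ⟨by omega, trivial, Function.update (fun _ => []) 1 l, ⟨?_, ?_, ?_, ?_, hch, ?_, ?_, ?_⟩, ?_, ?_⟩
    all_goals try simp only [St.simps, reduceCtorEq, if_false, if_true, vqq, vkk, vem, hze, hzc, vj, hzr]
    · refine ⟨rfl, rfl, rfl, ?_, ?_, ?_, ?_, ?_, ?_, hwh, ?_⟩
      · rw [K.a .row (by decide)]; exact h.row
      · rw [K.a .pw (by decide)]; exact hpw
      · rw [K.a .dec (by decide)]; exact hdec
      · rw [K.a .an (by decide), K.a .ah (by decide)]; exact h.adj
      · rw [K.a .hd (by decide)]; exact h.hd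
      · rw [K.a .wt (by decide)]; exact h.wt
      · rw [K.a .cx (by decide)]; exact h.cx
    · exact {
        K2 := hK2
        hQ := rfl
        j1 := le_rfl
        jK := by omega
        eQ := dvd_zero _
        levK := fun x => (hlev x).1.trans (by omega)
        Sk := by simp
        Uc := fun _ _ _ => Nat.zero_le _
        emp := fun i hi _ => hlu i (by omega)
        fin := by rw [hlu _ (by omega)]; simp
        nd := by rw [hlu _ (by omega)]; simp
        cov2 := fun x _ h2 => by have := (hlev x).1; omega
        up := fun x i _ h2 h3 => by have := (hlev x).1; omega
        low := fun x _ h2 => by have := (hlev x).1; omega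
        cov1 := fun x _ h1 _ => by
          obtain ⟨i, hi, rfl⟩ := (hlev x).2 (by omega)
          left
          rw [Function.update_self]
          exact ⟨(hsrc i hi).2, Nat.zero_le _⟩
        ent := fun i x h1 _ hx => by
          rcases (show i = 1 ∨ i ≠ 1 by omega) with rfl | hi
          · rw [Function.update_self] at hx
            exact (hl x hx).ge
          · rw [hlu i hi] at hx; simp at hx
        ent1 := fun x _ => by rw [hzk]; omega
        entT := fun e' x hx => by rw [hlu _ (by omega)] at hx; simp at hx
        ex := by simp
        ubw := fun i hi _ => by rw [hu i hi]; exact Nat.zero_le _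
        ub1 := by rw [Function.update_self]; omega
        ph := fun h => by omega
        ubK := by rw [hu _ hK2]; omega
        ub0 := hu _ (by omega) }
    · refine ⟨fun i hi => ⟨by rw [(hsrc i hi).1]; omega, hzk _⟩, by simp, fun x hx => ?_⟩
      obtain ⟨i, hi, rfl⟩ := (hlev x).2 hx
      exact ⟨i, hi, I.s, rfl, by rw [hzk]; exact .src⟩
    · refine ⟨by simp, by simp, by simp, by simp, by simp, by simp, fun i hi v hv hvs hx => ?_,
        by simp⟩
      obtain ⟨i', hi', hn⟩ := (hlev _).2 hx
      exact absurd (I.node_inj hv I.s_lt hn).2 hvs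
    · intro v hv
      refine ⟨trivial, hzh v, ?_⟩
      rw [ho]
      exact h.zo v
    · simp
    · exact Nat.zero_le _
    · simp only [Inst.potSt, Inst.pot, Inst.pot₀, St.simps, reduceCtorEq, if_false, hze, vj, vcnt]
      have P1 := Inst.potL_update (I := I) (k := 1) (by omega) (fun _ => []) l
      have P2 : I.potL (fun _ => []) = 0 := by simp [Inst.potL]
      have P3 : I.potV (s'.a .lev) ≤ I.X.card * (30 * I.K + 20) := by
        unfold Inst.potV
        rw [← smul_eq_mul]
        refine Finset.sum_le_card_nsmul _ _ _ fun x _ => ?_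
        unfold Inst.LV
        split_ifs <;> omega
      simp only [P2, List.length_nil, hlen] at P1
      omega
    · rw [Nat.sub_zero, Nat.mul_comm] at ht
      have : (2 * I.m + 13) * (I.m - I.m) = 0 := by simp
      rw [Nat.mul_comm]
      rw [Nat.mul_comm] at ht
      omega

/-- The result of the computation: all distances, and a list of records for each vertex. -/
structure Solved (I : Inst) (E : Env) (recs : ℕ → List ℕ) (ρ : ℕ → ℕ) (s : St) : Prop where
  own : ∀ v < I.n, ∀ a ∈ recs v, 1 ≤ a
  rf_lt : ∀ v < I.n, ∀ a ∈ recs v, s.a .rf a < I.m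
  reach : ∀ v < I.n, ∀ a ∈ recs v, I.Reach (s.a .rf a) v (s.a .rd a)
  least : ∀ v < I.n, ∀ a ∈ recs v, ∀ d ≤ I.EM, I.Reach (s.a .rf a) v d → s.a .rd a ≤ d
  cov : ∀ i < I.m, ∀ v < I.n, ∀ d ≤ I.EM, I.Reach i v d →
    ∃ a ∈ recs v, s.a .rd a ≤ d ∧ I.cp i ≤ I.cp (s.a .rf a)
  prd : ∀ v < I.n, v ≠ I.s → ∀ a ∈ recs v, ∃ e < I.m, ∃ b ∈ recs (I.tl e), I.hd e = v ∧
    I.cp (s.a .rf a) ≤ I.cp e ∧ s.a .rp a = I.tl e ∧ s.a .rr a = E.B + 32 * b ∧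
    s.a .rd a = s.a .rd b + I.wt e ∧ (I.cp (s.a .rf a) < I.cp (s.a .rf b) ∨
      I.cp (s.a .rf a) = I.cp (s.a .rf b) ∧ ρ b < ρ a)
  pw : ∀ v < I.n, (recs v).Pairwise fun a b =>
    s.a .rd b < s.a .rd a ∧ I.cp (s.a .rf b) < I.cp (s.a .rf a)
  rch : ∀ v < I.n, RCh E.B (s.a .rn) (recs v) ∧ s.o v = adrOf E.B ((recs v).headD 0)
  rcc : ∀ v < I.n, ∀ a ∈ recs v, s.rc a = I.cp (s.a .rf a)

/-- Unsettled keys are at least `e`, which exceeds `EM`. So every walk of cost at most `EM` ends at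
a settled node whose key is at most that cost, and the invariants of the records give the rest. -/
theorem LInv.solved {I : Inst} {E : Env} {lst : ℕ → List ℕ} {S : Finset ℕ} {recs : ℕ → List ℕ}
    {ρ : ℕ → ℕ} {jj r x₀ : ℕ} {s : St} (h : LInv I E lst S recs ρ jj [] r x₀ [] s)
    (he : I.EM < s.v .e) : Solved I E recs ρ s := by
  have low : ∀ i < I.m, ∀ v d, d ≤ I.EM → I.Reach i v d →
      I.node i v ∈ S ∧ s.a .key (I.node i v) ≤ d := fun i hi v d hd hr =>
    (h.di.lower (fun x hx hl => h.qi.e_le hx hl) hi hr).resolve_right (by omega)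
  refine ⟨fun v hv a ha => (h.ri.own v hv a ha).1, fun v hv a ha => (h.ri.good v hv a ha).1, ?_, ?_,
    ?_, h.ri.prd, h.ri.pw, fun v hv => ⟨(h.rch v hv).1, (h.rch v hv).2.2⟩, h.rcc⟩
  · intro v hv a ha
    obtain ⟨h1, h2, h3⟩ := h.ri.good v hv a ha
    rw [← h3]
    refine (h.di.snd_node hv ?_).2
    rw [(h.qi.Sk _ h2).1]
    have := I.K2
    omega
  · intro v hv a ha d hd hr
    obtain ⟨h1, h2, h3⟩ := h.ri.good v hv a ha
    rw [← h3]
    exact (low _ h1 v d hd hr).2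
  · intro i hi v hv d hd hr
    obtain ⟨h1, h2⟩ := low i hi v d hd hr
    obtain ⟨a, ha, h3, h4⟩ := h.ri.cov i hi v hv h1
    exact ⟨a, ha, by omega, h4⟩

theorem solver_spec {I : Inst} {E : Env} {s : St} (hG : Given I E) (hcp : E.cp = I.cp)
    (hmx : I.mx = (Finset.range I.m).sup I.wt) (hK : ∀ k, k + 2 < I.K → I.m * 2 ^ k < I.mx)
    (hW : E.B + 32 * (I.m * I.n + 2) + 4 * I.HB + 4 * I.pot₀ + I.m + I.n + 100 ≤ E.W)
    (hz : ∀ x, s.v x = 0) (ha : ∀ k i, s.a k i = 0) (ho : ∀ i, s.o i = 0) :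
    wp E solverC (fun t s' => ∃ recs ρ, Solved I E recs ρ s' ∧
      t ≤ 2 * (I.m * I.m) + 28 * I.m + 9 * I.K + I.pot₀ + 19) s := by
  have hE : Fit I E I.pot₀ := ⟨hG.n, hG.m, hcp, hW⟩
  have hB : E.B = 3 + (I.m + I.m + I.m) + I.n := by rw [Env.B, Env.O, hG.n, hG.m]
  have h0 : I.m ≤ I.pot₀ := by unfold Inst.pot₀; omega
  simp only [solverC, wp_seq]
  refine (read_spec hG (by omega) hz ha ho).mono ?_
  rintro t₁ s₁ ⟨B₁, h₁⟩
  refine (levels_spec (by omega) B₁ hmx hK).mono ?_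
  rintro t₂ s₂ ⟨B₂, a1, a2, a3, a4, a5, h₂⟩
  refine (start_spec hE h0 B₂ hmx a1 a2 a3 a4 a5).mono ?_
  rintro t₃ s₃ ⟨lst, L, hp, h₃⟩
  refine (main_spec hE L hp).mono ?_
  rintro t₄ s₄ ⟨lst', S, recs, ρ, r, x₀, L', he, h₄⟩
  refine ⟨recs, ρ, L'.solved he, ?_⟩
  have : I.m * (2 * I.m + 13) = 2 * (I.m * I.m) + 13 * I.m := by ring
  omega

/-! ### Bounds -/

namespace Inst

variable {I : Inst}

theorem card_X_le : I.X.card ≤ I.m * I.vs.card := by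
  refine Finset.card_image_le.trans ?_
  rw [show (Finset.product (Finset.range I.m) I.vs).card = _ from Finset.card_product _ _,
    Finset.card_range]

/-- A vertex that is reached is the source or the head of an edge. This keeps `n` out of the part of
the bound without logarithm. -/
theorem card_vs_le : I.vs.card ≤ I.m + 1 :=
  (Finset.card_insert_le _ _).trans
    (Nat.add_le_add_right (Finset.card_image_le.trans (Finset.card_range _).le) 1)

theorem card_vs_le_n : I.vs.card ≤ I.n := by
  have : I.vs ⊆ Finset.range I.n := fun v hv => Finset.mem_range.2 (vs_lt hv)
  exact (Finset.card_le_card this).trans (Finset.card_range _).le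

theorem sum_outE_le : ∑ v ∈ I.vs, (I.outE I.m v).length ≤ I.m := by
  have h : ∀ v, (I.outE I.m v).length = ((Finset.range I.m).filter (I.tl · = v)).card := fun v => by
    rw [outE, List.length_reverse, ← List.toFinset_card_of_nodup (List.nodup_range.filter _)]
    congr 1
    ext e
    simp
  simp only [h]
  rw [← Finset.card_biUnion]
  · refine (Finset.card_le_card ?_).trans (Finset.card_range I.m).le
    intro e he
    obtain ⟨v, -, h⟩ := Finset.mem_biUnion.1 he
    exact (Finset.mem_filter.1 h).1
  · intro v _ w _ hvw
    rw [Function.onFun, Finset.disjoint_left]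
    intro e h1 h2
    exact hvw ((Finset.mem_filter.1 h1).2.symm.trans (Finset.mem_filter.1 h2).2)

/-- In each of the `m` copies the out-degrees sum to at most `m`. -/
theorem potS_empty_le : I.potS ∅ ≤ I.m * (I.m + I.vs.card) := by
  unfold potS
  rw [Finset.sdiff_empty, X, Finset.sum_image]
  · rw [show Finset.product (Finset.range I.m) I.vs = Finset.range I.m ×ˢ I.vs from rfl,
      Finset.sum_product]
    calc _ = ∑ i ∈ Finset.range I.m, ∑ v ∈ I.vs, ((I.outE I.m v).length + 1) :=
          Finset.sum_congr rfl fun i _ => Finset.sum_congr rfl fun v hv => by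
            rw [dg_node (vs_lt hv)]
      _ ≤ ∑ i ∈ Finset.range I.m, (I.m + I.vs.card) := Finset.sum_le_sum fun i _ => by
          rw [Finset.sum_add_distrib, Finset.sum_const, smul_eq_mul, Nat.mul_one]
          exact Nat.add_le_add_right sum_outE_le _
      _ = _ := by rw [Finset.sum_const, Finset.card_range, smul_eq_mul]
  · rintro ⟨i, v⟩ h ⟨i', v'⟩ h' e
    obtain ⟨-, h⟩ := Finset.mem_product.1 h
    obtain ⟨-, h'⟩ := Finset.mem_product.1 h'
    obtain ⟨rfl, rfl⟩ := I.node_inj (vs_lt h) (vs_lt h') e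
    rfl

/-- The range of length `m * mx ≤ m * m * Q` is cut into pieces of length `Q`. -/
theorem potE_zero_le : I.potE 0 ≤ I.m * I.m + 1 := by
  have hQ : 0 < I.Q := by unfold Q; positivity
  unfold potE
  refine Nat.div_le_of_le_mul ?_
  have : I.m * I.mx ≤ I.m * (I.m * I.Q) := Nat.mul_le_mul_left _ I.mx_le
  unfold EM
  calc I.m * I.mx + I.Q - 0 ≤ I.m * (I.m * I.Q) + I.Q := by omega
    _ = I.Q * (I.m * I.m + 1) := by ring

/-- A bound on the number of steps of the program. -/
theorem total_le : 2 * (I.m * I.m) + 28 * I.m + 9 * I.K + I.pot₀ + 19 ≤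
    367 * (I.m * I.m) + 9 * (I.K - 2) + 30 * (I.X.card * (I.K - 2)) + 51 := by
  have h1 : I.X.card ≤ I.m * I.m + I.m :=
    I.card_X_le.trans (by rw [← Nat.mul_succ]; exact Nat.mul_le_mul_left _ I.card_vs_le)
  have h2 : I.potS ∅ ≤ I.m * I.m + (I.m * I.m + I.m) := I.potS_empty_le.trans (by
    rw [Nat.mul_add, ← Nat.mul_succ]
    exact Nat.add_le_add_left (Nat.mul_le_mul_left _ I.card_vs_le) _)
  have h3 := I.potE_zero_le
  have h4 : I.m ≤ I.m * I.m := Nat.le_mul_self _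
  have hK2 := I.K2
  have h5 : I.X.card * (30 * I.K + 20) = 30 * (I.X.card * (I.K - 2)) + 80 * I.X.card := by
    obtain ⟨k, hk⟩ := Nat.exists_eq_add_of_le hK2
    rw [hk, Nat.add_sub_cancel_left]
    ring
  unfold pot₀
  omega

/-- For `k = K - 2 > 0`, minimality of `K` gives `m * 2 ^ (k - 1) < mx ≤ c`, so that `k - 1` is at
most the binary logarithm of `c / m`. In the product of `k` with the number of nodes, the bound `m *
(m + 1)` is used for the constant part of `k` and `m * n` for its logarithmic part. -/
theorem total_le_real {c : ℕ} (hc : I.mx ≤ c) (hK : ∀ k, k + 2 < I.K → I.m * 2 ^ k < I.mx) :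
    ((2 * (I.m * I.m) + 28 * I.m + 9 * I.K + I.pot₀ + 19 : ℕ) : ℝ) ≤
      500 * ((I.m : ℝ) ^ 2 + I.m * I.n * Real.posLog ((c : ℝ) / I.m) + 1) := by
  set Lg := Real.posLog ((c : ℝ) / I.m)
  have hL : 0 ≤ Lg := Real.posLog_nonneg
  obtain ⟨k, hk⟩ := Nat.exists_eq_add_of_le I.K2
  have hkk : I.K - 2 = k := by omega
  have hm0 : (0 : ℝ) ≤ I.m := Nat.cast_nonneg _
  have hn0 : (0 : ℝ) ≤ I.n := Nat.cast_nonneg _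
  have hX1 : (I.X.card : ℝ) ≤ I.m ^ 2 + I.m := by
    have : I.X.card ≤ I.m * (I.m + 1) := I.card_X_le.trans (Nat.mul_le_mul_left _ I.card_vs_le)
    calc (I.X.card : ℝ) ≤ ((I.m * (I.m + 1) : ℕ) : ℝ) := by exact_mod_cast this
      _ = _ := by push_cast; ring
  have hX2 : (I.X.card : ℝ) ≤ I.m * I.n := by
    exact_mod_cast I.card_X_le.trans (Nat.mul_le_mul_left _ I.card_vs_le_n)
  have hmm : (I.m : ℝ) ≤ I.m ^ 2 := by
    have := Nat.le_mul_self I.m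
    calc (I.m : ℝ) ≤ ((I.m * I.m : ℕ) : ℝ) := by exact_mod_cast this
      _ = _ := by push_cast; ring
  have key : (k : ℝ) ≤ 1 + 2 * (I.m * I.n * Lg) ∧
      (I.X.card : ℝ) * k ≤ 2 * I.m ^ 2 + 2 * (I.m * I.n * Lg) := by
    rcases Nat.eq_zero_or_pos k with rfl | hk0
    · constructor
      · push_cast; positivity
      · push_cast; rw [mul_zero]; positivity
    have h1 := hK (k - 1) (by omega)
    have hm1 : 0 < I.m := by
      by_contra hm
      have := I.mx_le
      rw [Nat.eq_zero_of_not_pos hm] at this h1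
      simp at this
      omega
    have hn1 : 0 < I.n := lt_of_le_of_lt (Nat.zero_le _) I.s_lt
    have hm1' : (1 : ℝ) ≤ I.m := by exact_mod_cast hm1
    have hn1' : (1 : ℝ) ≤ I.n := by exact_mod_cast hn1
    have h2 : (2 : ℝ) ^ (k - 1) ≤ c / I.m := by
      rw [le_div_iff₀ (by linarith)]
      have : 2 ^ (k - 1) * I.m ≤ c := by rw [Nat.mul_comm]; omega
      exact_mod_cast this
    have h3 : ((k - 1 : ℕ) : ℝ) * Real.log 2 ≤ Lg := by
      rw [← Real.log_pow]
      exact (Real.log_le_log (by positivity) h2).trans (le_max_right _ _)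
    have h4 := Real.log_two_gt_d9
    rw [Nat.cast_sub hk0, Nat.cast_one] at h3
    have hk1 : (1 : ℝ) ≤ k := by exact_mod_cast hk0
    have h5 : (k : ℝ) ≤ 1 + 2 * Lg := by nlinarith
    have h6 : Lg ≤ I.m * I.n * Lg := le_mul_of_one_le_left hL (by nlinarith)
    refine ⟨by linarith, ?_⟩
    calc (I.X.card : ℝ) * k ≤ I.X.card * (1 + 2 * Lg) := mul_le_mul_of_nonneg_left h5 (Nat.cast_nonneg _)
      _ = I.X.card + 2 * (I.X.card * Lg) := by ring
      _ ≤ (I.m ^ 2 + I.m) + 2 * (I.m * I.n * Lg) :=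
          add_le_add hX1 (by have := mul_le_mul_of_nonneg_right hX2 hL; linarith)
      _ ≤ _ := by linarith
  have := I.total_le
  rw [hkk] at this
  have h7 : ((2 * (I.m * I.m) + 28 * I.m + 9 * I.K + I.pot₀ + 19 : ℕ) : ℝ) ≤
      367 * (I.m : ℝ) ^ 2 + 9 * k + 30 * (I.X.card * k) + 51 := by
    refine (Nat.cast_le.2 this).trans (le_of_eq ?_)
    push_cast
    ring
  have h8 : 0 ≤ I.m * I.n * Lg := by positivity
  have h9 : 0 ≤ (I.m : ℝ) ^ 2 := by positivity
  obtain ⟨k1, k2⟩ := key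
  linarith

/-- A bound on all words. -/
def words (I : Inst) : ℕ :=
  3 + 3 * I.m + I.n + 32 * (I.m * I.n + 2) + 4 * I.HB + 4 * I.pot₀ + I.m + I.n + 100

/-- As `m ≤ n * n`, all quantities involved, including `2 ^ (K - 2)`, are polynomial in `N = n + c +
2`. The constants are absorbed into powers of `N ≥ 2`, and the exponent `40` is generous. -/
theorem words_le {c : ℕ} (hc : I.mx ≤ c) (hm : I.m ≤ I.n * I.n)
    (hK : ∀ k, k + 2 < I.K → I.m * 2 ^ k < I.mx) :
    3 + 3 * I.m + I.n + 32 * I.words + 64 ≤ (I.n + c + 2) ^ 40 := by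
  set N := I.n + c + 2 with hN
  obtain ⟨k, hk⟩ := Nat.exists_eq_add_of_le I.K2
  have hkk : I.K - 2 = k := by omega
  have hQ : I.Q = 2 ^ k := by rw [Q, hkk]
  set M := N * N with hM
  have hN2 : 2 ≤ N := by omega
  have hNM : 2 * N ≤ M := Nat.mul_le_mul_right _ hN2
  have hmM : I.m ≤ M := hm.trans (Nat.mul_le_mul (by omega) (by omega))
  have hQM : 2 ^ k ≤ M := by
    rcases Nat.eq_zero_or_pos k with rfl | hk0
    · simp; omega
    · have h1 := hK (k - 1) (by omega)
      have hm1 : 0 < I.m := by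
        by_contra hm
        have := I.mx_le
        rw [Nat.eq_zero_of_not_pos hm] at this h1
        simp at this
        omega
      have h2 : 2 ^ (k - 1) ≤ I.m * 2 ^ (k - 1) := Nat.le_mul_of_pos_left _ hm1
      have h3 : 2 ^ k = 2 * 2 ^ (k - 1) := by
        rw [← pow_succ', Nat.sub_add_cancel hk0]
      omega
  have hkM : k ≤ M := (Nat.lt_two_pow_self).le.trans hQM
  have hX : I.X.card ≤ M * M :=
    (I.card_X_le.trans (Nat.mul_le_mul_left _ I.card_vs_le_n)).trans
      (Nat.mul_le_mul hmM (by omega))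
  set R := M * M * M with hR
  have hM1 : 1 ≤ M := by omega
  have r2 : M * M ≤ R := Nat.le_mul_of_pos_right _ hM1
  have r1 : M ≤ R := (Nat.le_mul_of_pos_right M hM1).trans r2
  have b1 : I.m * I.m ≤ R := (Nat.mul_le_mul hmM hmM).trans r2
  have b2 : I.m * I.n ≤ R := (Nat.mul_le_mul hmM (by omega)).trans r2
  have b3 : I.m * I.mx ≤ R := (Nat.mul_le_mul hmM (by omega)).trans r2
  have b4 : I.X.card * k ≤ R := Nat.mul_le_mul hX hkM
  have ht := I.total_le
  rw [hkk] at ht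
  have hHB : I.HB = I.K + 2 + I.EM + 3 * I.Q + I.mx := rfl
  have hEM : I.EM = I.m * I.mx := rfl
  have fin : 3 + 3 * I.m + I.n + 32 * I.words + 64 ≤ 2 ^ 20 * R := by
    unfold words
    omega
  refine fin.trans ?_
  calc 2 ^ 20 * R ≤ N ^ 20 * R := Nat.mul_le_mul_right _ (Nat.pow_le_pow_left hN2 _)
    _ = N ^ 26 := by rw [hR, hM]; ring
    _ ≤ N ^ 40 := Nat.pow_le_pow_right (by omega) (by omega)

end Inst

/-! ### Walks and paths -/

namespace Network

variable {n : ℕ} (G : Network n)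

theorem pathEdges_cons_cons (a b : Fin n) (l : List (Fin n)) :
    pathEdges (a :: b :: l) = (a, b) :: pathEdges (b :: l) := rfl

theorem pathEdges_append_cons : ∀ (p : List (Fin n)) (u : Fin n) (q : List (Fin n)),
    pathEdges (p ++ u :: q) = pathEdges (p ++ [u]) ++ pathEdges (u :: q)
  | [], _, _ => rfl
  | [a], u, q => rfl
  | a :: b :: p, u, q => by
    have := pathEdges_append_cons (b :: p) u q
    simp only [List.cons_append, pathEdges_cons_cons] at this ⊢
    rw [this]

theorem pathEdges_concat (p : List (Fin n)) (u v : Fin n) :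
    pathEdges (p ++ [u] ++ [v]) = pathEdges (p ++ [u]) ++ [(u, v)] := by
  rw [List.append_assoc, List.singleton_append, pathEdges_append_cons]
  rfl

theorem le_bottleneck_iff (f : ℝ≥0∞) (p : List (Fin n)) :
    f ≤ G.bottleneck p ↔ ∀ e ∈ pathEdges p, f ≤ G.cap e := by
  unfold bottleneck
  induction pathEdges p with
  | nil => simp
  | cons a l ih => simp [ih]

theorem pathEdges_nodup {p : List (Fin n)} (h : p.Nodup) : (pathEdges p).Nodup := by
  refine List.Nodup.of_map Prod.snd ?_
  rw [pathEdges, List.map_snd_zip (by simp)]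
  exact h.tail

variable (s : Fin n) (L : List (Fin n × Fin n))

/-- The costs by edge numbers. -/
def costAt (e : ℕ) : ℕ := (L[e]?).elim 0 G.cost

theorem exists_level : ∃ k, (Finset.range L.length).sup (G.costAt L) ≤ L.length * 2 ^ k := by
  rcases Nat.eq_zero_or_pos L.length with h | h
  · exact ⟨0, by simp [h]⟩
  · exact ⟨_, Nat.lt_two_pow_self.le.trans (Nat.le_mul_of_pos_left _ h)⟩

/-- The instance that belongs to a network and an enumeration of its edges. -/
noncomputable def inst : Inst where
  n := n
  m := L.length
  s := s
  mx := (Finset.range L.length).sup (G.costAt L)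
  K := Nat.find (G.exists_level L) + 2
  tl e := (L[e]?).elim 0 fun x => x.1.val
  hd e := (L[e]?).elim 0 fun x => x.2.val
  wt := G.costAt L
  cp e := (L.map G.cap).getD e 0
  s_lt := s.2
  tl_lt e he := by simp [he]
  hd_lt e he := by simp [he]
  wt_le e he := Finset.le_sup (f := G.costAt L) (Finset.mem_range.2 he)
  K2 := by omega
  mx_le := by simpa using Nat.find_spec (G.exists_level L)

variable {G L s}

theorem inst_min {k : ℕ} (hk : k + 2 < (G.inst s L).K) :
    (G.inst s L).m * 2 ^ k < (G.inst s L).mx :=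
  not_le.1 (Nat.find_min (G.exists_level L) (by simpa [inst] using hk))

theorem inst_mx_le {c : ℕ} (hc : G.CostsBoundedBy c) (hL : G.Enumerates L) :
    (G.inst s L).mx ≤ c := by
  show (Finset.range L.length).sup (G.costAt L) ≤ c
  refine Finset.sup_le fun e he => ?_
  have he := Finset.mem_range.1 he
  simpa [costAt, he] using hc _ ((hL.2 _).1 (List.getElem_mem he))

theorem inst_edge {e : ℕ} (he : e < L.length) : (G.inst s L).tl e = (L[e]).1 ∧
    (G.inst s L).hd e = (L[e]).2 ∧ (G.inst s L).wt e = G.cost L[e] ∧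
    (G.inst s L).cp e = G.cap L[e] := by
  refine ⟨?_, ?_, ?_, ?_⟩ <;> simp [inst, costAt, he]
  rfl

theorem inst_m (hL : G.Enumerates L) : L.length = G.edges.card := by
  rw [← List.toFinset_card_of_nodup hL.1]
  congr 1
  ext e
  simp [hL.2]

/-- The edges of a simple path are distinct, so there are at most `m` of them. This is why the
search may stop beyond `EM`. -/
theorem IsPath.cost_le (hL : G.Enumerates L) {v : Fin n} {p : List (Fin n)} (h : G.IsPath s v p) :
    G.pathCost p ≤ (G.inst s L).EM := by
  have h1 : (pathEdges p).length ≤ L.length := by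
    rw [inst_m hL, ← List.toFinset_card_of_nodup (pathEdges_nodup h.2.2.1)]
    refine Finset.card_le_card fun e he => h.2.2.2 e (List.mem_toFinset.1 he)
  have h2 : G.pathCost p ≤ (pathEdges p).length * (G.inst s L).mx := by
    unfold pathCost
    have := List.sum_le_card_nsmul ((pathEdges p).map G.cost) (G.inst s L).mx ?_
    · simpa using this
    · intro x hx
      obtain ⟨e, he, rfl⟩ := List.mem_map.1 hx
      obtain ⟨i, hi, rfl⟩ := List.getElem_of_mem ((hL.2 e).2 (h.2.2.2 e he))
      rw [← (inst_edge (s := s) hi).2.2.1]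
      exact (G.inst s L).wt_le i hi
  exact h2.trans (Nat.mul_le_mul_right _ h1)

theorem reach_of_path (hL : G.Enumerates L) (i : ℕ) : ∀ (p : List (Fin n)) (v : Fin n),
    p.head? = some s → p.getLast? = some v → (∀ e ∈ pathEdges p, e ∈ G.edges) →
    (∀ e ∈ pathEdges p, (G.inst s L).cp i ≤ G.cap e) →
    (G.inst s L).Reach i v (G.pathCost p) := by
  intro p
  induction p using List.reverseRecOn with
  | nil => simp
  | append_singleton q v' ih =>
    intro v h1 h2 h3 h4
    obtain rfl : v' = v := by simpa using h2
    rcases List.eq_nil_or_concat q with rfl | ⟨q', u, rfl⟩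
    · obtain rfl : v' = s := by simpa using h1
      exact .src
    · rw [List.concat_eq_append] at *
      rw [pathEdges_concat] at h3 h4
      have hr := ih u (by cases q' <;> simpa using h1) (by simp)
        (fun e he => h3 e (List.mem_append_left _ he)) fun e he => h4 e (List.mem_append_left _ he)
      obtain ⟨e, he, hev⟩ := List.getElem_of_mem ((hL.2 (u, v')).2 (h3 _ (by simp)))
      obtain ⟨e1, e2, e3, e4⟩ := inst_edge (G := G) (s := s) he
      rw [hev] at e1 e2 e3 e4
      have hcost : G.pathCost (q' ++ [u] ++ [v']) = G.pathCost (q' ++ [u]) + (G.inst s L).wt e := by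
        unfold pathCost
        rw [pathEdges_concat, e3]
        simp
      rw [hcost]
      have := Inst.Reach.step (I := G.inst s L) (i := i) (e := e) (by rw [e1]; exact hr) he
        (by rw [e4]; exact h4 _ (by simp))
      rwa [e2] at this

/-- A walk that returns to a vertex of the path found so far is cut back to that vertex. Costs are
non-negative and the edges that remain are among the old ones, so neither cost nor capacity gets
worse. -/
theorem path_of_reach (hL : G.Enumerates L) {i v d : ℕ} (h : (G.inst s L).Reach i v d) :
    ∀ v' : Fin n, v'.val = v → ∃ p, G.IsPath s v' p ∧
      (∀ e ∈ pathEdges p, (G.inst s L).cp i ≤ G.cap e) ∧ G.pathCost p ≤ d := by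
  induction h with
  | src =>
    intro v' hv
    obtain rfl : v' = s := Fin.ext hv
    exact ⟨[v'], ⟨rfl, rfl, by simp, by simp [pathEdges]⟩, by simp [pathEdges],
      by simp [pathCost, pathEdges]⟩
  | @step d e hr he hc ih =>
    intro v' hv
    obtain ⟨e1, e2, e3, e4⟩ := inst_edge (G := G) (s := s) he
    obtain ⟨p, ⟨p1, p2, p3, p4⟩, p5, p6⟩ := ih (L[e]).1 e1.symm
    have hv' : v' = (L[e]).2 := Fin.ext (hv.trans e2)
    by_cases hm : v' ∈ p
    · obtain ⟨a, b, rfl⟩ := List.append_of_mem hm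
      rw [pathEdges_append_cons] at p4 p5
      refine ⟨a ++ [v'], ⟨?_, by simp, ?_, fun x hx => p4 x (List.mem_append_left _ hx)⟩,
        fun x hx => p5 x (List.mem_append_left _ hx), ?_⟩
      · cases a <;> simpa using p1
      · exact p3.sublist (by simp)
      · have : G.pathCost (a ++ [v']) ≤ G.pathCost (a ++ v' :: b) := by
          unfold pathCost
          rw [pathEdges_append_cons a v' b]
          simp
        omega
    · rcases List.eq_nil_or_concat p with rfl | ⟨q, u, rfl⟩
      · simp at p1
      · rw [List.concat_eq_append] at *
        have hu : u = (L[e]).1 := by simpa using p2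
        have hL' : (u, v') = L[e] := by rw [hu, hv']
        have hE : ∀ x ∈ pathEdges (q ++ [u] ++ [v']), x ∈ pathEdges (q ++ [u]) ∨ x = L[e] := by
          intro x hx
          rw [pathEdges_concat, hL'] at hx
          simpa using hx
        refine ⟨q ++ [u] ++ [v'], ⟨?_, by simp, ?_, fun x hx => ?_⟩, fun x hx => ?_, ?_⟩
        · cases q <;> simpa using p1
        · rw [List.nodup_append]
          refine ⟨p3, by simp, ?_⟩
          intro a ha b hb hab
          simp only [List.mem_singleton] at hb
          exact hm (by rw [← hb, ← hab]; exact ha)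
        · rcases hE x hx with h | rfl
          · exact p4 x h
          · exact (hL.2 _).1 (List.getElem_mem he)
        · rcases hE x hx with h | rfl
          · exact p5 x h
          · rw [← e4]; exact hc
        · have : G.pathCost (q ++ [u] ++ [v']) = G.pathCost (q ++ [u]) + G.cost L[e] := by
            unfold pathCost
            rw [pathEdges_concat, hL']
            simp
          rw [this, e3]
          omega

end Network

/-! ### The final memory holds a solution -/

theorem RCh.recordList {B : ℕ} {rn mem : ℕ → ℕ} (hm : ∀ a, mem (B + 32 * a + 3) = rn a) :
    ∀ {l : List ℕ}, (∀ a ∈ l, 1 ≤ a) → RCh B rn l →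
      RecordList mem (adrOf B (l.headD 0)) (l.map fun a => B + 32 * a)
  | [], _, _ => .nil
  | a :: l, h1, h => by
    have ha : 1 ≤ a := h1 a (by simp)
    have e : adrOf B ((a :: l).headD 0) = B + 32 * a := by
      simp [adrOf, show a ≠ 0 by omega]
    rw [e, List.map_cons]
    refine .cons (by omega) ?_
    rw [hm, h.1]
    exact RCh.recordList hm (fun b hb => h1 b (by simp [hb])) h.2

namespace Network

variable {n : ℕ} {G : Network n} {s : Fin n} {L : List (Fin n × Fin n)} {E : Env}
  {recs : ℕ → List ℕ} {ρ : ℕ → ℕ} {st : St} {σ : Config}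

theorem IsDistFlow.reach (hL : G.Enumerates L) {v : Fin n} {d : ℕ} {f : ℝ≥0}
    (h : G.IsDistFlow s v d f) : ∃ i < L.length, (G.inst s L).cp i = f ∧
      d ≤ (G.inst s L).EM ∧ (G.inst s L).Reach i v d := by
  obtain ⟨⟨e, he, rfl⟩, ⟨p, hp, hb, rfl⟩, -⟩ := h
  obtain ⟨i, hi, rfl⟩ := List.getElem_of_mem ((hL.2 e).2 he)
  have hc := (inst_edge (G := G) (s := s) hi).2.2.2
  refine ⟨i, hi, hc, hp.cost_le hL, reach_of_path hL i p v hp.1 hp.2.1 hp.2.2.2 fun e he => ?_⟩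
  rw [hc]
  exact_mod_cast (G.le_bottleneck_iff _ p).1 hb e he

theorem isDistFlow_of_solved (hL : G.Enumerates L) (h : Solved (G.inst s L) E recs ρ st)
    {v : Fin n} {a : ℕ} (ha : a ∈ recs v) :
    G.IsDistFlow s v (st.a .rd a) ((G.inst s L).cp (st.a .rf a)) := by
  have hi := h.rf_lt v v.2 a ha
  have hc := (inst_edge (G := G) (s := s) hi).2.2.2
  have low : ∀ p, G.IsPath s v p →
      (((G.inst s L).cp (st.a .rf a) : ℝ≥0) : ℝ≥0∞) ≤ G.bottleneck p →
      st.a .rd a ≤ G.pathCost p := fun p hp hb => by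
    refine h.least v v.2 a ha _ (hp.cost_le hL)
      (reach_of_path hL _ p v hp.1 hp.2.1 hp.2.2.2 fun e he => ?_)
    exact_mod_cast (G.le_bottleneck_iff _ p).1 hb e he
  obtain ⟨p, hp, h1, h2⟩ := path_of_reach hL (h.reach v v.2 a ha) v rfl
  have hb : (((G.inst s L).cp (st.a .rf a) : ℝ≥0) : ℝ≥0∞) ≤ G.bottleneck p :=
    (G.le_bottleneck_iff _ p).2 fun e he => by exact_mod_cast h1 e he
  refine ⟨⟨_, (hL.2 _).1 (List.getElem_mem hi), hc.symm⟩, ⟨p, hp, hb, ?_⟩, ?_⟩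
  · exact le_antisymm h2 (low p hp hb)
  · rintro _ ⟨q, hq, hb, rfl⟩
    exact low q hq hb

/-- Of two records of a vertex, the one that is not longer accommodates less. -/
theorem solved_cmp (h : Solved (G.inst s L) E recs ρ st) {v a b : ℕ} (hv : v < n)
    (ha : a ∈ recs v) (hb : b ∈ recs v) (hd : st.a .rd b ≤ st.a .rd a) :
    a = b ∨ st.a .rd b < st.a .rd a ∧
      (G.inst s L).cp (st.a .rf b) < (G.inst s L).cp (st.a .rf a) := by
  by_contra hne
  rw [not_or] at hne
  rcases List.pairwise_iff_getElem.1 (h.pw v hv) with key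
  obtain ⟨i, hi, rfl⟩ := List.getElem_of_mem ha
  obtain ⟨j, hj, rfl⟩ := List.getElem_of_mem hb
  rcases lt_trichotomy i j with hij | rfl | hij
  · exact hne.2 (key i j hi hj hij)
  · exact hne.1 rfl
  · have := (key j i hj hi hij).1
    omega

/-- By `Solved.cov`, every distance and flow is dominated by a record, and the records of a vertex
do not dominate each other. Hence the records are exactly the undominated pairs. -/
theorem usefulPairs_eq (hL : G.Enumerates L) (h : Solved (G.inst s L) E recs ρ st) (v : Fin n) :
    {x | x ∈ (recs v).map fun a => (st.a .rd a, (G.inst s L).cp (st.a .rf a))} =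
      G.usefulPairs s v := by
  ext ⟨d, f⟩
  simp only [Set.mem_ofPred_eq, List.mem_map, Prod.mk.injEq, usefulPairs]
  constructor
  · rintro ⟨a, ha, rfl, rfl⟩
    refine ⟨isDistFlow_of_solved hL h ha, fun d' f' h' => ?_⟩
    obtain ⟨i, hi, rfl, hd, hr⟩ := h'.reach hL
    obtain ⟨b, hb, h1, h2⟩ := h.cov i hi v v.2 d' hd hr
    constructor
    · intro hlt
      rcases solved_cmp h v.2 ha hb (by omega) with rfl | ⟨-, h3⟩
      · omega
      · exact h2.trans_lt h3
    · intro he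
      rcases solved_cmp h v.2 ha hb (by omega) with rfl | ⟨-, h3⟩
      · exact h2
      · exact h2.trans h3.le
  · rintro ⟨h1, h2⟩
    obtain ⟨i, hi, rfl, hd, hr⟩ := h1.reach hL
    obtain ⟨a, ha, h3, h4⟩ := h.cov i hi v v.2 d hd hr
    obtain ⟨h5, h6⟩ := h2 _ _ (isDistFlow_of_solved hL h ha)
    rcases h3.lt_or_eq with h3 | h3
    · exact absurd (h5 h3) (not_lt.2 h4)
    · exact ⟨a, ha, h3, le_antisymm (h6 h3) h4⟩

/-- Following the pointers, either the flow strictly increases or it stays and `ρ` decreases, so an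
induction on the number of edges with greater capacity and then on `ρ` terminates. The last
conjunct, which compares the records met on the way with `a`, is carried through the induction to
show that the path is simple. -/
theorem retrieves (hL : G.Enumerates L) (h : Solved (G.inst s L) E recs ρ st)
    (hS : Sim E st σ) (v : Fin n) (hv : v ≠ s) (a : ℕ) (ha : a ∈ recs v) :
    ∃ p, Retrieves σ.mem s (fun v => (recs v).map fun a => E.B + 32 * a) v (E.B + 32 * a) p ∧
      G.IsPath s v p ∧ G.pathCost p = st.a .rd a ∧
      (∀ e ∈ pathEdges p, (G.inst s L).cp (st.a .rf a) ≤ G.cap e) ∧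
      ∀ w ∈ p, w = s ∨ ∃ b ∈ recs w, st.a .rd b ≤ st.a .rd a ∧ (b = a ∨
        ((G.inst s L).cp (st.a .rf a) < (G.inst s L).cp (st.a .rf b) ∨
          (G.inst s L).cp (st.a .rf a) = (G.inst s L).cp (st.a .rf b) ∧ ρ b < ρ a)) := by
  set J := G.inst s L with hJ
  set C : ℕ → ℝ≥0 := fun a => J.cp (st.a .rf a) with hC
  generalize hN : ((Finset.range J.m).filter fun i => C a < J.cp i).card = N
  generalize hr : ρ a = r
  induction N using Nat.strong_induction_on generalizing r v a with
  | _ N ihN =>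
  induction r using Nat.strong_induction_on generalizing v a with
  | _ r ihr =>
  obtain ⟨e, he, b, hb, h1, h2, h3, h4, h5, h6⟩ :=
    h.prd v v.2 (fun h => hv (Fin.ext h)) a ha
  obtain ⟨e1, e2, e3, e4⟩ := inst_edge (G := G) (s := s) (L := L) he
  have hmem : (L[e]'he) ∈ G.edges := (hL.2 _).1 (List.getElem_mem he)
  have hLe : L[e]'he = ((L[e]'he).1, v) := by
    have : v = (L[e]'he).2 := Fin.ext (h1.symm.trans e2)
    rw [this]
  set u := (L[e]'he).1 with hu
  have hRa : E.B + 32 * a ∈ (recs v).map fun a => E.B + 32 * a := List.mem_map_of_mem ha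
  have hm1 : σ.mem (E.B + 32 * a + 1) = u.val := (hS.a .rp a).trans (h3.trans e1)
  have hm2 : σ.mem (E.B + 32 * a + 2) = E.B + 32 * b := (hS.a .rr a).trans h4
  rw [hJ, e1] at hb
  rw [hJ, e3] at h5
  rw [hJ, e4] at h2
  by_cases hus : u = s
  -- The empty walk reaches the source at cost `0` for every flow, so the distance of any record of
  -- the source is `0`.
  · have hb0 : st.a .rd b = 0 := by
      have := h.least u u.2 b hb 0 (Nat.zero_le _) (by rw [hus]; exact .src)
      omega
    refine ⟨[s, v], .source hRa (hus ▸ hm1), ⟨rfl, rfl, by simpa using hv.symm, ?_⟩, ?_, ?_, ?_⟩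
    · intro x hx
      obtain rfl : x = (s, v) := by simpa [pathEdges] using hx
      rw [← hus, ← hLe]; exact hmem
    · rw [h5, hb0, hLe, hus]; simp [pathCost, pathEdges]
    · intro x hx
      obtain rfl : x = (s, v) := by simpa [pathEdges] using hx
      rw [← hus, ← hLe]; exact h2
    · intro w hw
      rcases List.mem_cons.1 hw with rfl | hw
      · exact .inl rfl
      · obtain rfl := List.mem_singleton.1 hw
        exact .inr ⟨a, ha, le_rfl, .inl rfl⟩
  · have ih : ∃ p, Retrieves σ.mem s (fun v => (recs v).map fun a => E.B + 32 * a) u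
        (E.B + 32 * b) p ∧ G.IsPath s u p ∧ G.pathCost p = st.a .rd b ∧
        (∀ e ∈ pathEdges p, C b ≤ G.cap e) ∧
        ∀ w ∈ p, w = s ∨ ∃ b' ∈ recs w, st.a .rd b' ≤ st.a .rd b ∧ (b' = b ∨
          (C b < C b' ∨ C b = C b' ∧ ρ b' < ρ b)) := by
      rcases h6 with h6 | ⟨h6, h7⟩
      · refine ihN _ ?_ u hus b hb rfl (ρ b) rfl
        rw [← hN]
        refine Finset.card_lt_card ⟨fun i hi => ?_, fun hsub => ?_⟩
        · simp only [Finset.mem_filter] at hi ⊢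
          exact ⟨hi.1, lt_trans h6 hi.2⟩
        · have := hsub (Finset.mem_filter.2
            ⟨Finset.mem_range.2 (h.rf_lt u u.2 b hb), h6⟩)
          exact lt_irrefl _ (Finset.mem_filter.1 this).2
      · refine ihr _ (hr ▸ h7) u hus b hb ?_ rfl
        rw [← hN]
        show _ = ((Finset.range J.m).filter fun i => J.cp (st.a .rf a) < J.cp i).card
        rw [h6]
    have hCab : C a ≤ C b := by
      rcases h6 with h6 | ⟨h6, -⟩
      exacts [h6.le, h6.le]
    obtain ⟨p, p1, ⟨p2, p3, p4, p5⟩, p6, p7, p8⟩ := ih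
    have q8 : ∀ w ∈ p, w = s ∨ ∃ b' ∈ recs w, st.a .rd b' ≤ st.a .rd a ∧
        (C a < C b' ∨ C a = C b' ∧ ρ b' < ρ a) := by
      intro w hw
      rcases p8 w hw with h | ⟨b', hb', h8, h9⟩
      · exact .inl h
      · refine .inr ⟨b', hb', by omega, ?_⟩
        rcases h9 with rfl | h9 | ⟨h9, h10⟩
        · exact h6
        · exact .inl (hCab.trans_lt h9)
        · rcases h6 with h6 | ⟨h6, h7⟩
          · exact .inl (h6.trans_eq h9)
          · exact .inr ⟨h6.trans h9, h10.trans h7⟩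
    -- A second visit to `v` would use a record that is not longer than `a`. It cannot be `a`, which
    -- would have to come after itself in the order; any other such record has smaller flow, whereas
    -- the flow does not decrease along the pointers.
    have hvp : v ∉ p := fun hvp => by
      rcases q8 v hvp with h | ⟨b', hb', h8, h9⟩
      · exact hv h
      · rcases solved_cmp h v.2 ha hb' h8 with rfl | ⟨-, h10⟩
        · rcases h9 with h9 | ⟨-, h9⟩
          exacts [lt_irrefl _ h9, lt_irrefl _ h9]
        · rcases h9 with h9 | ⟨h9, -⟩
          exacts [lt_asymm h9 h10, h10.ne' h9]
    rcases List.eq_nil_or_concat p with rfl | ⟨q, u', rfl⟩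
    · simp at p2
    rw [List.concat_eq_append] at *
    obtain rfl : u' = u := by simpa using p3
    have hE : ∀ x ∈ pathEdges (q ++ [u] ++ [v]), x ∈ pathEdges (q ++ [u]) ∨ x = L[e]'he := by
      intro x hx
      rw [pathEdges_concat, ← hLe] at hx
      simpa using hx
    refine ⟨q ++ [u] ++ [v], .step hRa hm1 hus (hm2 ▸ p1), ⟨?_, by simp, ?_, fun x hx => ?_⟩, ?_,
      fun x hx => ?_, fun w hw => ?_⟩
    · cases q <;> simpa using p2
    · rw [List.nodup_append]
      refine ⟨p4, by simp, ?_⟩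
      rintro x hx y hy rfl
      exact hvp (List.mem_singleton.1 hy ▸ hx)
    · rcases hE x hx with h | rfl
      · exact p5 x h
      · exact hmem
    · rw [h5, ← p6]
      unfold pathCost
      rw [pathEdges_concat, ← hLe]
      simp
    · rcases hE x hx with h | rfl
      · exact hCab.trans (p7 x h)
      · exact h2
    · rcases List.mem_append.1 hw with hw | hw
      · rcases q8 w hw with h | ⟨b', h, h', h''⟩
        exacts [.inl h, .inr ⟨b', h, h', .inr (hr ▸ h'')⟩]
      · obtain rfl := List.mem_singleton.1 hw
        exact .inr ⟨a, ha, le_rfl, .inl rfl⟩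

/-- The first four arrays occupy the offsets `0` to `3` of each block, which is the required layout
of a record. No pair is repeated because the distances in a list strictly decrease. -/
theorem isSolution_of_solved (hL : G.Enumerates L) (hn : E.n = n)
    (h : Solved (G.inst s L) E recs ρ st) (hS : Sim E st σ) : IsSolution G s σ := by
  refine ⟨fun v => (recs v).map fun a => E.B + 32 * a, fun v hv => ?_⟩
  obtain ⟨h1, h2⟩ := h.rch v v.2
  have hmap : (((recs v).map fun a => E.B + 32 * a).map fun a => (σ.mem a, σ.capMem a)) =
      (recs v).map fun a => (st.a .rd a, (G.inst s L).cp (st.a .rf a)) := by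
    rw [List.map_map]
    refine List.map_congr_left fun a ha => ?_
    exact Prod.ext (hS.a .rd a) ((hS.rc a).trans (h.rcc v v.2 a ha))
  rw [hmap]
  refine ⟨?_, ?_, usefulPairs_eq hL h v, ?_⟩
  · rw [hS.r0, hS.o v (hn ▸ v.2), h2]
    exact h1.recordList (hS.a .rn) fun a ha => h.own v v.2 a ha
  · rw [List.nodup_iff_pairwise_ne, List.pairwise_map]
    refine (h.pw v v.2).imp fun hab he => ?_
    have := (Prod.mk.inj he).1
    omega
  · intro x hx
    obtain ⟨a, ha, rfl⟩ := List.mem_map.1 hx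
    obtain ⟨p, p1, p2, p3, p4, -⟩ := retrieves hL h hS v hv a ha
    refine ⟨p, p1, p2, p3.trans (hS.a .rd a).symm, (G.le_bottleneck_iff _ p).2 fun e he => ?_⟩
    rw [hS.rc a, h.rcc v v.2 a ha]
    exact_mod_cast p4 e he

end Network

/-! ### The machine program -/

/-- Compute the addresses of the arrays from the input. -/
def setupCode : List Instr :=
  -- The first load reads `n`, as register `0` is still zero. Registers `3`, `5` and `7` are
  -- scratch; in the end registers `0` and `1` hold `3 + 3 * m` and `3 + 3 * m + n`.
  [.load 5 0, .const 3 1, .load 3 3, .add 7 3 3, .add 7 7 3, .const 3 3, .add 0 3 7, .add 1 0 5]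

/-- The program that solves SSSP-AF. -/
def allFlowsProgram : Program := setupCode ++ solverC.code 8

theorem List.getD_flatMap_three {α : Type*} (f g h : α → ℕ) :
    ∀ (L : List α) (e : ℕ) (he : e < L.length),
      (L.flatMap fun x => [f x, g x, h x]).getD (3 * e) 0 = f L[e] ∧
      (L.flatMap fun x => [f x, g x, h x]).getD (3 * e + 1) 0 = g L[e] ∧
      (L.flatMap fun x => [f x, g x, h x]).getD (3 * e + 2) 0 = h L[e]
  | [], _, he => absurd he (by simp)
  | x :: L, 0, _ => by simp
  | x :: L, e + 1, he => by
    have := List.getD_flatMap_three f g h L e (by simpa using he)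
    simpa [Nat.mul_add] using this

theorem Config.run_halted {P : Program} {σ : Config} (h : σ.Halted P) (t : ℕ) : σ.run P t = σ := by
  have h1 : σ.step P = σ := by
    have : P[σ.pc]? = none := List.getElem?_eq_none h
    simp [Config.step, this]
  exact Function.iterate_fixed h1 t

namespace Network

variable {n : ℕ} (G : Network n) (s : Fin n) (L : List (Fin n × Fin n))

/-- The data for the run of the solver on an input. -/
noncomputable def env : Env where
  n := n
  m := L.length
  W := (G.inst s L).words
  inp := (inputConfig G s L).mem
  cp := (G.inst s L).cp

theorem inputConfig_mem_eq_zero {i : ℕ} (hi : 3 + 3 * L.length ≤ i) :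
    (inputConfig G s L).mem i = 0 := by
  refine List.getD_eq_default _ _ ?_
  rw [List.length_append, List.length_flatMap]
  simp only [List.length_cons, List.length_nil, List.map_const', List.sum_replicate, smul_eq_mul]
  omega

theorem inputConfig_mem_le (i : ℕ) : (inputConfig G s L).mem i ≤ (G.inst s L).words := by
  have hs := s.2
  have hW : n ≤ (G.inst s L).words ∧ L.length ≤ (G.inst s L).words ∧
      (G.inst s L).mx ≤ (G.inst s L).words := by
    have h1 : (G.inst s L).n = n := rfl
    have h2 : (G.inst s L).m = L.length := rfl
    unfold Inst.words Inst.HB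
    omega
  have key : ∀ x ∈ [n, L.length, s.val] ++ L.flatMap fun e => [e.1.val, e.2.val, G.cost e],
      x ≤ (G.inst s L).words := by
    intro x hx
    simp only [List.mem_append, List.mem_cons, List.not_mem_nil, or_false, List.mem_flatMap] at hx
    rcases hx with (rfl | rfl | rfl) | ⟨e, he, rfl | rfl | rfl⟩
    · exact hW.1
    · exact hW.2.1
    · omega
    · have := e.1.2
      omega
    · have := e.2.2
      omega
    · obtain ⟨i, hi, rfl⟩ := List.getElem_of_mem he
      rw [← (inst_edge (s := s) hi).2.2.1]
      exact ((G.inst s L).wt_le i hi).trans hW.2.2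
  show List.getD _ i 0 ≤ _
  rw [List.getD_eq_getElem?_getD]
  cases h : ([n, L.length, s.val] ++ L.flatMap fun e => [e.1.val, e.2.val, G.cost e])[i]? with
  | none => exact Nat.zero_le _
  | some x => exact key x (List.mem_of_getElem? h)

theorem given_env : Given (G.inst s L) (G.env s L) := by
  have key := List.getD_flatMap_three (fun e : Fin n × Fin n => e.1.val)
    (fun e => e.2.val) G.cost L
  have sh : ∀ i, (inputConfig G s L).mem (3 + i) =
      (L.flatMap fun e => [e.1.val, e.2.val, G.cost e]).getD i 0 := fun i => by
    rw [Nat.add_comm]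
    rfl
  refine ⟨rfl, rfl, rfl, rfl, rfl, fun e he => ?_, fun e he => ?_, fun e he => ?_⟩
  · exact (sh _).trans ((key e he).1.trans (inst_edge (s := s) he).1.symm)
  · exact (sh (3 * e + 1)).trans ((key e he).2.1.trans (inst_edge (s := s) he).2.1.symm)
  · exact (sh (3 * e + 2)).trans ((key e he).2.2.trans (inst_edge (s := s) he).2.2.1.symm)

theorem setup_spec (P : Program) (h : CodeAt P 0 setupCode) :
    ∃ σ, Runs P (G.env s L).WW 8 (inputConfig G s L) σ ∧ σ.pc = 8 ∧
      Sim (G.env s L) ⟨fun _ => 0, fun _ _ => 0, fun _ => 0, fun _ => 0⟩ σ := by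
  set W := (G.env s L).WW with hWd
  have hWW : W = 3 + (L.length + L.length + L.length) + n + 32 * (G.inst s L).words + 64 := rfl
  have hO : (G.env s L).O = 3 + (L.length + L.length + L.length) := rfl
  have hB : (G.env s L).B = 3 + (L.length + L.length + L.length) + n := rfl
  set σ₀ := inputConfig G s L with hσ
  have h0 : σ₀.WordsAtMost W :=
    ⟨fun _ => Nat.zero_le _, fun a => (G.inputConfig_mem_le s L a).trans (by omega)⟩
  have R1 : Runs P W 1 σ₀ (σ₀.setReg 5 n) := Runs.setReg h.head h0 rfl (by omega)
  have R2 := Runs.setReg (r := 3) (x := 1) h.tail.head R1.words rfl (by omega)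
  have R3 := Runs.setReg (r := 3) (x := L.length) h.tail.tail.head R2.words rfl (by omega)
  have R4 := Runs.add (x := L.length + L.length) h.tail.tail.tail.head R3.words rfl (by omega)
  have R5 := Runs.add (x := L.length + L.length + L.length) h.tail.tail.tail.tail.head R4.words rfl
    (by omega)
  have R6 := Runs.setReg (r := 3) (x := 3) h.tail.tail.tail.tail.tail.head R5.words rfl (by omega)
  have R7 := Runs.add (x := (G.env s L).O) h.tail.tail.tail.tail.tail.tail.head R6.words rfl
    (by omega)
  have R8 := Runs.add (x := (G.env s L).B) h.tail.tail.tail.tail.tail.tail.tail.head R7.words rfl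
    (by omega)
  have R := R1.trans (R2.trans (R3.trans (R4.trans (R5.trans (R6.trans (R7.trans R8))))))
  refine ⟨_, R, rfl, rfl, rfl, fun x => ?_, fun k i => ?_, fun i _ => ?_, fun i _ => rfl,
    fun i => ?_, fun i _ => rfl, R.words, fun _ => Nat.zero_le _, fun _ _ => Nat.zero_le _,
    fun i _ => G.inputConfig_mem_le s L i⟩
  · have h1 : x.reg ≠ 0 ∧ x.reg ≠ 1 ∧ x.reg ≠ 3 ∧ x.reg ≠ 5 ∧ x.reg ≠ 7 := by
      unfold Vr.reg
      omega
    obtain ⟨h1, h2, h3, h4, h5⟩ := h1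
    simp only [Config.setReg, Function.update_of_ne h1, Function.update_of_ne h2,
      Function.update_of_ne h3, Function.update_of_ne h4, Function.update_of_ne h5]
    rfl
  · exact G.inputConfig_mem_eq_zero s L (by omega)
  · exact G.inputConfig_mem_eq_zero s L (by omega)
  · exact List.getD_eq_default _ _ (by rw [List.length_map]; omega)

variable {G s L}

theorem program_spec (hL : G.Enumerates L) {Λ : ℕ} (hΛ : (solverC.code 0).length ≤ Λ) :
    ∃ T σ, T ≤ 8 + Λ * (2 * ((G.inst s L).m * (G.inst s L).m) +
        28 * (G.inst s L).m + 9 * (G.inst s L).K + (G.inst s L).pot₀ + 19) ∧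
      Runs allFlowsProgram (G.env s L).WW T (inputConfig G s L) σ ∧
      σ.Halted allFlowsProgram ∧ IsSolution G s σ := by
  have hcode : CodeAt allFlowsProgram 0 (setupCode ++ solverC.code 8) :=
    ⟨[], [], by simp [allFlowsProgram], rfl⟩
  obtain ⟨σ₁, R₁, p₁, S₁⟩ := G.setup_spec s L _ hcode.left
  obtain ⟨t, st, hx, recs, ρ, h, ht⟩ := solver_spec (G.given_env s L) rfl rfl
    (fun k hk => inst_min hk) (by
      show _ ≤ (G.inst s L).words
      have : (G.env s L).B = 3 + (L.length + L.length + L.length) + n := rfl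
      have h1 : (G.inst s L).n = n := rfl
      have h2 : (G.inst s L).m = L.length := rfl
      unfold Inst.words
      omega)
    (s := ⟨fun _ => 0, fun _ _ => 0, fun _ => 0, fun _ => 0⟩)
    (fun _ => rfl) (fun _ _ => rfl) fun _ => rfl
  obtain ⟨T, σ₂, hT, R₂, S₂, p₂⟩ := Cmd.code_spec hx S₁ (by rw [p₁]; exact hcode.right) hΛ
  refine ⟨8 + T, σ₂, ?_, R₁.trans R₂, ?_, isSolution_of_solved hL rfl h S₂⟩
  · exact Nat.add_le_add_left (hT.trans (Nat.mul_le_mul_left Λ ht)) 8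
  · rw [Config.Halted, p₂, p₁, allFlowsProgram, List.length_append]
    exact Nat.add_le_add_right (show setupCode.length ≤ 8 from le_rfl) _

end Network

/-! ### The two time bounds -/

theorem allFlowsProgram_solves : SolvesInTime allFlowsProgram fun n m c =>
    (m : ℝ) ^ 2 + (m : ℝ) * (n : ℝ) * Real.posLog ((c : ℝ) / (m : ℝ)) := by
  -- The length of the code is abstracted: it only matters that it does not depend on the input.
  obtain ⟨Λ, hΛ⟩ : ∃ Λ, (solverC.code 0).length ≤ Λ := ⟨_, le_rfl⟩
  refine ⟨8 + 500 * Λ, 40, fun n c G s L hc hL => ?_⟩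
  obtain ⟨T, σ, hT, R, hh, hs⟩ := Network.program_spec (s := s) hL hΛ
  clear hΛ
  have hmx := Network.inst_mx_le (s := s) hc hL
  have hm : (G.inst s L).m = G.edges.card := Network.inst_m hL
  have hK : ∀ k, k + 2 < (G.inst s L).K → (G.inst s L).m * 2 ^ k < (G.inst s L).mx :=
    fun k hk => Network.inst_min hk
  refine ⟨⟨T, ?_, by rw [R.1]; exact hh, by rw [R.1]; exact hs⟩, fun t => ?_⟩
  · have h1 := Inst.total_le_real hmx hK
    have h2 : (0 : ℝ) ≤ (G.edges.card : ℝ) ^ 2 +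
        G.edges.card * n * Real.posLog ((c : ℝ) / G.edges.card) := by
      have := Real.posLog_nonneg (x := (c : ℝ) / G.edges.card)
      positivity
    have h3 : (T : ℝ) ≤ 8 + Λ * ((2 * ((G.inst s L).m * (G.inst s L).m) +
        28 * (G.inst s L).m + 9 * (G.inst s L).K + (G.inst s L).pot₀ + 19 : ℕ) : ℝ) := by
      exact_mod_cast hT
    rw [hm, show (G.inst s L).n = n from rfl] at h1
    have h4 := mul_le_mul_of_nonneg_left h1 (Nat.cast_nonneg (α := ℝ) Λ)
    push_cast
    push_cast at h3 h4
    rw [hm] at h3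
    nlinarith
  · have hW : (G.env s L).WW ≤ (n + c + 2) ^ 40 := by
      have h1 : G.edges.card ≤ n * n := by
        simpa using Finset.card_le_univ G.edges
      have h2 := Inst.words_le hmx (hm ▸ h1) hK
      refine le_trans (le_of_eq ?_) h2
      show 3 + (L.length + L.length + L.length) + n + _ + 64 = 3 + 3 * L.length + n + _ + 64
      congr 2
      omega
    have hw : ((inputConfig G s L).run allFlowsProgram t).WordsAtMost (G.env s L).WW := by
      rcases le_total t T with h | h
      · exact R.2 t h
      · obtain ⟨k, rfl⟩ := Nat.exists_eq_add_of_le h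
        rw [Config.run_add, R.1, Config.run_halted hh]
        exact R.words
    exact ⟨fun i => (hw.1 i).trans hW, fun a => (hw.2 a).trans hW⟩

theorem SolvesInTime.mono {P : Program} {T T' : ℕ → ℕ → ℕ → ℝ} (h : SolvesInTime P T)
    (hT : ∀ n m c, T n m c ≤ T' n m c) : SolvesInTime P T' := by
  obtain ⟨C, K, h⟩ := h
  refine ⟨C, K, fun n c G s L hc hL => ?_⟩
  obtain ⟨⟨t, ht, h1⟩, h2⟩ := h n c G s L hc hL
  refine ⟨⟨t, ht.trans ?_, h1⟩, h2⟩
  have := hT n G.edges.card c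
  gcongr

/-- From `log⁺ x ≤ x` at `x = c / m`, after which `m` cancels; for `m = 0` the left side vanishes.
-/
theorem mul_mul_posLog_div_le (n m c : ℕ) :
    (m : ℝ) * n * Real.posLog ((c : ℝ) / m) ≤ (n : ℝ) * c := by
  rcases Nat.eq_zero_or_pos m with rfl | hm
  · simp only [Nat.cast_zero, zero_mul]
    positivity
  have hm' : (0 : ℝ) < m := by exact_mod_cast hm
  have h0 : (0 : ℝ) ≤ (c : ℝ) / m := by positivity
  have h1 : Real.posLog ((c : ℝ) / m) ≤ (c : ℝ) / m :=
    max_le h0 (Real.log_le_self h0)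
  calc (m : ℝ) * n * Real.posLog ((c : ℝ) / m) ≤ (m : ℝ) * n * ((c : ℝ) / m) := by gcongr
    _ = n * c := by field_simp

theorem mainTheorem2 :
    (∃ P : Program, SolvesInTime P fun n m c => (m : ℝ) ^ 2 + (n : ℝ) * (c : ℝ)) ∧
    (∃ P : Program, SolvesInTime P fun n m c =>
      (m : ℝ) ^ 2 + (m : ℝ) * (n : ℝ) * Real.posLog ((c : ℝ) / (m : ℝ))) :=
  ⟨⟨_, allFlowsProgram_solves.mono fun n m c =>
    add_le_add le_rfl (mul_mul_posLog_div_le n m c)⟩, ⟨_, allFlowsProgram_solves⟩⟩
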